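/- Let $\mathcal O$ be a cyclic operad in vector spaces over a field of characteristic $0$. Let $\mathcal G^{\mathcal O}$ be the space spanned by finite oriented $\mathcal O$-labelled graphs, all of whose vertices have valence $\ge 3$ (loops and multiple edges allowed), modulo isomorphism, multilinearity in the labels and $(G,or)=-(G,-or)$. An orientation is an ordering of the vertices and a direction for each edge, up to even changes; a vertex with set $H(v)$ of half-edges is labelled by $\mathcal O((H(v)))=(\bigoplus_L\mathcal O(n))_{S_{n+1}}$, $L$ running over the labellings of $H(v)$ by $0,\dots,n$. Grade graphs by the number of vertices. Let $\partial_G(G)=\sum_e G_e$ be the sum of all edge contractions, where $G_e$ composes the two labels along $e$ (if $e$ is directed from vertex $1$ to vertex $2$, the new vertex is put first and the others keep their order) and $G_e=0$ for a loop. Let $P\mathcal G^{\mathcal O}$ be the span of the connected (nonempty) graphs, $S(P\mathcal G^{\mathcal O})$ its graded symmetric algebra, $\pi_i$ the projection onto $S^i(P\mathcal G^{\mathcal O})$, and $S:\mathcal G^{\mathcal O}\to S(P\mathcal G^{\mathcal O})$ the map carrying a disjoint union of connected graphs to their product. For $i\ge 1$ and distinct directed edges $e_1,\dots,e_i$ of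 a graph $G$, let $G\langle e_1,\dots,e_i\rangle$ be the result of gluing alternate sides of an oriented $2i$-gon to $e_1,\dots,e_i$ and deleting these edges: if $e_j$ has initial half-edge $x_j$ and terminal half-edge $y_j$, the new edges join $y_j$ with $x_{j+1}$ ($j$ modulo $i$) and, when the $e_j$ are directed as in the orientation of $G$, are directed from $x_{j+1}$ to $y_j$. Put $$\partial_i(G)=\sum_{(e_1,\dots,e_i)}G\langle e_1,\dots,e_i\rangle_{b_1},\qquad \mu_i(G)=\sum_{(e_1,\dots,e_i)}G\langle e_1,\dots,e_i\rangle ,$$ where $b_1$ is the new edge joining $y_1$ and $x_2$. On $P\mathcal G^{\mathcal O}$ put $\theta_i=\tfrac12\,\pi_i\circ S\circ\partial_i$ and $\nu_i=\tfrac1{2i}\,\pi_i\circ S\circ\mu_i$, both with values in $S^i(P\mathcal G^{\mathcal O})$, and extend $\theta_i$ (of degree $-1$), $\nu_i$ (of degree $0$) and $\partial_G|_{P\mathcal G^{\mathcal O}}$ (of degree $-1$; the extension is again denoted $\partial_G$) to $S(P\mathcal G^{\mathcal O})$ as graded derivations. **Proposition.** All these operators are well defined, $\partial_G$ preserves $P\mathcal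 G^{\mathcal O}$, and $\partial_G^2=0$ on $\mathcal G^{\mathcal O}$ and on $S(P\mathcal G^{\mathcal O})$. One has $\theta_1=\partial_G$, and for every $i\ge 1$ the operator $\theta_i$ is compatible with the boundary, $$\partial_G\theta_i+\theta_i\partial_G=0,$$ and induces the zero map on the homology of $(S(P\mathcal G^{\mathcal O}),\partial_G)$. This vanishing is canonical: $\theta_i=\partial_G\nu_i-\nu_i\partial_G$, where $\nu_i$ attaches a $2i$-gon in all possible ways without contracting an edge. -/

import Mathlib

open scoped BigOperators

noncomputable section

/-! ### Cyclic operads -/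

/-- A bijection carrying `x` to `x'` restricts to the complements of `x` and `x'`. -/
def puncture {X Y : Type} (σ : X ≃ Y) {x : X} {y : Y} (h : σ x = y) :
    {a : X // a ≠ x} ≃ {a : Y // a ≠ y} :=
  σ.subtypeEquiv fun a => by rw [← h]; exact (σ.injective.ne_iff).symm

/-- The legs of an operation of arity `n` are labelled by `Fin (n + 1)`, the root being `0` and the
inputs `1, …, n`. When the root of an operation of arity `n` is grafted onto the input number
`i + 1` of an operation of arity `m`, the remaining legs are renumbered in planar order: the legs
`0, …, i` of the first operation keep their numbers, then come the inputs of the second operation,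
then the remaining inputs of the first one. -/
def graftFun {m n l : ℕ} (h : m + n = l + 1) (i : Fin m) :
    {x : Fin (m + 1) // x ≠ i.succ} ⊕ {y : Fin (n + 1) // y ≠ 0} → Fin (l + 1)
  | Sum.inl x =>
      if hx : (x.1 : ℕ) ≤ i then ⟨x.1, by have := i.2; omega⟩
      else ⟨x.1 + n - 1, by have := x.1.2; omega⟩
  | Sum.inr y => ⟨i + y.1, by have := i.2; have := y.1.2; omega⟩

theorem graftFun_bijective {m n l : ℕ} (h : m + n = l + 1) (i : Fin m) :
    Function.Bijective (graftFun h i) := by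
  rw [Fintype.bijective_iff_injective_and_card]
  constructor
  · rintro (⟨x, hx⟩ | ⟨y, hy⟩) (⟨x', hx'⟩ | ⟨y', hy'⟩) e
    all_goals
      simp only [graftFun] at e
      try simp only [ne_eq, Fin.ext_iff, Fin.val_succ] at hx
      try simp only [ne_eq, Fin.ext_iff, Fin.val_succ] at hx'
      try simp only [ne_eq, Fin.ext_iff, Fin.val_zero] at hy
      try simp only [ne_eq, Fin.ext_iff, Fin.val_zero] at hy'
      (try split_ifs at e) <;> simp only [Fin.mk.injEq] at e <;>
      first
      | (exfalso; omega)
      | (congr 1; apply Subtype.ext; apply Fin.ext; simp only []; omega)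
  · simp [Fintype.card_sum, Fintype.card_subtype_compl, h]

/-- The renumbering of the legs under grafting, as a bijection. -/
def graftEquiv {m n l : ℕ} (h : m + n = l + 1) (i : Fin m) :
    {x : Fin (m + 1) // x ≠ i.succ} ⊕ {y : Fin (n + 1) // y ≠ 0} ≃ Fin (l + 1) :=
  Equiv.ofBijective (graftFun h i) (graftFun_bijective h i)

/-- A cyclic operad in vector spaces over `k`. `act n` is the left action of the symmetric group
`S_{n+1}` of all the legs; an element whose leg is numbered `x` has, after the action of `σ`, this
leg numbered `σ x`. `comp h i a b` is the partial composition `a ∘_{i+1} b`, of arity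
`l = m + n - 1`.

`comp_act` says that composition commutes with renumbering the legs, whenever the root of `b` stays
the root and the input of `a` used for grafting stays an input: for permutations fixing `0` this is
the usual equivariance of an operad, for the cyclic rotation of `a` it is the relation
`τ (a ∘_i b) = (τ a) ∘_{i-1} b` for `i ≥ 2`. `comp_exchange` treats the renumberings after which
the grafted input of `a` is the root and the root of `b` is an input; for the cyclic rotations
it is the relation `τ (a ∘_1 b) = (τ b) ∘_n (τ a)`. -/
structure CyclicOperad (k : Type*) [Field k] where
  obj : ℕ → Type*
  [addCommGroup : ∀ n, AddCommGroup (obj n)]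
  [module : ∀ n, Module k (obj n)]
  act : ∀ n, Representation k (Equiv.Perm (Fin (n + 1))) (obj n)
  comp : ∀ {m n l : ℕ}, m + n = l + 1 → Fin m → (obj m →ₗ[k] obj n →ₗ[k] obj l)
  one : obj 1
  one_comp : ∀ {n : ℕ} (h : 1 + n = n + 1) (b : obj n), comp h 0 one b = b
  comp_one : ∀ {m : ℕ} (h : m + 1 = m + 1) (i : Fin m) (a : obj m), comp h i a one = a
  act_one : ∀ σ, act 1 σ one = one
  /-- Sequential associativity: `(a ∘_{i+1} b) ∘_{i+j+1} c = a ∘_{i+1} (b ∘_{j+1} c)`. -/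
  comp_assoc : ∀ {m n p l q r : ℕ} (h₁ : m + n = l + 1) (h₂ : l + p = q + 1)
    (h₃ : n + p = r + 1) (h₄ : m + r = q + 1) (i : Fin m) (j : Fin n) (t : Fin l),
    (t : ℕ) = i + j → ∀ (a : obj m) (b : obj n) (c : obj p),
      comp h₂ t (comp h₁ i a b) c = comp h₄ i a (comp h₃ j b c)
  /-- Parallel associativity: `(a ∘_{i+1} b) ∘_{j+n} c = (a ∘_{j+1} c) ∘_{i+1} b` for `i < j`. -/
  comp_comm : ∀ {m n p l q l' : ℕ} (h₁ : m + n = l + 1) (h₂ : l + p = q + 1)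
    (h₃ : m + p = l' + 1) (h₄ : l' + n = q + 1) (i j : Fin m) (t : Fin l) (t' : Fin l'),
    i < j → (t : ℕ) + 1 = j + n → (t' : ℕ) = i → ∀ (a : obj m) (b : obj n) (c : obj p),
      comp h₂ t (comp h₁ i a b) c = comp h₄ t' (comp h₃ j a c) b
  comp_act : ∀ {m n l : ℕ} (h : m + n = l + 1) (i i' : Fin m)
    (σ : Equiv.Perm (Fin (m + 1))) (τ : Equiv.Perm (Fin (n + 1)))
    (hσ : σ i.succ = i'.succ) (hτ : τ 0 = 0) (a : obj m) (b : obj n),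
      comp h i' (act m σ a) (act n τ b) =
        act l ((graftEquiv h i).symm.trans
          (((puncture σ hσ).sumCongr (puncture τ hτ)).trans (graftEquiv h i')))
          (comp h i a b)
  comp_exchange : ∀ {m n l : ℕ} (h : m + n = l + 1) (h' : n + m = l + 1) (i : Fin m) (j : Fin n)
    (σ : Equiv.Perm (Fin (m + 1))) (τ : Equiv.Perm (Fin (n + 1)))
    (hσ : σ i.succ = 0) (hτ : τ 0 = j.succ) (a : obj m) (b : obj n),
      comp h' j (act n τ b) (act m σ a) =
        act l ((graftEquiv h i).symm.trans
          (((puncture σ hσ).sumCongr (puncture τ hτ)).trans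
            ((Equiv.sumComm _ _).trans (graftEquiv h' j))))
          (comp h i a b)

attribute [instance] CyclicOperad.addCommGroup CyclicOperad.module

section LabelSpace

open scoped Classical

variable {k : Type*} [Field k] (O : CyclicOperad k)

/-- The labellings of the elements of `X` by `0, …, n`. -/
abbrev Labelling (X : Type) : Type := Σ n : ℕ, X ≃ Fin (n + 1)

/-- The direct sum `⨁_L O(n)` over the labellings of `X`. -/
abbrev LabelSum (X : Type) := Π₀ L : Labelling X, O.obj L.1

/-- The element `o_L`: `o` in the summand of `L`. -/
def LabelSum.of {X : Type} (L : Labelling X) : O.obj L.1 →ₗ[k] LabelSum O X :=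
  DFinsupp.lsingle (R := k) (M := fun L : Labelling X => O.obj L.1) L

/-- The linear map on the direct sum with given restrictions to the summands. -/
def LabelSum.lift {X : Type} {M : Type*} [AddCommGroup M] [Module k M]
    (f : ∀ L : Labelling X, O.obj L.1 →ₗ[k] M) : LabelSum O X →ₗ[k] M :=
  DFinsupp.lsum k f

theorem LabelSum.lift_of {X : Type} {M : Type*} [AddCommGroup M] [Module k M]
    (f : ∀ L : Labelling X, O.obj L.1 →ₗ[k] M) (L : Labelling X) (o : O.obj L.1) :
    lift O f (of O L o) = f L o := by
  simp [lift, of]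

/-- The relations `o_L = σ · o_L = (σ · o)_{σ · L}` of the coinvariants. -/
def labelRel (X : Type) : Submodule k (LabelSum O X) :=
  Submodule.span k
    {z | ∃ (L : Labelling X) (σ : Equiv.Perm (Fin (L.1 + 1))) (o : O.obj L.1),
      z = LabelSum.of O L o - LabelSum.of O ⟨L.1, L.2.trans σ⟩ (O.act L.1 σ o)}

/-- The space `O((X)) = (⨁_L O(n))_{S_{n+1}}` attached to a finite set `X` with `n + 1` elements. -/
abbrev LabelSpace (X : Type) := LabelSum O X ⧸ labelRel O X

/-- The class of `o_L`. -/
def LabelSpace.mk {X : Type} {n : ℕ} (L : X ≃ Fin (n + 1)) : O.obj n →ₗ[k] LabelSpace O X :=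
  (labelRel O X).mkQ ∘ₗ LabelSum.of O (⟨n, L⟩ : Labelling X)

/-- The action of a bijection between `{0, …, n'}` and `{0, …, n}` (which forces `n' = n`). -/
def CyclicOperad.relabel {n' n : ℕ} (e : Fin (n' + 1) ≃ Fin (n + 1)) : O.obj n' →ₗ[k] O.obj n :=
  have h : n' = n := by simpa using Fintype.card_congr e
  h.rec (motive := fun n _ => (Fin (n' + 1) ≃ Fin (n + 1)) → (O.obj n' →ₗ[k] O.obj n))
    (fun e => O.act n' e) e

theorem CyclicOperad.relabel_self {n : ℕ} (e : Fin (n + 1) ≃ Fin (n + 1)) :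
    O.relabel e = O.act n e := rfl

theorem CyclicOperad.relabel_act {n' n : ℕ} (σ : Equiv.Perm (Fin (n' + 1)))
    (e : Fin (n' + 1) ≃ Fin (n + 1)) (o : O.obj n') :
    O.relabel e (O.act n' σ o) = O.relabel (σ.trans e) o := by
  obtain rfl : n' = n := by simpa using Fintype.card_congr e
  rw [relabel_self, relabel_self]
  have : (σ.trans e : Equiv.Perm (Fin (n' + 1))) = e * σ := rfl
  rw [this, map_mul]
  rfl

/-- Each labelling `L` identifies `O((X))` with `O(n)`: the inverse of `o ↦ [o_L]`. -/
def LabelSpace.coord {X : Type} {n : ℕ} (L : X ≃ Fin (n + 1)) : LabelSpace O X →ₗ[k] O.obj n :=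
  (labelRel O X).liftQ
    (LabelSum.lift O fun L' : Labelling X => O.relabel (L'.2.symm.trans L)) (by
      rw [labelRel, Submodule.span_le]
      rintro _ ⟨L', σ, o, rfl⟩
      have e : σ.trans ((L'.2.trans σ).symm.trans L) = L'.2.symm.trans L := by
        ext x; simp
      rw [SetLike.mem_coe, LinearMap.mem_ker, map_sub, LabelSum.lift_of, LabelSum.lift_of,
        CyclicOperad.relabel_act, e, sub_self])

theorem LabelSpace.coord_mk {X : Type} {n' n : ℕ} (L' : X ≃ Fin (n' + 1)) (L : X ≃ Fin (n + 1))
    (o : O.obj n') : coord O L (mk O L' o) = O.relabel (L'.symm.trans L) o := by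
  simp only [coord, mk, LinearMap.comp_apply, Submodule.mkQ_apply, Submodule.liftQ_apply]
  rw [LabelSum.lift_of]

theorem LabelSpace.mk_act {X : Type} {n : ℕ} (L : X ≃ Fin (n + 1))
    (σ : Equiv.Perm (Fin (n + 1))) (o : O.obj n) :
    mk O (L.trans σ) (O.act n σ o) = mk O L o := by
  symm
  simp only [mk, LinearMap.comp_apply, Submodule.mkQ_apply]
  exact (Submodule.Quotient.eq _).2 (Submodule.subset_span ⟨⟨n, L⟩, σ, o, rfl⟩)

theorem LabelSpace.mk_coord {X : Type} {n : ℕ} (L : X ≃ Fin (n + 1)) (u : LabelSpace O X) :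
    mk O L (coord O L u) = u := by
  obtain ⟨z, rfl⟩ := (labelRel O X).mkQ_surjective u
  induction z using DFinsupp.induction with
  | h0 => simp
  | ha L' o f _ _ ih =>
    rw [map_add, map_add, map_add, ih]
    congr 1
    obtain ⟨n', L'⟩ := L'
    obtain rfl : n' = n := by simpa using Fintype.card_congr (L'.symm.trans L)
    change mk O L (coord O L (mk O L' o)) = mk O L' o
    rw [coord_mk, CyclicOperad.relabel_self]
    have e : L'.trans (L'.symm.trans L) = L := by ext; simp
    have := mk_act O L' (L'.symm.trans L) o
    rw [e] at this
    exact this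

/-- Transport of `O((X))` along a bijection `X ≃ Y`. -/
def LabelSpace.map {X Y : Type} (f : X ≃ Y) : LabelSpace O X →ₗ[k] LabelSpace O Y :=
  (labelRel O X).liftQ
    (LabelSum.lift O fun L : Labelling X => mk O (f.symm.trans L.2)) (by
      rw [labelRel, Submodule.span_le]
      rintro _ ⟨L, σ, o, rfl⟩
      rw [SetLike.mem_coe, LinearMap.mem_ker, map_sub, LabelSum.lift_of, LabelSum.lift_of]
      rw [← Equiv.trans_assoc, mk_act, sub_self])

/-- Labellings of `X` and `Y` such that `x` is an input and `y` is the root. -/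
structure GraftData {X Y : Type} (x : X) (y : Y) where
  (m n l : ℕ)
  (L : X ≃ Fin (m + 1))
  (M : Y ≃ Fin (n + 1))
  (i : Fin m)
  (hL : L x = i.succ)
  (hM : M y = 0)
  (h : m + n = l + 1)

/-- The labelling of the legs left over after grafting. -/
def GraftData.labelling {X Y : Type} {x : X} {y : Y} (g : GraftData x y) :
    {a : X // a ≠ x} ⊕ {b : Y // b ≠ y} ≃ Fin (g.l + 1) :=
  ((puncture g.L g.hL).sumCongr (puncture g.M g.hM)).trans (graftEquiv g.h g.i)

/-- The composition `([a_L], [b_M]) ↦ [a ∘_i b]`. -/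
def LabelSpace.graftBy {X Y : Type} {x : X} {y : Y} (g : GraftData x y) :
    LabelSpace O X →ₗ[k] LabelSpace O Y →ₗ[k]
      LabelSpace O ({a : X // a ≠ x} ⊕ {b : Y // b ≠ y}) :=
  ((O.comp g.h g.i).compl₁₂ (coord O g.L) (coord O g.M)).compr₂ (mk O g.labelling)

/-- The composition does not depend on the labellings. -/
theorem LabelSpace.graftBy_eq {X Y : Type} {x : X} {y : Y} (g g' : GraftData x y) :
    graftBy O g = graftBy O g' := by
  obtain ⟨m, n, l, L, M, i, hL, hM, h⟩ := g
  obtain ⟨m', n', l', L', M', i', hL', hM', h'⟩ := g'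
  obtain rfl : m' = m := by simpa using Fintype.card_congr (L'.symm.trans L)
  obtain rfl : n' = n := by simpa using Fintype.card_congr (M'.symm.trans M)
  obtain rfl : l' = l := by omega
  refine LinearMap.ext fun u => LinearMap.ext fun w => ?_
  rw [← mk_coord O L u, ← mk_coord O M w]
  generalize coord O L u = a
  generalize coord O M w = b
  simp only [graftBy, LinearMap.compr₂_apply, LinearMap.compl₁₂_apply, coord_mk,
    CyclicOperad.relabel_self]
  have hσ : (L.symm.trans L') i.succ = i'.succ := by simp [← hL, hL']
  have hτ : (M.symm.trans M') 0 = 0 := by simp [← hM, hM']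
  rw [O.comp_act h i i' _ _ hσ hτ]
  have e1 : O.act m' (L.symm.trans L) a = a := by
    rw [Equiv.symm_trans_self]; exact congrArg (fun f => f a) (map_one (O.act m'))
  have e2 : O.act n' (M.symm.trans M) b = b := by
    rw [Equiv.symm_trans_self]; exact congrArg (fun f => f b) (map_one (O.act n'))
  rw [e1, e2, ← mk_act]
  congr 2
  ext z
  rcases z with z | z <;> simp [GraftData.labelling, puncture]

/-- Grafting of `O((X))` and `O((Y))` along `x ∈ X` and `y ∈ Y`. -/
def LabelSpace.graft {X Y : Type} (x : X) (y : Y) :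
    LabelSpace O X →ₗ[k] LabelSpace O Y →ₗ[k]
      LabelSpace O ({a : X // a ≠ x} ⊕ {b : Y // b ≠ y}) :=
  if h : Nonempty (GraftData x y) then graftBy O h.some else 0

theorem LabelSpace.graft_eq {X Y : Type} {x : X} {y : Y} (g : GraftData x y) :
    graft O x y = graftBy O g := by
  rw [graft, dif_pos ⟨g⟩]
  exact graftBy_eq O _ _

end LabelSpace

/-! ### Labelled oriented graphs -/

/-- An oriented `O`-labelled graph, all of whose vertices have valence at least `3`. It has vertices
`V`, edges `E`, and `H v` is the set of half-edges incident to the vertex `v`. The edge `e` consists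
of the half-edges `ends (e, false)` and `ends (e, true)`, so loops and multiple edges are allowed and
the graph need not be connected. The orientation is given by the ordering of the vertices together
with the directions of the edges: `e` is directed from `ends (e, false)` to `ends (e, true)`. -/
structure OGraph {k : Type*} [Field k] (O : CyclicOperad k) where
  V : Type
  E : Type
  H : V → Type
  [fintypeV : Fintype V]
  [linearOrderV : LinearOrder V]
  [fintypeE : Fintype E]
  [fintypeH : ∀ v, Fintype (H v)]
  ends : E × Bool ≃ Σ v, H v
  valence : ∀ v, 3 ≤ Fintype.card (H v)
  label : ∀ v, LabelSpace O (H v)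

attribute [instance] OGraph.fintypeV OGraph.linearOrderV OGraph.fintypeE OGraph.fintypeH

namespace OGraph

open scoped Classical

variable {k : Type*} [Field k] {O : CyclicOperad k}

/-- The same graph with the label of the vertex `v` replaced by `u`. -/
def withLabel (X : OGraph O) (v : X.V) (u : LabelSpace O (X.H v)) : OGraph O :=
  { X with label := Function.update X.label v u }

/-- Isomorphisms of labelled graphs, which need not respect the orientations. An edge `e` is carried
to the edge `E e`, and its direction is reversed when `flip e` holds. -/
structure Iso (X Y : OGraph O) where
  V : X.V ≃ Y.V
  E : X.E ≃ Y.E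
  flip : X.E → Bool
  H : ∀ v, X.H v ≃ Y.H (V v)
  ends : ∀ e s, Y.ends (E e, xor s (flip e)) =
    ⟨V (X.ends (e, s)).1, H _ (X.ends (e, s)).2⟩
  label : ∀ v, Y.label (V v) = LabelSpace.map O (H v) (X.label v)

/-- The effect of an isomorphism on orientations: the sign of the permutation of the vertices (the
parity of its number of inversions) times `-1` for each edge whose direction is reversed. -/
def Iso.sign {X Y : OGraph O} (f : Iso X Y) : ℤˣ :=
  (-1) ^ Fintype.card {p : X.V × X.V // p.1 < p.2 ∧ f.V p.2 < f.V p.1} *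
    (-1) ^ Fintype.card {e : X.E // f.flip e = true}

/-- The vertex at the end `s` of the edge `e`: the start for `s = false`, the terminal vertex for
`s = true`. -/
def vert (X : OGraph O) (e : X.E) (s : Bool) : X.V := (X.ends (e, s)).1

/-- The half-edge of `e` at the end `s`. -/
def half (X : OGraph O) (e : X.E) (s : Bool) : X.H (X.vert e s) := (X.ends (e, s)).2

/-- `e` is a loop. -/
def IsLoop (X : OGraph O) (e : X.E) : Prop := X.vert e false = X.vert e true

/-- Two vertices joined by an edge. -/
def Joined (X : OGraph O) (u v : X.V) : Prop := ∃ e, X.vert e false = u ∧ X.vert e true = v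

/-- Connected graphs are nonempty, and any two vertices are joined by an edge path. -/
def Connected (X : OGraph O) : Prop :=
  Nonempty X.V ∧ ∀ u v, Relation.EqvGen X.Joined u v

/-- The disjoint union of a finite sequence of graphs, the vertices of the earlier graphs coming
first. -/
def disjointUnion {n : ℕ} (X : Fin n → OGraph O) : OGraph O where
  V := Σₗ j, (X j).V
  E := Σ j, (X j).E
  H v := (X (ofLex v).1).H (ofLex v).2
  ends :=
    { toFun := fun p => ⟨toLex ⟨p.1.1, ((X p.1.1).ends (p.1.2, p.2)).1⟩,
        ((X p.1.1).ends (p.1.2, p.2)).2⟩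
      invFun := fun q => (⟨(ofLex q.1).1, ((X (ofLex q.1).1).ends.symm ⟨(ofLex q.1).2, q.2⟩).1⟩,
        ((X (ofLex q.1).1).ends.symm ⟨(ofLex q.1).2, q.2⟩).2)
      left_inv := by
        rintro ⟨⟨j, e⟩, s⟩
        have h : (X j).ends.symm ⟨((X j).ends (e, s)).1, ((X j).ends (e, s)).2⟩ = (e, s) :=
          (X j).ends.symm_apply_apply (e, s)
        change ((⟨j, ((X j).ends.symm ⟨((X j).ends (e, s)).1, ((X j).ends (e, s)).2⟩).1⟩ :
            Σ j, (X j).E),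
          ((X j).ends.symm ⟨((X j).ends (e, s)).1, ((X j).ends (e, s)).2⟩).2) = _
        rw [h]
      right_inv := by
        rintro ⟨v, h⟩
        obtain ⟨⟨j, v⟩, rfl⟩ := toLex.surjective v
        change (X j).H v at h
        have e : (X j).ends ((X j).ends.symm ⟨v, h⟩) = ⟨v, h⟩ := (X j).ends.apply_symm_apply _
        have e' : ∀ q : Σ v, (X j).H v, q = ⟨v, h⟩ →
            (⟨toLex ⟨j, q.1⟩, q.2⟩ : Σ v : Σₗ j, (X j).V, (X (ofLex v).1).H (ofLex v).2) =
              ⟨toLex ⟨j, v⟩, h⟩ := by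
          rintro _ rfl; rfl
        exact e' _ e }
  valence v := (X (ofLex v).1).valence _
  label v := (X (ofLex v).1).label _

/-! #### Contraction of an edge -/

section Contract

variable (X : OGraph O) (e : X.E)

/-- The vertices after the contraction of `e`: the new vertex, which comes first, and the vertices
which are not endpoints of `e`. -/
abbrev ContractV : Type := WithBot {v : X.V // v ≠ X.vert e false ∧ v ≠ X.vert e true}

/-- The half-edges after the contraction of `e`: those at the new vertex are the half-edges at either
endpoint of `e`, with the two halves of `e` removed. -/
def ContractH : X.ContractV e → Type
  | none => {a : X.H (X.vert e false) // a ≠ X.half e false} ⊕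
      {b : X.H (X.vert e true) // b ≠ X.half e true}
  | some v => X.H v.1

instance contractFintype : ∀ v, Fintype (X.ContractH e v)
  | none => inferInstanceAs (Fintype ({a : X.H (X.vert e false) // a ≠ X.half e false} ⊕
      {b : X.H (X.vert e true) // b ≠ X.half e true}))
  | some v => inferInstanceAs (Fintype (X.H v.1))

/-- The half-edges after contraction are half-edges of the original graph. -/
def contractInclusion : (Σ v, X.ContractH e v) → Σ v, X.H v
  | ⟨none, Sum.inl a⟩ => ⟨_, a.1⟩
  | ⟨none, Sum.inr b⟩ => ⟨_, b.1⟩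
  | ⟨some v, h⟩ => ⟨v.1, h⟩

theorem contractInclusion_ne (he : ¬ X.IsLoop e) (q : Σ v, X.ContractH e v) (s : Bool) :
    X.contractInclusion e q ≠ X.ends (e, s) := by
  have key : ∀ (s : Bool) (a : X.H (X.vert e s)),
      (⟨X.vert e s, a⟩ : Σ v, X.H v) = X.ends (e, s) → a = X.half e s := by
    intro s a h
    have h' : (⟨X.vert e s, a⟩ : Σ v, X.H v) = ⟨X.vert e s, X.half e s⟩ := h
    simpa using h'
  intro h
  rcases q with ⟨_ | v, q⟩
  · rcases q with a | b
    · cases s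
      · exact a.2 (key _ _ h)
      · have h' := congrArg Sigma.fst h
        exact he h'
    · cases s
      · have h' := congrArg Sigma.fst h
        exact he h'.symm
      · exact b.2 (key _ _ h)
  · cases s
    · exact v.2.1 (congrArg Sigma.fst h)
    · exact v.2.2 (congrArg Sigma.fst h)

theorem contractInclusion_bijective (he : ¬ X.IsLoop e) :
    Function.Bijective (fun q : Σ v, X.ContractH e v =>
      (⟨X.contractInclusion e q, X.contractInclusion_ne e he q⟩ :
        {q : Σ v, X.H v // ∀ s, q ≠ X.ends (e, s)})) := by
  constructor
  · rintro ⟨_ | v, q⟩ ⟨_ | v', q'⟩ h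
    all_goals replace h := congrArg Subtype.val h
    · rcases q with a | b <;> rcases q' with a' | b'
      · have : a.1 = a'.1 := by simpa [contractInclusion] using h
        rw [Subtype.ext this]
      · exact (by have h' := congrArg Sigma.fst h; exact (he h').elim)
      · exact (by have h' := congrArg Sigma.fst h; exact (he h'.symm).elim)
      · have : b.1 = b'.1 := by simpa [contractInclusion] using h
        rw [Subtype.ext this]
    · rcases q with a | b
      · exact (v'.2.1 (congrArg Sigma.fst h).symm).elim
      · exact (v'.2.2 (congrArg Sigma.fst h).symm).elim
    · rcases q' with a | b
      · exact (v.2.1 (congrArg Sigma.fst h)).elim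
      · exact (v.2.2 (congrArg Sigma.fst h)).elim
    · obtain ⟨v, hv⟩ := v
      obtain ⟨v', hv'⟩ := v'
      obtain rfl : v = v' := congrArg Sigma.fst h
      have : (q : X.H v) = q' := by
        change (⟨v, q⟩ : Σ v, X.H v) = ⟨v, q'⟩ at h
        exact eq_of_heq (Sigma.mk.inj h).2
      subst this
      rfl
  · rintro ⟨⟨v, h⟩, hq⟩
    by_cases h₁ : v = X.vert e false
    · subst h₁
      refine ⟨⟨none, Sum.inl ⟨h, fun hh => hq false ?_⟩⟩, rfl⟩
      rw [hh]; rfl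
    by_cases h₂ : v = X.vert e true
    · subst h₂
      refine ⟨⟨none, Sum.inr ⟨h, fun hh => hq true ?_⟩⟩, rfl⟩
      rw [hh]; rfl
    · exact ⟨⟨some ⟨v, h₁, h₂⟩, h⟩, rfl⟩

/-- The contraction of the edge `e`, which is not a loop: the labels at its endpoints are composed
along `e`. -/
def contract (he : ¬ X.IsLoop e) : OGraph O where
  V := X.ContractV e
  E := {f : X.E // f ≠ e}
  H := X.ContractH e
  fintypeV := inferInstanceAs (Fintype (Option _))
  ends :=
    (show {f : X.E // f ≠ e} × Bool ≃ {p : X.E × Bool // p.1 ≠ e} from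
      { toFun := fun p => ⟨(p.1.1, p.2), p.1.2⟩
        invFun := fun p => (⟨p.1.1, p.2⟩, p.1.2)
        left_inv := fun _ => rfl
        right_inv := fun _ => rfl }).trans
    ((X.ends.subtypeEquiv fun p => by
        constructor
        · rintro hp s h
          exact hp (congrArg Prod.fst (X.ends.injective h))
        · rintro h rfl
          exact h p.2 rfl).trans
      (Equiv.ofBijective _ (X.contractInclusion_bijective e he)).symm)
  valence
    | none => by
        have h₁ := X.valence (X.vert e false)
        have h₂ := X.valence (X.vert e true)
        have : Fintype.card ({a : X.H (X.vert e false) // a ≠ X.half e false} ⊕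
            {b : X.H (X.vert e true) // b ≠ X.half e true}) =
            (Fintype.card (X.H (X.vert e false)) - 1) +
              (Fintype.card (X.H (X.vert e true)) - 1) := by
          rw [Fintype.card_sum]
          simp [Fintype.card_subtype_compl]
        change 3 ≤ Fintype.card ({a : X.H (X.vert e false) // a ≠ X.half e false} ⊕
            {b : X.H (X.vert e true) // b ≠ X.half e true})
        omega
    | some v => X.valence v.1
  label
    | none => LabelSpace.graft O (X.half e false) (X.half e true)
        (X.label (X.vert e false)) (X.label (X.vert e true))
    | some v => X.label v.1

/-- The sign of the reordering of the vertices which moves the start of `e` to the first place and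
its terminal vertex to the second place, keeping the other vertices in order. -/
def contractSign : ℤˣ :=
  (-1) ^ (Fintype.card {v : X.V // v < X.vert e false} +
    Fintype.card {v : X.V // v < X.vert e true ∧ v ≠ X.vert e false})

end Contract

/-! #### Attaching a polygon -/

/-- A choice of `i` directed edges `e_1, …, e_i`, all distinct. The pair `(e, false)` is the edge `e`
with its own direction, and `(e, true)` is `e` with the opposite direction. In both cases the pair
also names the initial half-edge of the directed edge. -/
abbrev DirectedEdges (X : OGraph O) (i : ℕ) : Type :=
  {p : Fin i → X.E × Bool // Function.Injective fun j => (p j).1}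

/-- The graph `G⟨e_1, …, e_i⟩`. Let `x_j` and `y_j` be the initial and the terminal half-edge of the
directed edge `e_j`. The new edges of the `2i`-gon, which replace `e_1, …, e_i`, join `y_j` to
`x_{j+1}`, with `j` modulo `i`; the new edge containing `y_j` keeps the name of `e_j`. The orientation
of the new edges is from `x_{j+1}` to `y_j`, if the direction of each `e_j` agrees with the orientation
of the graph; if it does not agree for `e_j`, then the directions of this edge have to be reversed
before and after, which is the same as to direct the new edge from `y_j` to `x_{j+1}`.
Hence attaching the polygon amounts to permuting the `x_j` cyclically. -/
def attach (X : OGraph O) {i : ℕ} (p : X.DirectedEdges i) : OGraph O :=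
  { X with ends := (List.formPerm (List.ofFn p.1)).trans X.ends }

end OGraph

/-! ### The graph complex -/

section GraphSpace

open scoped Classical

variable {k : Type*} [Field k] (O : CyclicOperad k)

/-- The relations between graphs: an isomorphism identifies two graphs up to its effect on the
orientations (in particular `(G, or) = - (G, -or)`), and graphs are multilinear in the labels. -/
inductive GraphRel : (OGraph O →₀ k) → Prop
  | iso {X Y : OGraph O} (f : OGraph.Iso X Y) :
      GraphRel (Finsupp.single X 1 - Finsupp.single Y (((f.sign : ℤˣ) : ℤ) : k))
  | add (X : OGraph O) (v : X.V) (a b : LabelSpace O (X.H v)) :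
      GraphRel (Finsupp.single (X.withLabel v (a + b)) 1 -
        Finsupp.single (X.withLabel v a) 1 - Finsupp.single (X.withLabel v b) 1)
  | smul (X : OGraph O) (v : X.V) (c : k) (a : LabelSpace O (X.H v)) :
      GraphRel (Finsupp.single (X.withLabel v (c • a)) 1 - Finsupp.single (X.withLabel v a) c)

/-- The vector space `𝒢^O` of `O`-labelled oriented graphs. -/
abbrev GraphSpace := (OGraph O →₀ k) ⧸ Submodule.span k {z | GraphRel O z}

variable {O}

/-- The class of a graph. -/
def OGraph.cls (X : OGraph O) : GraphSpace O :=
  (Submodule.span k {z | GraphRel O z}).mkQ (Finsupp.single X 1)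

/-- The linear map on `𝒢^O` with prescribed values on graphs. It takes these values if they
respect the relations of `𝒢^O`; otherwise it is zero. -/
def GraphSpace.ofValues {M : Type*} [AddCommGroup M] [Module k M] (f : OGraph O → M) :
    GraphSpace O →ₗ[k] M :=
  if h : ∃ T : GraphSpace O →ₗ[k] M, ∀ X : OGraph O, T X.cls = f X then h.choose else 0

/-- `(G, or)_e`, the contraction of the edge `e`, which is zero if `e` is a loop. The sign compares
the orientation with one where the start of `e` is the first vertex and its terminal vertex the
second one. -/
def OGraph.contracted (X : OGraph O) (e : X.E) : GraphSpace O :=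
  if he : X.IsLoop e then 0 else ((X.contractSign e : ℤˣ) : ℤ) • (X.contract e he).cls

/-- The sum `∂_G(G, or) = ∑_e (G, or)_e` of the contractions of all edges. -/
def OGraph.boundary (X : OGraph O) : GraphSpace O := ∑ e : X.E, X.contracted e

/-- The sum of `G⟨e_1, …, e_i⟩_e` over all `i`-tuples of distinct directed edges, where `e` is the edge
of the `2i`-gon between `1` and `2`. -/
def OGraph.attachContract (X : OGraph O) (i : ℕ) [NeZero i] : GraphSpace O :=
  ∑ p : X.DirectedEdges i, (X.attach p).contracted (p.1 0).1

/-- The sum of `G⟨e_1, …, e_i⟩` over all `i`-tuples of distinct directed edges, without contraction. -/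
def OGraph.attachSum (X : OGraph O) (i : ℕ) : GraphSpace O :=
  ∑ p : X.DirectedEdges i, (X.attach p).cls

variable (O)

/-- The boundary operator `∂_G : 𝒢^O → 𝒢^O`. -/
def graphBoundary : GraphSpace O →ₗ[k] GraphSpace O := GraphSpace.ofValues OGraph.boundary

/-- The operator `∂_i : 𝒢^O → 𝒢^O`. -/
def polygonOp (i : ℕ) [NeZero i] : GraphSpace O →ₗ[k] GraphSpace O :=
  GraphSpace.ofValues fun X => X.attachContract i

/-- The operator which attaches a `2i`-gon in all possible ways, without contracting an edge. -/
def attachOp (i : ℕ) : GraphSpace O →ₗ[k] GraphSpace O :=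
  GraphSpace.ofValues fun X => X.attachSum i

/-- The subspace `P𝒢^O` generated by connected graphs. -/
def Primitive : Submodule k (GraphSpace O) :=
  Submodule.span k {z | ∃ X : OGraph O, X.Connected ∧ X.cls = z}

end GraphSpace

/-! ### The graded symmetric algebra of connected graphs -/

section SymGraph

open scoped Classical

variable {k : Type*} [Field k] (O : CyclicOperad k)

/-- A connected graph as an element of `P𝒢^O`. -/
def OGraph.prim {O : CyclicOperad k} (X : OGraph O) (hX : X.Connected) : Primitive O :=
  ⟨X.cls, Submodule.subset_span ⟨X, hX, rfl⟩⟩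

/-- Graded commutativity, where the degree of a graph is its number of vertices. -/
inductive SymRel : TensorAlgebra k (Primitive O) → TensorAlgebra k (Primitive O) → Prop
  | comm (X Y : OGraph O) (hX : X.Connected) (hY : Y.Connected) :
      SymRel (TensorAlgebra.ι k (X.prim hX) * TensorAlgebra.ι k (Y.prim hY))
        ((-1 : k) ^ (Fintype.card X.V * Fintype.card Y.V) •
          (TensorAlgebra.ι k (Y.prim hY) * TensorAlgebra.ι k (X.prim hX)))

/-- The graded symmetric algebra `S(P𝒢^O)`. -/
abbrev SymGraph := RingQuot (SymRel O)

/-- The inclusion of `P𝒢^O` into `S(P𝒢^O)`. -/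
def SymGraph.ι : Primitive O →ₗ[k] SymGraph O :=
  (RingQuot.mkAlgHom k (SymRel O)).toLinearMap ∘ₗ TensorAlgebra.ι k

/-- The product `G_1 ⊙ ⋯ ⊙ G_n` of connected graphs. -/
def SymGraph.prod {O : CyclicOperad k} (l : List {X : OGraph O // X.Connected}) : SymGraph O :=
  (l.map fun X => SymGraph.ι O (X.1.prim X.2)).prod

/-- The summand `S^i(P𝒢^O)`. -/
def SymGraph.power (i : ℕ) : Submodule k (SymGraph O) :=
  Submodule.span k {z | ∃ l : List {X : OGraph O // X.Connected}, l.length = i ∧ prod l = z}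

/-- The part of `S(P𝒢^O)` of degree `v`, spanned by products of graphs with `v` vertices in all. -/
def SymGraph.degree (v : ℕ) : Submodule k (SymGraph O) :=
  Submodule.span k {z | ∃ l : List {X : OGraph O // X.Connected},
    (l.map fun X => Fintype.card X.1.V).sum = v ∧ prod l = z}

/-- The algebra map `S(P𝒢^O) → S(P𝒢^O)[t]` which multiplies `S^i(P𝒢^O)` by `t ^ i`. -/
def SymGraph.weight : SymGraph O →ₐ[k] Polynomial (SymGraph O) :=
  RingQuot.liftAlgHom k ⟨TensorAlgebra.lift k
    ((Polynomial.monomial (R := SymGraph O) 1).restrictScalars k ∘ₗ SymGraph.ι O), by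
    rintro _ _ ⟨X, Y, hX, hY⟩
    have h := RingQuot.mkAlgHom_rel k (SymRel.comm X Y hX hY)
    rw [map_mul, map_smul, map_mul] at h
    rw [map_mul, map_smul, map_mul, TensorAlgebra.lift_ι_apply, TensorAlgebra.lift_ι_apply]
    change Polynomial.monomial 1 _ * Polynomial.monomial 1 _ =
      _ • (Polynomial.monomial 1 _ * Polynomial.monomial 1 _)
    rw [Polynomial.monomial_mul_monomial, Polynomial.monomial_mul_monomial,
      Polynomial.smul_monomial]
    exact congrArg _ h⟩

/-- The projection `π_i : S(P𝒢^O) → S^i(P𝒢^O)`, as an endomorphism of `S(P𝒢^O)`. -/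
def SymGraph.proj (i : ℕ) : SymGraph O →ₗ[k] SymGraph O :=
  (Polynomial.lcoeff (SymGraph O) i).restrictScalars k ∘ₗ (SymGraph.weight O).toLinearMap

theorem SymGraph.proj_prod {O : CyclicOperad k} (l : List {X : OGraph O // X.Connected}) (i : ℕ) :
    proj O i (prod l) = if l.length = i then prod l else 0 := by
  have hι : ∀ x, weight O (ι O x) = Polynomial.monomial 1 (ι O x) := by
    intro x
    simp [weight, ι, RingQuot.liftAlgHom_mkAlgHom_apply]
  have h : ∀ l : List {X : OGraph O // X.Connected},
      weight O (prod l) = Polynomial.monomial l.length (prod l) := by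
    intro l
    induction l with
    | nil => simp [prod]
    | cons X l ih =>
      have : prod (X :: l) = ι O (X.1.prim X.2) * prod l := by simp [prod]
      rw [this, map_mul, ih, hι, Polynomial.monomial_mul_monomial, List.length_cons, add_comm 1]
  change (weight O (prod l)).coeff i = _
  rw [h, Polynomial.coeff_monomial]

/-- The map `S : 𝒢^O → S(P𝒢^O)` is characterized by the property that it carries a disjoint union of
connected graphs to the product of these graphs. -/
def IsComponentMap (S : GraphSpace O →ₗ[k] SymGraph O) : Prop :=
  ∀ (n : ℕ) (X : Fin n → OGraph O) (hX : ∀ j, (X j).Connected),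
    S (OGraph.disjointUnion X).cls = SymGraph.prod (List.ofFn fun j => ⟨X j, hX j⟩)

/-- The map `S : 𝒢^O → S(P𝒢^O)`. -/
def componentMap : GraphSpace O →ₗ[k] SymGraph O :=
  if h : ∃ S, IsComponentMap O S then h.choose else 0

variable {O}

/-- Derivations of the graded algebra `S(P𝒢^O)`: `D (a b) = D(a) b + (-1)^{d |a|} a D(b)`, where `d` is
the parity of `D`. -/
def IsGradedDerivation (d : ℕ) (D : SymGraph O →ₗ[k] SymGraph O) : Prop :=
  ∀ v, ∀ a ∈ SymGraph.degree O v, ∀ b, D (a * b) = D a * b + (-1 : k) ^ (d * v) • (a * D b)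

/-- The extension of a linear map `P𝒢^O → S(P𝒢^O)` of parity `d` to a derivation. -/
def extendDerivation (d : ℕ) (f : Primitive O →ₗ[k] SymGraph O) : SymGraph O →ₗ[k] SymGraph O :=
  if h : ∃ D, IsGradedDerivation d D ∧ ∀ x, D (SymGraph.ι O x) = f x then h.choose else 0

variable (O)

/-- The boundary operator of `S(P𝒢^O)`: the derivation extending `∂_G`. -/
def symBoundary : SymGraph O →ₗ[k] SymGraph O :=
  extendDerivation 1 (componentMap O ∘ₗ graphBoundary O ∘ₗ (Primitive O).subtype)

/-- The fission operator `θ_i = ½ π_i ∘ S ∘ ∂_i` on connected graphs, extended to `S(P𝒢^O)` as a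
derivation. -/
def fission (i : ℕ) [NeZero i] : SymGraph O →ₗ[k] SymGraph O :=
  extendDerivation 1 ((2 : k)⁻¹ •
    (SymGraph.proj O i ∘ₗ componentMap O ∘ₗ polygonOp O i ∘ₗ (Primitive O).subtype))

/-- The operator which, on connected graphs, attaches an unlabelled `2i`-gon in all possible ways
without contracting an edge, and projects to `S^i(P𝒢^O)`; it is extended to `S(P𝒢^O)` as a
derivation. Each such attachment comes from `2i` tuples of directed edges. -/
def fissionHomotopy (i : ℕ) [NeZero i] : SymGraph O →ₗ[k] SymGraph O :=
  extendDerivation 0 ((2 * i : k)⁻¹ •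
    (SymGraph.proj O i ∘ₗ componentMap O ∘ₗ attachOp O i ∘ₗ (Primitive O).subtype))

end SymGraph

/-! ### Homology -/

section Homology

variable {k M : Type*} [Field k] [AddCommGroup M] [Module k M]

/-- The homology `ker d / im d`. -/
abbrev Homology (d : M →ₗ[k] M) : Type _ :=
  LinearMap.ker d ⧸ (LinearMap.range d).comap (LinearMap.ker d).subtype

/-- The map on homology induced by an operator which anticommutes with `d`. -/
def homologyMap (d T : M →ₗ[k] M) (h : d ∘ₗ T + T ∘ₗ d = 0) : Homology d →ₗ[k] Homology d :=
  have hT : ∀ x, d (T x) = - T (d x) := fun x => eq_neg_of_add_eq_zero_left (LinearMap.congr_fun h x)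
  Submodule.mapQ _ _ (T.restrict (p := LinearMap.ker d) (q := LinearMap.ker d) fun x hx => by
      rw [LinearMap.mem_ker] at hx ⊢
      rw [hT, hx, map_zero, neg_zero]) (by
    rintro ⟨x, hx⟩ ⟨y, hy⟩
    exact ⟨- T y, by rw [map_neg, hT, neg_neg, hy]; rfl⟩)

end Homology

end

/-! The heart of the matter is the identity ∂_G μ_i = i ∂_i + μ_i ∂_G on all graphs
(`graphBoundary_attachOp`). Expand the left side over pairs consisting of a tuple (e_1, …, e_i) and
an edge of the graph with the polygon attached. Attaching a polygon only redistributes half-edges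
among edges; the vertices, their order and their labels stay, so no sign arises. If the contracted
edge is not one of the polygon, contraction and attachment commute, and these terms add up to μ_i
∂_G. If it is one of the i new edges, a cyclic rotation of the tuple, which does not change the
attached graph, turns it into b_1; so each of the i positions contributes one copy of ∂_i. For i = 1
the attachment changes nothing and every edge occurs with both directions, whence ∂_1 = 2 ∂_G.

The boundary of the symmetric algebra commutes with S (`symBoundary_componentMap`) and with π_i
(`symBoundary_proj`). Hence dividing the identity by 2i and projecting gives θ_i = ∂_G ν_i - ν_i ∂_G
on connected graphs. The commutator of the odd derivation ∂_G with the even derivation ν_i is an odd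
derivation, so the formula extends to products (`fission_eq`). With ∂_G² = 0 it yields the
compatibility with the boundary, and θ_i z = ∂_G ν_i z on cycles z.

Most of the work lies in signs and well-definedness, and rests on a few devices. Labels are regarded
as elements of O((S)) for subsets S of one ambient set of darts (`Loc`), so that compatibilities up
to canonical bijections become equations. Contraction, which creates a new first vertex, is replaced
by absorption of one end of the edge into the other (`contracted_eq`): the remaining vertices keep
their places, and the sign essentially counts the vertices below the removed one.

For ∂_G² = 0, two edges which are neither loops nor parallel have ends that can be removed in either
order (`exists_nonincident_ends`). The results agree, because two grafts at different legs of one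
vertex commute, and the signs differ by -1, because exactly one of the removed vertices precedes the
other. All other pairs of edges contribute zero.

The map S sends a graph to the product of its components, with the sign of sorting the vertices by
component; graded commutativity makes this independent of the order of the components (`prod_perm`).
Derivations are obtained as the corner entry of an algebra map into upper triangular 2 × 2 matrices
(`exists_extendDerivation`). -/

noncomputable section

/-! ### Functoriality of the label spaces -/

section Labels

open scoped Classical

variable {k : Type*} [Field k] {O : CyclicOperad k}

namespace LabelSpace

theorem map_mk {X Y : Type} (f : X ≃ Y) {n : ℕ} (L : X ≃ Fin (n + 1)) (o : O.obj n) :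
    map O f (mk O L o) = mk O (f.symm.trans L) o := by
  simp only [map, mk, LinearMap.comp_apply, Submodule.mkQ_apply, Submodule.liftQ_apply]
  rw [LabelSum.lift_of]
  rfl

theorem hom_ext {X : Type} {M : Type*} [AddCommGroup M] [Module k M]
    {f g : LabelSpace O X →ₗ[k] M}
    (h : ∀ (n : ℕ) (L : X ≃ Fin (n + 1)) (o : O.obj n), f (mk O L o) = g (mk O L o)) : f = g := by
  refine LinearMap.ext fun u => ?_
  obtain ⟨z, rfl⟩ := (labelRel O X).mkQ_surjective u
  induction z using DFinsupp.induction with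
  | h0 => simp
  | ha L o z _ _ ih =>
    rw [map_add, map_add, map_add, ih]
    congr 1
    exact h L.1 L.2 o

theorem map_refl {X : Type} : map O (Equiv.refl X) = LinearMap.id :=
  hom_ext fun n L o => by rw [map_mk]; rfl

theorem map_trans {X Y Z : Type} (f : X ≃ Y) (g : Y ≃ Z) :
    map O (f.trans g) = map O g ∘ₗ map O f :=
  hom_ext fun n L o => by
    rw [map_mk, LinearMap.comp_apply, map_mk, map_mk]; rfl

theorem map_map {X Y Z : Type} (f : X ≃ Y) (g : Y ≃ Z) (u : LabelSpace O X) :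
    map O g (map O f u) = map O (f.trans g) u := by
  rw [map_trans]; rfl

theorem map_symm_map {X Y : Type} (f : X ≃ Y) (u : LabelSpace O X) :
    map O f.symm (map O f u) = u := by
  rw [map_map, Equiv.self_trans_symm, map_refl]; rfl

theorem graft_mk {X Y : Type} {x : X} {y : Y} (g : GraftData x y) (a : O.obj g.m) (b : O.obj g.n) :
    graft O x y (mk O g.L a) (mk O g.M b) = mk O g.labelling (O.comp g.h g.i a b) := by
  rw [graft_eq O g]
  simp only [graftBy, LinearMap.compr₂_apply, LinearMap.compl₁₂_apply, coord_mk,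
    CyclicOperad.relabel_self, Equiv.symm_trans_self]
  have e1 : O.act g.m (Equiv.refl _) a = a := congrArg (fun f => f a) (map_one (O.act g.m))
  have e2 : O.act g.n (Equiv.refl _) b = b := congrArg (fun f => f b) (map_one (O.act g.n))
  rw [e1, e2]

/-- Transport of grafting data along bijections. -/
def _root_.GraftData.map {X Y X' Y' : Type} {x : X} {y : Y} (g : GraftData x y) (p : X ≃ X')
    (q : Y ≃ Y') : GraftData (p x) (q y) where
  m := g.m
  n := g.n
  l := g.l
  L := p.symm.trans g.L
  M := q.symm.trans g.M
  i := g.i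
  hL := by simp [g.hL]
  hM := by simp [g.hM]
  h := g.h

/-- Grafting data can be transported along the bijections, and the composition does not depend on
the data chosen, so grafting is natural. -/
theorem graft_map {X Y X' Y' : Type} (x : X) (y : Y) (p : X ≃ X') (q : Y ≃ Y')
    (u : LabelSpace O X) (w : LabelSpace O Y) :
    graft O (p x) (q y) (map O p u) (map O q w) =
      map O ((puncture p rfl).sumCongr (puncture q rfl)) (graft O x y u w) := by
  by_cases h : Nonempty (GraftData x y)
  · obtain ⟨g⟩ := h
    rw [← mk_coord O g.L u, ← mk_coord O g.M w, graft_mk, map_mk, map_mk, map_mk]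
    rw [show mk O (p.symm.trans g.L) (coord O g.L u) = mk O (g.map p q).L (coord O g.L u) from rfl,
      show mk O (q.symm.trans g.M) (coord O g.M w) = mk O (g.map p q).M (coord O g.M w) from rfl]
    erw [graft_mk (g.map p q)]
    change mk O (g.map p q).labelling (O.comp g.h g.i (coord O g.L u) (coord O g.M w)) = _
    congr 2
    ext z
    rcases z with z | z <;> rfl
  -- Data exist for one pair exactly if they exist for the other; without data both grafts are zero
  -- by definition.
  · have h' : ¬ Nonempty (GraftData (p x) (q y)) := by
      rintro ⟨g⟩
      have := g.map p.symm q.symm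
      rw [p.symm_apply_apply, q.symm_apply_apply] at this
      exact h ⟨this⟩
    rw [graft, graft, dif_neg h, dif_neg h']
    simp

theorem _root_.GraftData.labelling_inl {X Y : Type} {x : X} {y : Y} (g : GraftData x y)
    (a : {a : X // a ≠ x}) :
    (g.labelling (Sum.inl a) : ℕ) =
      if (g.L a : ℕ) ≤ g.i then (g.L a : ℕ) else (g.L a : ℕ) + g.n - 1 := by
  change (graftFun g.h g.i (Sum.inl (puncture g.L g.hL a)) : ℕ) = _
  rw [graftFun]
  have : ((puncture g.L g.hL a).1 : Fin (g.m + 1)) = g.L a := rfl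
  simp only [this]
  split_ifs <;> rfl

theorem _root_.GraftData.labelling_inr {X Y : Type} {x : X} {y : Y} (g : GraftData x y)
    (b : {b : Y // b ≠ y}) : (g.labelling (Sum.inr b) : ℕ) = g.i + g.M b := rfl

theorem exists_labelling {X : Type} {m : ℕ} (hX : Nat.card X = m + 1) (x : X) (a : Fin (m + 1)) :
    ∃ L : X ≃ Fin (m + 1), L x = a := by
  have : Finite X := Nat.finite_of_card_ne_zero (by omega)
  let e : X ≃ Fin (m + 1) := (Finite.equivFin X).trans (finCongr hX)
  exact ⟨e.trans (Equiv.swap (e x) a), by simp⟩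

theorem exists_labelling₂ {X : Type} {m : ℕ} (hX : Nat.card X = m + 1) {x x' : X} (hx : x ≠ x')
    {a a' : Fin (m + 1)} (ha : a ≠ a') :
    ∃ L : X ≃ Fin (m + 1), L x = a ∧ L x' = a' := by
  obtain ⟨e, he⟩ := exists_labelling hX x a
  refine ⟨e.trans (Equiv.swap (e x') a'), ?_, by simp⟩
  rw [Equiv.trans_apply, he, Equiv.swap_apply_of_ne_of_ne _ ha]
  rw [← he]
  exact fun h => hx (e.injective h)

/-- Grafting is symmetric in its two arguments. -/
theorem graft_comm {X Y : Type} (hX : 2 ≤ Nat.card X) (hY : 2 ≤ Nat.card Y) (x : X) (y : Y)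
    (u : LabelSpace O X) (w : LabelSpace O Y) :
    map O (Equiv.sumComm _ _) (graft O x y u w) = graft O y x w u := by
  obtain ⟨m, hm⟩ : ∃ m, Nat.card X = (m + 1) + 1 := ⟨Nat.card X - 2, by omega⟩
  obtain ⟨n, hn⟩ : ∃ n, Nat.card Y = (n + 1) + 1 := ⟨Nat.card Y - 2, by omega⟩
  obtain ⟨L, hL⟩ := exists_labelling hm x (Fin.succ 0)
  obtain ⟨M, hM⟩ := exists_labelling hn y 0
  -- Exchanging the legs 0 and 1 on both sides makes `x` the root and `y` the first input, which is
  -- the situation of `comp_exchange`.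
  let σ : Equiv.Perm (Fin (m + 1 + 1)) := Equiv.swap (Fin.succ 0) 0
  let τ : Equiv.Perm (Fin (n + 1 + 1)) := Equiv.swap 0 (Fin.succ 0)
  have hσ : σ (Fin.succ 0) = 0 := Equiv.swap_apply_left _ _
  have hτ : τ 0 = Fin.succ 0 := Equiv.swap_apply_left _ _
  let g : GraftData x y := ⟨m + 1, n + 1, m + n + 1, L, M, 0, hL, hM, by omega⟩
  let g' : GraftData y x := ⟨n + 1, m + 1, m + n + 1, M.trans τ, L.trans σ, 0,
    by simp [hM, hτ], by rw [Equiv.trans_apply, hL, hσ], by omega⟩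
  rw [← mk_coord O L u, ← mk_coord O M w]
  generalize coord O L u = a
  generalize coord O M w = b
  have e1 := graft_mk (O := O) g a b
  have e2 := graft_mk (O := O) g' (O.act _ τ b) (O.act _ σ a)
  change graft O x y (mk O L a) (mk O M b) = _ at e1
  change graft O y x (mk O (M.trans τ) (O.act _ τ b)) (mk O (L.trans σ) (O.act _ σ a)) = _ at e2
  rw [mk_act, mk_act] at e2
  rw [e1, e2]
  have e3 := O.comp_exchange g.h g'.h 0 0 σ τ hσ hτ a b
  change _ = mk O g'.labelling (O.comp g'.h 0 (O.act _ τ b) (O.act _ σ a))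
  rw [e3, map_mk]
  change mk O _ (O.comp g.h 0 a b) = _
  rw [← mk_act O ((Equiv.sumComm _ _).symm.trans g.labelling)]
  congr 2
  refine Equiv.ext fun z => ?_
  have key : ∀ q, (graftEquiv g.h 0).symm (g.labelling q) =
      (puncture g.L g.hL).sumCongr (puncture g.M g.hM) q :=
    fun q => Equiv.symm_apply_apply _ _
  simp only [Equiv.trans_apply]
  rw [key]
  rcases z with z | z <;> rfl

/-- The bijection between the legs left over after grafting at two inputs in either order. -/
def parallelEquiv {X Y Z : Type} {x x' : X} (hx : x ≠ x') (y : Y) (z : Z) :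
    {a : {a : X // a ≠ x} ⊕ {b : Y // b ≠ y} // a ≠ Sum.inl ⟨x', hx.symm⟩} ⊕ {c : Z // c ≠ z} ≃
      {a : {a : X // a ≠ x'} ⊕ {c : Z // c ≠ z} // a ≠ Sum.inl ⟨x, hx⟩} ⊕ {b : Y // b ≠ y} where
  toFun
    | Sum.inl ⟨Sum.inl a, h⟩ => Sum.inl ⟨Sum.inl ⟨a.1, fun e => h (by congr; exact Subtype.ext e)⟩,
        fun e => a.2 (congrArg Subtype.val (Sum.inl.inj e))⟩
    | Sum.inl ⟨Sum.inr b, _⟩ => Sum.inr b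
    | Sum.inr c => Sum.inl ⟨Sum.inr c, by simp⟩
  invFun
    | Sum.inl ⟨Sum.inl a, h⟩ => Sum.inl ⟨Sum.inl ⟨a.1, fun e => h (by congr; exact Subtype.ext e)⟩,
        fun e => a.2 (congrArg Subtype.val (Sum.inl.inj e))⟩
    | Sum.inl ⟨Sum.inr c, _⟩ => Sum.inr c
    | Sum.inr b => Sum.inl ⟨Sum.inr b, by simp⟩
  left_inv := by rintro (⟨a | b, h⟩ | c) <;> rfl
  right_inv := by rintro (⟨a | b, h⟩ | c) <;> rfl

/-- Graftings at different inputs commute. -/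
theorem graft_graft {X Y Z : Type} (hX : 3 ≤ Nat.card X) (hY : 1 ≤ Nat.card Y)
    (hZ : 1 ≤ Nat.card Z) {x x' : X} (hx : x ≠ x') (y : Y) (z : Z)
    (u : LabelSpace O X) (v : LabelSpace O Y) (w : LabelSpace O Z) :
    map O (parallelEquiv hx y z)
        (graft O (Sum.inl ⟨x', hx.symm⟩) z (graft O x y u v) w) =
      graft O (Sum.inl ⟨x, hx⟩) y (graft O x' z u w) v := by
  obtain ⟨m, hm⟩ : ∃ m, Nat.card X = (m + 2) + 1 := ⟨Nat.card X - 3, by omega⟩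
  obtain ⟨n, hn⟩ : ∃ n, Nat.card Y = n + 1 := ⟨Nat.card Y - 1, by omega⟩
  obtain ⟨p, hp⟩ : ∃ p, Nat.card Z = p + 1 := ⟨Nat.card Z - 1, by omega⟩
  -- With `x` and `x'` as the first two inputs, the claim becomes an instance of `comp_comm`.
  obtain ⟨L, hL, hL'⟩ := exists_labelling₂ hm hx
    (a := (0 : Fin (m + 2)).succ) (a' := (1 : Fin (m + 2)).succ)
    ((Fin.succ_injective _).ne (by simp))
  obtain ⟨M, hM⟩ := exists_labelling hn y 0
  obtain ⟨N, hN⟩ := exists_labelling hp z 0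
  let g₁ : GraftData x y := ⟨m + 2, n, m + n + 1, L, M, 0, hL, hM, by omega⟩
  let g₂ : GraftData x' z := ⟨m + 2, p, m + p + 1, L, N, 1, hL', hN, by omega⟩
  have hx1 : (L x : ℕ) = 1 := by rw [hL]; rfl
  have hx2 : (L x' : ℕ) = 2 := by rw [hL']; rfl
  -- Grafting `b` at the first input replaces one input by `n`, so `x'` moves from leg 2 to leg n +
  -- 1, the input with index n. Grafting at `x'` leaves `x`, which comes earlier, at leg 1.
  have hg₁ : g₁.labelling (Sum.inl ⟨x', hx.symm⟩) = Fin.succ (⟨n, by omega⟩ : Fin (m + n + 1)) := by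
    apply Fin.ext
    rw [GraftData.labelling_inl]
    change (if (L x' : ℕ) ≤ 0 then (L x' : ℕ) else (L x' : ℕ) + n - 1) = n + 1
    rw [hx2, if_neg (by omega)]
    omega
  have hg₂ : g₂.labelling (Sum.inl ⟨x, hx⟩) = Fin.succ (⟨0, by omega⟩ : Fin (m + p + 1)) := by
    apply Fin.ext
    rw [GraftData.labelling_inl]
    change (if (L x : ℕ) ≤ 1 then (L x : ℕ) else (L x : ℕ) + p - 1) = 0 + 1
    rw [hx1, if_pos le_rfl]
  let g₃ : GraftData (Sum.inl ⟨x', hx.symm⟩ : {a : X // a ≠ x} ⊕ {b : Y // b ≠ y}) z :=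
    ⟨m + n + 1, p, m + n + p, g₁.labelling, N, _, hg₁, hN, by omega⟩
  let g₄ : GraftData (Sum.inl ⟨x, hx⟩ : {a : X // a ≠ x'} ⊕ {c : Z // c ≠ z}) y :=
    ⟨m + p + 1, n, m + n + p, g₂.labelling, M, _, hg₂, hM, by omega⟩
  rw [← mk_coord O L u, ← mk_coord O M v, ← mk_coord O N w]
  generalize coord O L u = a
  generalize coord O M v = b
  generalize coord O N w = c
  have e1 := graft_mk (O := O) g₁ a b
  have e2 := graft_mk (O := O) g₂ a c
  have e3 := graft_mk (O := O) g₃ (O.comp g₁.h g₁.i a b) c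
  have e4 := graft_mk (O := O) g₄ (O.comp g₂.h g₂.i a c) b
  change graft O x y (mk O L a) (mk O M b) = _ at e1
  change graft O x' z (mk O L a) (mk O N c) = _ at e2
  change graft O _ z (mk O g₁.labelling _) (mk O N c) = _ at e3
  change graft O _ y (mk O g₂.labelling _) (mk O M b) = _ at e4
  rw [e1, e2, e3, e4, map_mk]
  have e5 := O.comp_comm g₁.h g₃.h g₂.h g₄.h 0 1 g₃.i g₄.i (by simp)
    (by change n + 1 = (1 : Fin (m + 2)).1 + n; simp [add_comm]) rfl a b c
  change mk O _ (O.comp g₃.h g₃.i (O.comp g₁.h 0 a b) c) =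
    mk O _ (O.comp g₄.h g₄.i (O.comp g₂.h 1 a c) b)
  rw [e5]
  -- In both orders the final numbering is: the root, the inputs of `b`, those of `c`, the remaining
  -- inputs of `a`. The three cases are the three possible origins of a leg.
  have : (parallelEquiv hx y z).symm.trans g₃.labelling = g₄.labelling := by
    refine Equiv.ext fun q => ?_
    obtain ⟨q, rfl⟩ := (parallelEquiv hx y z).surjective q
    rw [Equiv.trans_apply, Equiv.symm_apply_apply]
    apply Fin.ext
    rcases q with ⟨q | q, hq⟩ | q
    · have h1 : (L q.1 : ℕ) ≠ 1 := fun h =>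
        q.2 (L.injective (Fin.ext (h.trans hx1.symm)))
      change _ = (g₄.labelling (Sum.inl ⟨Sum.inl _, _⟩) : ℕ)
      have h2 : (L q.1 : ℕ) ≠ 2 := fun h => hq (by
        congr; exact Subtype.ext (L.injective (Fin.ext (h.trans hx2.symm))))
      rw [GraftData.labelling_inl, GraftData.labelling_inl, GraftData.labelling_inl]
      erw [GraftData.labelling_inl]
      change (if (if (L q.1 : ℕ) ≤ 0 then (L q.1 : ℕ) else (L q.1 : ℕ) + n - 1) ≤ n then
          (if (L q.1 : ℕ) ≤ 0 then (L q.1 : ℕ) else (L q.1 : ℕ) + n - 1) else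
          (if (L q.1 : ℕ) ≤ 0 then (L q.1 : ℕ) else (L q.1 : ℕ) + n - 1) + p - 1) =
        (if (if (L q.1 : ℕ) ≤ 1 then (L q.1 : ℕ) else (L q.1 : ℕ) + p - 1) ≤ 0 then
          (if (L q.1 : ℕ) ≤ 1 then (L q.1 : ℕ) else (L q.1 : ℕ) + p - 1) else
          (if (L q.1 : ℕ) ≤ 1 then (L q.1 : ℕ) else (L q.1 : ℕ) + p - 1) + n - 1)
      split_ifs <;> omega
    · change _ = (g₄.labelling (Sum.inr q) : ℕ)
      rw [GraftData.labelling_inl, GraftData.labelling_inr]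
      have := (M q.1).2
      change (if (0 + (M q.1 : ℕ)) ≤ n then (0 + (M q.1 : ℕ)) else (0 + (M q.1 : ℕ)) + p - 1) =
        0 + (M q.1 : ℕ)
      rw [if_pos (by omega)]
    · have h0 : (N q.1 : ℕ) ≠ 0 := fun h => q.2 (N.injective (Fin.ext (h.trans (by rw [hN]; rfl))))
      change _ = (g₄.labelling (Sum.inl ⟨Sum.inr q, _⟩) : ℕ)
      rw [GraftData.labelling_inl, GraftData.labelling_inr]
      have h1 : ((1 : Fin (m + 2)) : ℕ) = 1 := rfl
      change n + (N q.1 : ℕ) = if ((1 : Fin (m + 2)) : ℕ) + (N q.1 : ℕ) ≤ 0 then _ else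
        ((1 : Fin (m + 2)) : ℕ) + (N q.1 : ℕ) + n - 1
      rw [h1, if_neg (by omega)]
      omega
  change mk O ((parallelEquiv hx y z).symm.trans g₃.labelling) _ = _
  rw [this]

end LabelSpace
end Labels

/-! ### Labels on subsets of a fixed set -/

section Loc

open scoped Classical

variable {k : Type*} [Field k] {O : CyclicOperad k}

variable (O) in
/-- An element of `O((S))` for some subset `S` of `D`. -/
structure Loc (D : Type) where
  support : Set D
  label : LabelSpace O support

namespace Loc

variable {D D' D'' X Y Z : Type}

/-- A bijection of subsets lying over the identity of `D` forces the subsets to coincide and is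
itself the identity, so no transport remains. -/
theorem mk_eq_mk_iff {S T : Set D} {u : LabelSpace O S} {w : LabelSpace O T} :
    (⟨S, u⟩ : Loc O D) = ⟨T, w⟩ ↔
      ∃ f : S ≃ T, (∀ x, (f x : D) = x) ∧ LabelSpace.map O f u = w := by
  constructor
  · intro h
    cases h
    exact ⟨Equiv.refl _, fun _ => rfl, by rw [LabelSpace.map_refl]; rfl⟩
  · rintro ⟨f, hf, h⟩
    obtain rfl : S = T := by
      ext x
      constructor
      · intro hx
        have := (f ⟨x, hx⟩).2
        rwa [show (f ⟨x, hx⟩ : D) = x from hf ⟨x, hx⟩] at this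
      · intro hx
        have h1 := hf (f.symm ⟨x, hx⟩)
        rw [f.apply_symm_apply] at h1
        have h2 : x = _ := h1
        rw [h2]
        exact (f.symm ⟨x, hx⟩).2
    obtain rfl : f = Equiv.refl _ := Equiv.ext fun x => Subtype.ext (hf x)
    rw [LabelSpace.map_refl] at h
    exact congrArg (Loc.mk S) h

/-- The image of a label under an injection. -/
def place (i : X ↪ D) (u : LabelSpace O X) : Loc O D :=
  ⟨Set.range i, LabelSpace.map O (Equiv.ofInjective i i.injective) u⟩

theorem place_fst (i : X ↪ D) (u : LabelSpace O X) : (place i u).1 = Set.range i := rfl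

/-- The working criterion: a label-preserving bijection over `D` is the same thing as an equation in
`Loc O D`. Isomorphisms of graphs can therefore be produced by rewriting labels. -/
theorem place_eq_iff {i : X ↪ D} {j : Y ↪ D} {u : LabelSpace O X} {w : LabelSpace O Y} :
    place i u = place j w ↔ ∃ f : X ≃ Y, (∀ x, j (f x) = i x) ∧ LabelSpace.map O f u = w := by
  rw [place, place, mk_eq_mk_iff]
  constructor
  · rintro ⟨f, hf, h⟩
    refine ⟨(Equiv.ofInjective i i.injective).trans
      (f.trans (Equiv.ofInjective j j.injective).symm), fun x => ?_, ?_⟩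
    · simp only [Equiv.trans_apply]
      have := Equiv.apply_ofInjective_symm j.injective (f (Equiv.ofInjective i i.injective x))
      exact this.trans (hf _)
    · rw [← LabelSpace.map_map, ← LabelSpace.map_map, LabelSpace.map_map, LabelSpace.map_map,
        ← Equiv.trans_assoc, ← LabelSpace.map_map, ← LabelSpace.map_map, h]
      exact LabelSpace.map_symm_map _ _
  · rintro ⟨f, hf, rfl⟩
    refine ⟨(Equiv.ofInjective i i.injective).symm.trans
      (f.trans (Equiv.ofInjective j j.injective)), fun x => ?_, ?_⟩
    · obtain ⟨x, rfl⟩ := (Equiv.ofInjective i i.injective).surjective x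
      simp only [Equiv.trans_apply, Equiv.symm_apply_apply]
      exact hf x
    · rw [LabelSpace.map_map, LabelSpace.map_map, ← Equiv.trans_assoc, Equiv.self_trans_symm,
        Equiv.refl_trans]

theorem place_map (f : X ≃ Y) (j : Y ↪ D) (u : LabelSpace O X) :
    place j (LabelSpace.map O f u) = place (f.toEmbedding.trans j) u :=
  (place_eq_iff.2 ⟨f, fun _ => rfl, rfl⟩).symm

theorem eq_place (A : Loc O D) : A = place (Function.Embedding.subtype (· ∈ A.1)) A.2 := by
  obtain ⟨S, u⟩ := A
  exact mk_eq_mk_iff.2 ⟨Equiv.ofInjective _ Subtype.val_injective, fun _ => rfl, rfl⟩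

/-- The image of a label under an injection of the ambient sets. -/
def push (f : D ↪ D') (A : Loc O D) : Loc O D' :=
  place ((Function.Embedding.subtype (· ∈ A.1)).trans f) A.2

theorem push_place (f : D ↪ D') (i : X ↪ D) (u : LabelSpace O X) :
    push f (place i u) = place (i.trans f) u := by
  symm
  exact place_eq_iff.2 ⟨Equiv.ofInjective i i.injective, fun _ => rfl, rfl⟩

theorem push_push (f : D ↪ D') (g : D' ↪ D'') (A : Loc O D) :
    push g (push f A) = push (f.trans g) A :=
  push_place g ((Function.Embedding.subtype (· ∈ A.1)).trans f) A.2

theorem push_fst (f : D ↪ D') (A : Loc O D) : (push f A).1 = f '' A.1 := by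
  ext x
  simp [push, place_fst]

theorem push_refl (A : Loc O D) : push (Function.Embedding.refl D) A = A := (eq_place A).symm

/-- The label in `O((X))` corresponding to a label on the image of `X`. -/
def restrict (i : X ↪ D) (A : Loc O D) (h : Set.range i = A.1) : LabelSpace O X :=
  LabelSpace.map O ((Equiv.ofInjective i i.injective).trans (Equiv.setCongr h)).symm A.2

theorem place_restrict (i : X ↪ D) (A : Loc O D) (h : Set.range i = A.1) :
    place i (restrict i A h) = A := by
  rw [restrict, place_map]
  conv_rhs => rw [eq_place A]
  rw [place_eq_iff]
  refine ⟨Equiv.refl _, fun x => ?_, by rw [LabelSpace.map_refl]; rfl⟩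
  obtain ⟨x, rfl⟩ := ((Equiv.ofInjective i i.injective).trans (Equiv.setCongr h)).surjective x
  change _ = i (Equiv.symm _ (_))
  rw [Equiv.symm_apply_apply]
  rfl

/-- The injection of the legs left over after grafting. -/
def graftEmb (i : X ↪ D) (j : Y ↪ D) (h : ∀ a b, i a ≠ j b) (x : X) (y : Y) :
    {a : X // a ≠ x} ⊕ {b : Y // b ≠ y} ↪ D where
  toFun := Sum.elim (fun a => i a) (fun b => j b)
  inj' := by
    rintro (a | a) (b | b) e
    · exact congrArg Sum.inl (Subtype.ext (i.injective e))
    · exact (h _ _ e).elim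
    · exact (h _ _ e.symm).elim
    · exact congrArg Sum.inr (Subtype.ext (j.injective e))

/-- Grafting of labels with disjoint supports. -/
def graft (x y : D) (A B : Loc O D) : Loc O D :=
  if h : x ∈ A.1 ∧ y ∈ B.1 ∧ Disjoint A.1 B.1 then
    place (graftEmb (Function.Embedding.subtype (· ∈ A.1)) (Function.Embedding.subtype (· ∈ B.1))
      (fun a b e => Set.disjoint_left.1 h.2.2 a.2 (by
        have : (a : D) = b := e
        rw [this]; exact b.2)) ⟨x, h.1⟩ ⟨y, h.2.1⟩)
      (LabelSpace.graft O (⟨x, h.1⟩ : A.1) (⟨y, h.2.1⟩ : B.1) A.2 B.2)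
  -- A junk value: the lemmas below concern disjoint supports containing the two legs.
  else A

/-- Grafting is defined with the supports themselves as index sets; by naturality any other
parametrization computes the same result. -/
theorem graft_place (i : X ↪ D) (j : Y ↪ D) (h : ∀ a b, i a ≠ j b) (x : X) (y : Y)
    (u : LabelSpace O X) (w : LabelSpace O Y) :
    graft (i x) (j y) (place i u) (place j w) =
      place (graftEmb i j h x y) (LabelSpace.graft O x y u w) := by
  have hd : (i x) ∈ (place i u).1 ∧ j y ∈ (place j w).1 ∧ Disjoint (place i u).1 (place j w).1 := by
    refine ⟨⟨x, rfl⟩, ⟨y, rfl⟩, ?_⟩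
    rw [Set.disjoint_left]
    rintro _ ⟨a, rfl⟩ ⟨b, e⟩
    exact h a b e.symm
  rw [graft, dif_pos hd]
  symm
  rw [place_eq_iff]
  refine ⟨(puncture (Equiv.ofInjective i i.injective) rfl).sumCongr
    (puncture (Equiv.ofInjective j j.injective) rfl), ?_, ?_⟩
  · rintro (a | a) <;> rfl
  · exact (LabelSpace.graft_map x y _ _ u w).symm

theorem graft_fst {x y : D} {A B : Loc O D} (hx : x ∈ A.1) (hy : y ∈ B.1)
    (h : Disjoint A.1 B.1) : (graft x y A B).1 = A.1 \ {x} ∪ B.1 \ {y} := by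
  rw [graft, dif_pos ⟨hx, hy, h⟩, place_fst]
  ext d
  constructor
  · rintro ⟨a | a, rfl⟩
    · exact Or.inl ⟨a.1.2, fun e => a.2 (Subtype.ext e)⟩
    · exact Or.inr ⟨a.1.2, fun e => a.2 (Subtype.ext e)⟩
  · rintro (⟨h₁, h₂⟩ | ⟨h₁, h₂⟩)
    · exact ⟨Sum.inl ⟨⟨d, h₁⟩, fun e => h₂ (congrArg Subtype.val e)⟩, rfl⟩
    · exact ⟨Sum.inr ⟨⟨d, h₁⟩, fun e => h₂ (congrArg Subtype.val e)⟩, rfl⟩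

theorem card_place (i : X ↪ D) (u : LabelSpace O X) :
    Nat.card (place i u).1 = Nat.card X :=
  (Nat.card_congr (Equiv.ofInjective i i.injective)).symm

theorem exists_place {A : Loc O D} {x : D} (hx : x ∈ A.1) :
    ∃ (X : Type) (i : X ↪ D) (u : LabelSpace O X) (a : X), A = place i u ∧ x = i a :=
  ⟨A.1, _, A.2, ⟨x, hx⟩, eq_place A, rfl⟩

theorem place_disjoint {i : X ↪ D} {j : Y ↪ D} {u : LabelSpace O X} {w : LabelSpace O Y}
    (h : Disjoint (place i u).1 (place j w).1) (a : X) (b : Y) : i a ≠ j b := fun e =>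
  Set.disjoint_left.1 h ⟨a, rfl⟩ ⟨b, e.symm⟩

theorem push_graft (f : D ↪ D') {x y : D} {A B : Loc O D} (hx : x ∈ A.1) (hy : y ∈ B.1)
    (h : Disjoint A.1 B.1) :
    push f (graft x y A B) = graft (f x) (f y) (push f A) (push f B) := by
  obtain ⟨X, i, u, x, rfl, rfl⟩ := exists_place hx
  obtain ⟨Y, j, w, y, rfl, rfl⟩ := exists_place hy
  rw [graft_place i j (place_disjoint h), push_place, push_place, push_place]
  have := graft_place (i.trans f) (j.trans f)
    (fun a b e => place_disjoint h a b (f.injective e)) x y u w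
  refine Eq.trans ?_ this.symm
  congr 1
  ext (a | a) <;> rfl

theorem graft_comm {x y : D} {A B : Loc O D} (hx : x ∈ A.1) (hy : y ∈ B.1)
    (h : Disjoint A.1 B.1) (hA : 2 ≤ Nat.card A.1) (hB : 2 ≤ Nat.card B.1) :
    graft x y A B = graft y x B A := by
  obtain ⟨X, i, u, x, rfl, rfl⟩ := exists_place hx
  obtain ⟨Y, j, w, y, rfl, rfl⟩ := exists_place hy
  rw [card_place] at hA hB
  rw [graft_place i j (place_disjoint h), graft_place j i (place_disjoint h.symm),
    ← LabelSpace.graft_comm hA hB, place_map]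
  congr 1
  ext (a | a) <;> rfl

/-- Once all legs are points of `D`, the reindexing `parallelEquiv` lies over the identity and
disappears, so parallel associativity is a plain equation. -/
theorem graft_graft {x x' y z : D} {A B C : Loc O D} (hx : x ∈ A.1) (hx' : x' ∈ A.1)
    (hy : y ∈ B.1) (hz : z ∈ C.1) (hxx : x ≠ x') (hAB : Disjoint A.1 B.1) (hAC : Disjoint A.1 C.1)
    (hBC : Disjoint B.1 C.1) (hA : 3 ≤ Nat.card A.1) (hB : 1 ≤ Nat.card B.1)
    (hC : 1 ≤ Nat.card C.1) :
    graft x' z (graft x y A B) C = graft x y (graft x' z A C) B := by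
  obtain ⟨X, i, u, x, rfl, rfl⟩ := exists_place hx
  obtain ⟨Y, j, v, y, rfl, rfl⟩ := exists_place hy
  obtain ⟨Z, l, w, z, rfl, rfl⟩ := exists_place hz
  obtain ⟨x', rfl⟩ := hx'
  have hn : x ≠ x' := fun e => hxx (congrArg i e)
  rw [card_place] at hA hB hC
  rw [graft_place i j (place_disjoint hAB), graft_place i l (place_disjoint hAC)]
  have h₁ : ∀ a b, graftEmb i j (place_disjoint hAB) x y a ≠ l b := by
    rintro (a | a) b
    · exact place_disjoint hAC _ _
    · exact place_disjoint hBC _ _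
  have h₂ : ∀ a b, graftEmb i l (place_disjoint hAC) x' z a ≠ j b := by
    rintro (a | a) b
    · exact place_disjoint hAB _ _
    · exact place_disjoint hBC.symm _ _
  have e₁ := graft_place _ l h₁ (Sum.inl ⟨x', hn.symm⟩) z (LabelSpace.graft O x y u v) w
  have e₂ := graft_place _ j h₂ (Sum.inl ⟨x, hn⟩) y (LabelSpace.graft O x' z u w) v
  refine e₁.trans (Eq.trans ?_ e₂.symm)
  rw [← LabelSpace.graft_graft hA hB hC hn, place_map]
  congr 1
  ext (⟨a | a, h⟩ | a) <;> rfl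

theorem card_graft {x y : D} {A B : Loc O D} (hx : x ∈ A.1) (hy : y ∈ B.1)
    (h : Disjoint A.1 B.1) (hA : 3 ≤ Nat.card A.1) (hB : 3 ≤ Nat.card B.1) :
    3 ≤ Nat.card (graft x y A B).1 := by
  obtain ⟨X, i, u, x, rfl, rfl⟩ := exists_place hx
  obtain ⟨Y, j, w, y, rfl, rfl⟩ := exists_place hy
  rw [card_place] at hA hB
  rw [graft_place i j (place_disjoint h), card_place]
  have : Fintype X := @Fintype.ofFinite _ (Nat.finite_of_card_ne_zero (by omega))
  have : Fintype Y := @Fintype.ofFinite _ (Nat.finite_of_card_ne_zero (by omega))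
  rw [Nat.card_eq_fintype_card] at hA hB ⊢
  simp only [Fintype.card_sum, ne_eq, Fintype.card_subtype_compl, Fintype.card_unique]
  omega

end Loc
end Loc

/-! ### Signs of bijections between linearly ordered sets -/

section Signs

open scoped Classical

variable {V W U : Type}

/-- The product of the values of `s` at the pairs `u < v` in `T`. -/
def pairProd [LinearOrder V] (T : Finset V) (s : V → V → ℤˣ) : ℤˣ :=
  ∏ p ∈ (T ×ˢ T).filter (fun p => p.1 < p.2), s p.1 p.2

theorem pairProd_empty [LinearOrder V] (s : V → V → ℤˣ) : pairProd ∅ s = 1 := by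
  simp [pairProd]

/-- Symmetry of `s` makes the position of `a` among the points of `T` irrelevant: each pair with `a`
contributes `s a b`, whichever point is smaller. -/
theorem pairProd_insert [LinearOrder V] {s : V → V → ℤˣ} (hs : ∀ u v, s u v = s v u) {a : V}
    {T : Finset V} (ha : a ∉ T) :
    pairProd (insert a T) s = pairProd T s * ∏ b ∈ T, s a b := by
  have h : ((insert a T) ×ˢ (insert a T)).filter (fun p => p.1 < p.2) =
      (T ×ˢ T).filter (fun p => p.1 < p.2) ∪
        T.image (fun b => if a < b then (a, b) else (b, a)) := by
    ext ⟨u, v⟩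
    simp only [Finset.mem_filter, Finset.mem_product, Finset.mem_insert, Finset.mem_union,
      Finset.mem_image]
    constructor
    · rintro ⟨⟨rfl | hu, rfl | hv⟩, h⟩
      · exact (lt_irrefl _ h).elim
      · exact Or.inr ⟨v, hv, if_pos h⟩
      · exact Or.inr ⟨u, hu, if_neg h.not_gt⟩
      · exact Or.inl ⟨⟨hu, hv⟩, h⟩
    · rintro (⟨⟨hu, hv⟩, h⟩ | ⟨b, hb, h⟩)
      · exact ⟨⟨Or.inr hu, Or.inr hv⟩, h⟩
      · split_ifs at h with hab
        · cases h; exact ⟨⟨Or.inl rfl, Or.inr hb⟩, hab⟩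
        · cases h
          exact ⟨⟨Or.inr hb, Or.inl rfl⟩,
            lt_of_le_of_ne (not_lt.1 hab) (fun e => ha (e ▸ hb))⟩
  rw [pairProd, h, Finset.prod_union, Finset.prod_image]
  · congr 1
    refine Finset.prod_congr rfl fun b _ => ?_
    split_ifs
    · rfl
    · exact hs _ _
  · intro b hb c hc e
    have hba : b ≠ a := fun e => ha (e ▸ hb)
    have hca : c ≠ a := fun e => ha (e ▸ hc)
    simp only at e
    split_ifs at e
    · exact congrArg Prod.snd e
    · exact (hca (congrArg Prod.fst e).symm).elim
    · exact (hba (congrArg Prod.fst e)).elim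
    · exact congrArg Prod.fst e
  · rw [Finset.disjoint_left]
    rintro ⟨u, v⟩ h₁ h₂
    simp only [Finset.mem_filter, Finset.mem_product, Finset.mem_image] at h₁ h₂
    obtain ⟨b, hb, h₂⟩ := h₂
    split_ifs at h₂
    · cases h₂; exact ha h₁.1.1
    · cases h₂; exact ha h₁.1.2

theorem pairProd_union [LinearOrder V] {s : V → V → ℤˣ} (hs : ∀ u v, s u v = s v u)
    {S T : Finset V} (h : Disjoint S T) :
    pairProd (S ∪ T) s = pairProd S s * pairProd T s * ∏ a ∈ S, ∏ b ∈ T, s a b := by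
  induction S using Finset.induction_on with
  | empty => simp [pairProd_empty]
  | insert a S ha ih =>
    rw [Finset.disjoint_insert_left] at h
    rw [Finset.insert_union, pairProd_insert hs (by simp [ha, h.1]), ih h.2,
      pairProd_insert hs ha, Finset.prod_union h.2, Finset.prod_insert ha]
    simp only [mul_assoc, mul_left_comm, mul_comm]

theorem pairProd_map [LinearOrder V] [LinearOrder W] {s : W → W → ℤˣ}
    (hs : ∀ u v, s u v = s v u) (f : V ↪ W) (T : Finset V) :
    pairProd (T.map f) s = pairProd T (fun u v => s (f u) (f v)) := by
  induction T using Finset.induction_on with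
  | empty => simp [pairProd_empty]
  | insert a T ha ih =>
    rw [Finset.map_insert, pairProd_insert hs (by simpa using ha), ih,
      pairProd_insert (fun _ _ => hs _ _) ha, Finset.prod_map]

theorem pairProd_mul [LinearOrder V] (T : Finset V) (s t : V → V → ℤˣ) :
    pairProd T (fun u v => s u v * t u v) = pairProd T s * pairProd T t :=
  Finset.prod_mul_distrib

theorem pairProd_congr [LinearOrder V] {T : Finset V} {s t : V → V → ℤˣ}
    (h : ∀ u ∈ T, ∀ v ∈ T, u < v → s u v = t u v) : pairProd T s = pairProd T t := by
  refine Finset.prod_congr rfl fun p hp => ?_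
  simp only [Finset.mem_filter, Finset.mem_product] at hp
  exact h _ hp.1.1 _ hp.1.2 hp.2

/-- `-1` if `f` reverses the order of `u` and `v`, and `1` otherwise. -/
def revSign [LinearOrder V] [LinearOrder W] (f : V → W) (u v : V) : ℤˣ :=
  if (u < v ↔ f u < f v) then 1 else -1

theorem revSign_comm [LinearOrder V] [LinearOrder W] {f : V → W} (hf : Function.Injective f)
    (u v : V) :
    revSign f u v = revSign f v u := by
  rcases eq_or_ne u v with rfl | h
  · rfl
  have h' : f u ≠ f v := fun e => h (hf e)
  have h1 : v < u ↔ ¬ u < v := by rw [not_lt]; exact ⟨le_of_lt, fun l => lt_of_le_of_ne l h.symm⟩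
  have h2 : f v < f u ↔ ¬ f u < f v := by
    rw [not_lt]; exact ⟨le_of_lt, fun l => lt_of_le_of_ne l h'.symm⟩
  have h3 : (v < u ↔ f v < f u) ↔ (u < v ↔ f u < f v) := by rw [h1, h2, not_iff_not]
  unfold revSign
  exact if_congr h3.symm rfl rfl

theorem revSign_comp [LinearOrder V] [LinearOrder W] [LinearOrder U] (f : V → W) (g : W → U)
    (u v : V) : revSign (g ∘ f) u v = revSign f u v * revSign g (f u) (f v) := by
  simp only [revSign, Function.comp]
  by_cases h₁ : u < v <;> by_cases h₂ : f u < f v <;> by_cases h₃ : g (f u) < g (f v) <;>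
    simp [h₁, h₂, h₃]

/-- The sign of a bijection between linearly ordered sets: the parity of its number of
inversions. -/
def ordSign [LinearOrder V] [LinearOrder W] [Fintype V] (f : V ≃ W) : ℤˣ :=
  pairProd Finset.univ (revSign f)

/-- A composite reverses a pair exactly if one of its two factors does and the other does not. The
factor of `g` is reindexed along `f`, which symmetry of `revSign` permits. -/
theorem ordSign_trans [LinearOrder V] [LinearOrder W] [LinearOrder U] [Fintype V] [Fintype W]
    (f : V ≃ W) (g : W ≃ U) : ordSign (f.trans g) = ordSign f * ordSign g := by
  have h := pairProd_map (s := revSign g) (revSign_comm g.injective) f.toEmbedding Finset.univ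
  rw [Finset.map_univ_equiv] at h
  rw [ordSign, ordSign, ordSign, h, ← pairProd_mul]
  exact pairProd_congr fun u _ v _ _ => revSign_comp f g u v

theorem ordSign_eq_one [LinearOrder V] [LinearOrder W] [Fintype V] (f : V ≃ W)
    (h : ∀ u v, u < v → f u < f v) : ordSign f = 1 := by
  refine Finset.prod_eq_one fun p hp => ?_
  have hp : p.1 < p.2 := (Finset.mem_filter.1 hp).2
  simp [revSign, hp, h _ _ hp]

/-- The parity of the number of elements below `a`. -/
def belowSign [LinearOrder V] [Fintype V] (a : V) : ℤˣ :=
  ∏ v : V, if v < a then -1 else 1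

theorem belowSign_eq [LinearOrder V] [Fintype V] (a : V) :
    belowSign a = (-1) ^ Fintype.card {v : V // v < a} := by
  rw [belowSign, Finset.prod_ite, Finset.prod_const, Finset.prod_const_one, mul_one,
    Fintype.card_subtype]

theorem ordSign_eq_card [LinearOrder V] [LinearOrder W] [Fintype V] (f : V ≃ W) :
    ordSign f = (-1) ^ Fintype.card {p : V × V // p.1 < p.2 ∧ f p.2 < f p.1} := by
  rw [ordSign, pairProd]
  have : ∀ p ∈ (Finset.univ ×ˢ Finset.univ : Finset (V × V)).filter (fun p => p.1 < p.2),
      revSign f p.1 p.2 = if f p.2 < f p.1 then -1 else 1 := by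
    intro p hp
    have hp : p.1 < p.2 := (Finset.mem_filter.1 hp).2
    have hn : f p.1 ≠ f p.2 := fun e => hp.ne (f.injective e)
    rcases lt_or_gt_of_ne hn with h | h
    · simp [revSign, hp, h, h.not_gt]
    · simp [revSign, hp, h, h.not_gt]
  rw [Finset.prod_congr rfl this, Finset.prod_ite, Finset.prod_const, Finset.prod_const_one,
    mul_one, Finset.filter_filter, Fintype.card_subtype, Finset.univ_product_univ]

/-- Removing a point from the source and its image from the target. -/
theorem ordSign_puncture [LinearOrder V] [LinearOrder W] [Fintype V] [Fintype W] (f : V ≃ W)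
    (a : V) (g : {v : V // v ≠ a} ≃ {w : W // w ≠ f a}) (hg : ∀ v, (g v : W) = f v) :
    ordSign f = ordSign g * belowSign a * belowSign (f a) := by
  have hu : (Finset.univ : Finset V) =
      insert a ((Finset.univ : Finset {v : V // v ≠ a}).map (Function.Embedding.subtype _)) := by
    ext v
    by_cases h : v = a <;> simp [h]
  rw [ordSign, hu, pairProd_insert (revSign_comm f.injective) (by simp),
    pairProd_map (revSign_comm f.injective), Finset.prod_map]
  have h1 : pairProd Finset.univ (fun u v : {v : V // v ≠ a} => revSign f u v) = ordSign g := by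
    refine pairProd_congr fun u _ v _ _ => ?_
    simp only [revSign, ← Subtype.coe_lt_coe, hg]
  have h2 : belowSign a = ∏ v : {v : V // v ≠ a}, if v.1 < a then (-1 : ℤˣ) else 1 := by
    rw [belowSign, hu, Finset.prod_insert (by simp), Finset.prod_map, if_neg (lt_irrefl a), one_mul]
    rfl
  have h3 : belowSign (f a) = ∏ v : {v : V // v ≠ a}, if f v.1 < f a then (-1 : ℤˣ) else 1 := by
    rw [belowSign, ← f.prod_comp, hu, Finset.prod_insert (by simp), Finset.prod_map,
      if_neg (lt_irrefl (f a)), one_mul]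
    rfl
  rw [mul_assoc, h2, h3, ← Finset.prod_mul_distrib]
  refine congrArg₂ (· * ·) h1 (Finset.prod_congr rfl fun v _ => ?_)
  -- The pair of `v` and `a` is reversed exactly if one, and only one, of v < a and f v < f a holds.
  rw [revSign_comm f.injective]
  change revSign f v.1 a = _
  unfold revSign
  by_cases h : v.1 < a <;> by_cases h' : f v.1 < f a <;> simp [h, h']

/-- Only the missing point `a` can change the count of points below `b`. This factor is the source
of the sign in the antisymmetry of double contractions. -/
theorem belowSign_subtype [LinearOrder V] [Fintype V] {a : V} (b : {v : V // v ≠ a}) :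
    belowSign b = belowSign b.1 * if a < b.1 then -1 else 1 := by
  have hu : (Finset.univ : Finset V) =
      insert a ((Finset.univ : Finset {v : V // v ≠ a}).map (Function.Embedding.subtype _)) := by
    ext v
    by_cases h : v = a <;> simp [h]
  rw [belowSign, belowSign, hu, Finset.prod_insert (by simp), Finset.prod_map, mul_comm, ← mul_assoc]
  have : ∀ x : ℤˣ, x * x = 1 := Int.units_mul_self
  rw [this, one_mul]
  rfl

end Signs

/-! ### Graphs in terms of darts -/

namespace OGraph

open scoped Classical

variable {k : Type*} [Field k] {O : CyclicOperad k}

theorem Iso.sign_eq {X Y : OGraph O} (f : Iso X Y) :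
    f.sign = ordSign f.V * ∏ e : X.E, if f.flip e then -1 else 1 := by
  rw [ordSign_eq_card, Finset.prod_ite, Finset.prod_const, Finset.prod_const_one, mul_one,
    Iso.sign, Fintype.card_subtype (fun e => f.flip e = true)]

theorem cls_eq_of_iso {X Y : OGraph O} (f : Iso X Y) : X.cls = f.sign • Y.cls := by
  rw [Units.smul_def, ← Int.cast_smul_eq_zsmul k, cls, cls, ← map_smul, Finsupp.smul_single,
    smul_eq_mul, mul_one]
  exact (Submodule.Quotient.eq _).2 (Submodule.subset_span (GraphRel.iso f))

/-- The vertex of a dart, that is, of an edge with a choice of one of its ends. -/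
def vtx (X : OGraph O) (d : X.E × Bool) : X.V := (X.ends d).1

/-- The half-edges at `v` as darts. -/
def dart (X : OGraph O) (v : X.V) : X.H v ↪ X.E × Bool where
  toFun h := X.ends.symm ⟨v, h⟩
  inj' h h' e := by simpa using X.ends.symm.injective e

/-- The label of `v`, as an element of `O((S))` for a set `S` of darts. -/
def loc (X : OGraph O) (v : X.V) : Loc O (X.E × Bool) := Loc.place (X.dart v) (X.label v)

theorem vtx_dart (X : OGraph O) (v : X.V) (h : X.H v) : X.vtx (X.dart v h) = v := by
  change (X.ends (X.ends.symm ⟨v, h⟩)).1 = v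
  rw [Equiv.apply_symm_apply]

theorem mem_loc (X : OGraph O) {v : X.V} {d : X.E × Bool} : d ∈ (X.loc v).1 ↔ X.vtx d = v := by
  constructor
  · rintro ⟨h, rfl⟩
    exact X.vtx_dart v h
  · rintro rfl
    exact ⟨(X.ends d).2, X.ends.symm_apply_apply d⟩

theorem loc_disjoint (X : OGraph O) {u v : X.V} (h : u ≠ v) :
    Disjoint (X.loc u).1 (X.loc v).1 :=
  Set.disjoint_left.2 fun _ h₁ h₂ => h (((X.mem_loc).1 h₁).symm.trans ((X.mem_loc).1 h₂))

theorem card_loc (X : OGraph O) (v : X.V) : 3 ≤ Nat.card (X.loc v).1 := by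
  rw [loc, Loc.card_place, Nat.card_eq_fintype_card]
  exact X.valence v

/-- The effect on darts of a bijection of edges which reverses some of the edges. -/
def dartEquiv {E E' : Type} (φ : E ≃ E') (flip : E → Bool) : E × Bool ≃ E' × Bool where
  toFun p := (φ p.1, xor p.2 (flip p.1))
  invFun p := (φ.symm p.1, xor p.2 (flip (φ.symm p.1)))
  left_inv p := by simp
  right_inv p := by simp

/-- The effect of an isomorphism on darts. -/
def Iso.dart {X Y : OGraph O} (f : Iso X Y) : X.E × Bool ≃ Y.E × Bool := dartEquiv f.E f.flip

/-- The condition on labels in an isomorphism, as an equation between labels supported on darts of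
`Y`. -/
theorem Iso.loc_eq {X Y : OGraph O} (f : Iso X Y) (v : X.V) :
    Y.loc (f.V v) = (X.loc v).push f.dart.toEmbedding := by
  rw [loc, loc, Loc.push_place]
  symm
  rw [Loc.place_eq_iff]
  refine ⟨f.H v, fun h => ?_, (f.label v).symm⟩
  change Y.ends.symm _ = _
  rw [Equiv.symm_apply_eq]
  have := f.ends (X.dart v h).1 (X.dart v h).2
  refine Eq.trans ?_ this.symm
  have e : X.ends ((X.dart v h).1, (X.dart v h).2) = ⟨v, h⟩ := X.ends.apply_symm_apply _
  rw [e]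

theorem Iso.vtx_dart {X Y : OGraph O} (f : Iso X Y) (d : X.E × Bool) :
    Y.vtx (f.dart d) = f.V (X.vtx d) := by
  have h : f.dart d ∈ (Y.loc (f.V (X.vtx d))).1 := by
    rw [f.loc_eq, Loc.push_fst]
    exact ⟨d, X.mem_loc.2 rfl, rfl⟩
  exact Y.mem_loc.1 h

/-- An isomorphism can be given by bijections of the vertices and of the edges which respect
the labels, where the labels are compared after embedding the darts into a common set. -/
theorem exists_iso {X Y : OGraph O} {D : Type} (i : X.E × Bool ↪ D) (j : Y.E × Bool ↪ D)
    (V : X.V ≃ Y.V) (E : X.E ≃ Y.E) (flip : X.E → Bool)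
    (hE : ∀ p, j (dartEquiv E flip p) = i p)
    (hL : ∀ v, (Y.loc (V v)).push j = (X.loc v).push i) :
    ∃ f : Iso X Y, f.V = V ∧ f.E = E ∧ f.flip = flip := by
  have h : ∀ v, ∃ g : X.H v ≃ Y.H (V v), (∀ h, Y.dart (V v) (g h) = dartEquiv E flip (X.dart v h)) ∧
      LabelSpace.map O g (X.label v) = Y.label (V v) := by
    intro v
    have h := (hL v).symm
    rw [loc, loc, Loc.push_place, Loc.push_place, Loc.place_eq_iff] at h
    obtain ⟨g, hg, h⟩ := h
    exact ⟨g, fun x => j.injective ((hg x).trans (hE _).symm), h⟩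
  choose g hg hl using h
  refine ⟨⟨V, E, flip, g, fun e s => ?_, fun v => (hl v).symm⟩, rfl, rfl, rfl⟩
  have h := hg _ (X.ends (e, s)).2
  have h' : X.dart _ (X.ends (e, s)).2 = (e, s) := X.ends.symm_apply_apply _
  rw [h'] at h
  change Y.ends.symm _ = _ at h
  rw [Equiv.symm_apply_eq] at h
  exact h.symm

theorem exists_iso_ordSign {X Y : OGraph O} {D : Type} (i : X.E × Bool ↪ D)
    (j : Y.E × Bool ↪ D) (V : X.V ≃ Y.V) (E : X.E ≃ Y.E)
    (hE : ∀ p, j (E p.1, p.2) = i p)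
    (hL : ∀ v, (Y.loc (V v)).push j = (X.loc v).push i) :
    ∃ f : Iso X Y, f.V = V ∧ f.E = E ∧ f.sign = ordSign V := by
  obtain ⟨f, rfl, rfl, h⟩ := exists_iso i j V E (fun _ => false) (fun p => by
    rw [← hE]; simp [dartEquiv]) hL
  refine ⟨f, rfl, rfl, ?_⟩
  rw [f.sign_eq, h]
  simp

/-- The graph with given vertices, edges, incidence relation and labels. -/
abbrev ofLoc (V E : Type) [Fintype V] [LinearOrder V] [Fintype E] (vt : E × Bool → V) {D : Type}
    (j : E × Bool ↪ D) (L : V → Loc O D)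
    (hL : ∀ v d, d ∈ (L v).1 ↔ ∃ p, vt p = v ∧ j p = d) (hc : ∀ v, 3 ≤ Nat.card (L v).1) :
    OGraph O where
  V := V
  E := E
  H v := {p : E × Bool // vt p = v}
  ends := (Equiv.sigmaFiberEquiv vt).symm
  valence v := by
    have h := hc v
    rw [← Loc.place_restrict ((Function.Embedding.subtype fun p => vt p = v).trans j) (L v)
      (by ext d; rw [hL]; simp), Loc.card_place, Nat.card_eq_fintype_card] at h
    convert h
  label v := Loc.restrict ((Function.Embedding.subtype fun p => vt p = v).trans j) (L v)
    (by ext d; rw [hL]; simp)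

theorem push_loc_ofLoc (V E : Type) [Fintype V] [LinearOrder V] [Fintype E] (vt : E × Bool → V)
    {D : Type} (j : E × Bool ↪ D) (L : V → Loc O D)
    (hL : ∀ v d, d ∈ (L v).1 ↔ ∃ p, vt p = v ∧ j p = d) (hc : ∀ v, 3 ≤ Nat.card (L v).1) (v : V) :
    ((ofLoc V E vt j L hL hc).loc v).push j = L v := by
  refine (Loc.push_place j _ _).trans ?_
  exact Loc.place_restrict ((Function.Embedding.subtype fun p => vt p = v).trans j) (L v) _

/-! ### Absorbing one end of an edge into the other -/

/-- The other end of the same edge. -/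
def opp {E : Type} (d : E × Bool) : E × Bool := (d.1, !d.2)

/-- The darts which do not belong to the edge `e`. -/
def dartEmb {E : Type} (e : E) : {f : E // f ≠ e} × Bool ↪ E × Bool :=
  (Function.Embedding.subtype _).prodMap (Function.Embedding.refl _)

section Absorb

variable (X : OGraph O) (d : X.E × Bool)

/-- The vertex of `d` goes to the other end of the edge. -/
def absorbV (h : X.vtx d ≠ X.vtx (opp d)) (v : X.V) : {v : X.V // v ≠ X.vtx d} :=
  if hv : v = X.vtx d then ⟨X.vtx (opp d), h.symm⟩ else ⟨v, hv⟩

/-- The labels after the vertex of `d` is absorbed by the other end of the edge. -/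
def absorbLoc (v : X.V) : Loc O (X.E × Bool) :=
  if v = X.vtx (opp d) then (X.loc (X.vtx d)).graft d (opp d) (X.loc (X.vtx (opp d))) else X.loc v

theorem absorbV_self (h : X.vtx d ≠ X.vtx (opp d)) :
    X.absorbV d h (X.vtx d) = ⟨X.vtx (opp d), h.symm⟩ := dif_pos rfl

theorem absorbV_of_ne (h : X.vtx d ≠ X.vtx (opp d)) {v : X.V} (hv : v ≠ X.vtx d) :
    X.absorbV d h v = ⟨v, hv⟩ := dif_neg hv

theorem eq_or_eq_opp_iff {E : Type} {d p : E × Bool} : p.1 = d.1 ↔ p = d ∨ p = opp d := by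
  obtain ⟨e, s⟩ := d
  obtain ⟨f, t⟩ := p
  simp only [opp, Prod.mk.injEq]
  cases s <;> cases t <;> simp

variable {X d}

/-- Supports of the new labels match the new incidence relation, as the construction `ofLoc`
requires: the two halves of the edge disappear, and the other darts of the removed vertex move to
the far end. -/
theorem mem_absorbLoc (h : X.vtx d ≠ X.vtx (opp d)) (v : {v : X.V // v ≠ X.vtx d})
    (p : X.E × Bool) :
    p ∈ (X.absorbLoc d v).1 ↔ p.1 ≠ d.1 ∧ X.absorbV d h (X.vtx p) = v := by
  rw [Ne, eq_or_eq_opp_iff, not_or]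
  obtain ⟨v, hv⟩ := v
  change p ∈ (X.absorbLoc d v).1 ↔ _
  by_cases hb : v = X.vtx (opp d)
  · subst hb
    rw [absorbLoc, if_pos rfl, Loc.graft_fst (X.mem_loc.2 rfl) (X.mem_loc.2 rfl) (X.loc_disjoint h)]
    simp only [Set.mem_union, Set.mem_sdiff, mem_loc, Set.mem_singleton_iff]
    by_cases hp : X.vtx p = X.vtx d
    · rw [hp, absorbV_self]
      have : p ≠ opp d := fun e => h (by rw [← hp, e])
      simp [this, h]
    · rw [absorbV_of_ne _ _ _ hp]
      have : p ≠ d := fun e => hp (by rw [e])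
      simp [this, hp, and_comm]
  · rw [absorbLoc, if_neg hb, mem_loc]
    by_cases hp : X.vtx p = X.vtx d
    · rw [hp, absorbV_self]
      have h1 : X.vtx d ≠ v := fun e => hv e.symm
      have h2 : X.vtx (opp d) ≠ v := fun e => hb e.symm
      simp [h1, h2]
    · rw [absorbV_of_ne _ _ _ hp]
      have h1 : p ≠ d := fun e => hp (by rw [e])
      simp only [h1, not_false_eq_true, Subtype.mk.injEq, true_and]
      refine ⟨fun e => ⟨fun e' => hb ?_, e⟩, And.right⟩
      rw [← e, e']

theorem card_absorbLoc (h : X.vtx d ≠ X.vtx (opp d)) (v : X.V) :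
    3 ≤ Nat.card (X.absorbLoc d v).1 := by
  rw [absorbLoc]
  split_ifs
  · exact Loc.card_graft (X.mem_loc.2 rfl) (X.mem_loc.2 rfl) (X.loc_disjoint h) (X.card_loc _)
      (X.card_loc _)
  · exact X.card_loc _

variable (X d) in
/-- The contraction of the edge of `d`, in which the vertex of `d` is removed and the other end of
the edge becomes the new vertex. -/
abbrev absorb (h : X.vtx d ≠ X.vtx (opp d)) : OGraph O :=
  ofLoc {v : X.V // v ≠ X.vtx d} {f : X.E // f ≠ d.1}
    (fun p => X.absorbV d h (X.vtx (dartEmb d.1 p))) (dartEmb d.1) (fun v => X.absorbLoc d v)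
    (fun v p => by
      rw [mem_absorbLoc h]
      constructor
      · rintro ⟨h₁, h₂⟩
        exact ⟨(⟨p.1, h₁⟩, p.2), h₂, rfl⟩
      · rintro ⟨q, h₁, rfl⟩
        exact ⟨q.1.2, h₁⟩)
    (fun v => card_absorbLoc h v)

theorem push_loc_absorb (h : X.vtx d ≠ X.vtx (opp d)) (v : {v : X.V // v ≠ X.vtx d}) :
    ((X.absorb d h).loc v).push (dartEmb d.1) = X.absorbLoc d v := push_loc_ofLoc ..

theorem card_absorb (h : X.vtx d ≠ X.vtx (opp d)) :
    Fintype.card (X.absorb d h).V + 1 = Fintype.card X.V := by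
  have h1 : Fintype.card (X.absorb d h).V = Fintype.card {v : X.V // v ≠ X.vtx d} :=
    Fintype.card_congr (Equiv.refl _)
  have h2 : 0 < Fintype.card X.V := Fintype.card_pos_iff.2 ⟨X.vtx d⟩
  rw [h1, Fintype.card_subtype_compl, Fintype.card_subtype_eq]
  omega

end Absorb

end OGraph

namespace OGraph

open scoped Classical

variable {k : Type*} [Field k] {O : CyclicOperad k}

/-! ### Contraction in terms of absorption -/

theorem Iso.vtx_dart_opp {X Y : OGraph O} (f : Iso X Y) (d : X.E × Bool) :
    Y.vtx (opp (f.dart d)) = f.V (X.vtx (opp d)) := by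
  rw [← f.vtx_dart]
  congr 1
  simp [opp, Iso.dart, dartEquiv]

theorem Iso.absorb_ne {X Y : OGraph O} (f : Iso X Y) {d : X.E × Bool}
    (h : X.vtx d ≠ X.vtx (opp d)) : Y.vtx (f.dart d) ≠ Y.vtx (opp (f.dart d)) := by
  rw [f.vtx_dart, f.vtx_dart_opp]
  exact f.V.injective.ne h

/-- The sign with which the contraction of the edge of `d` appears when the vertex of `d` is
removed. -/
def dartSign (X : OGraph O) (d : X.E × Bool) : ℤˣ :=
  (if d.2 then -1 else 1) * belowSign (X.vtx d)

theorem Iso.absorbLoc_eq {X Y : OGraph O} (f : Iso X Y) {d : X.E × Bool}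
    (h : X.vtx d ≠ X.vtx (opp d)) (v : X.V) :
    Y.absorbLoc (f.dart d) (f.V v) = (X.absorbLoc d v).push f.dart.toEmbedding := by
  rw [absorbLoc, absorbLoc, f.vtx_dart_opp, f.vtx_dart]
  by_cases hv : v = X.vtx (opp d)
  · rw [if_pos hv, if_pos (by rw [hv]),
      Loc.push_graft _ (X.mem_loc.2 rfl) (X.mem_loc.2 rfl) (X.loc_disjoint h), f.loc_eq, f.loc_eq]
    congr 1
    simp [opp, Iso.dart, dartEquiv]
  · rw [if_neg hv, if_neg (fun e => hv (f.V.injective e)), f.loc_eq]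

/-- An isomorphism induces an isomorphism after contraction of corresponding edges. -/
theorem Iso.exists_absorb {X Y : OGraph O} (f : Iso X Y) {d : X.E × Bool}
    (h : X.vtx d ≠ X.vtx (opp d)) :
    ∃ g : Iso (X.absorb d h) (Y.absorb (f.dart d) (f.absorb_ne h)),
      X.dartSign d * g.sign = f.sign * Y.dartSign (f.dart d) ∧
      ∀ e : {e : X.E // e ≠ d.1}, (g.E e : {e : Y.E // e ≠ f.E d.1}).1 = f.E e.1 := by
  let V : {v : X.V // v ≠ X.vtx d} ≃ {v : Y.V // v ≠ f.V (X.vtx d)} := puncture f.V rfl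
  let c : {v : Y.V // v ≠ f.V (X.vtx d)} ≃ {v : Y.V // v ≠ Y.vtx (f.dart d)} :=
    Equiv.subtypeEquivRight fun v => by rw [f.vtx_dart]
  let E : {e : X.E // e ≠ d.1} ≃ {e : Y.E // e ≠ f.E d.1} := puncture f.E rfl
  obtain ⟨g, hV, hE, hf⟩ := exists_iso (X := X.absorb d h) (Y := Y.absorb (f.dart d) (f.absorb_ne h))
    ((dartEmb d.1).trans f.dart.toEmbedding) (dartEmb (f.E d.1)) (V.trans c) E
    (fun e => f.flip e.1) (fun p => rfl) (fun v => by
      refine ((push_loc_absorb (f.absorb_ne h) _).trans (f.absorbLoc_eq h v.1)).trans ?_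
      rw [← push_loc_absorb h v, Loc.push_push])
  refine ⟨g, ?_, fun e => by rw [hE]; rfl⟩
  rw [g.sign_eq, f.sign_eq, hf]
  have h1 : ordSign g.V = ordSign V := by
    rw [hV]
    refine (ordSign_trans V c).trans ?_
    rw [ordSign_eq_one c, mul_one]
    exact fun u v h => h
  -- Deleting the vertex and its image changes the sign of the vertex bijection by the two factors
  -- `belowSign`, which are those of the two `dartSign`s.
  have h2 := ordSign_puncture f.V (X.vtx d) V (fun _ => rfl)
  have h3 : (∏ e : X.E, if f.flip e then (-1 : ℤˣ) else 1) =
      (if f.flip d.1 then -1 else 1) * ∏ e : {e : X.E // e ≠ d.1}, if f.flip e.1 then -1 else 1 := by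
    rw [Fintype.prod_eq_mul_prod_subtype_ne _ d.1]
  -- The reversal of the contracted edge is lost from the product over edges, but it reappears as
  -- the change of the end named by the dart.
  have h4 : (if (f.dart d).2 then (-1 : ℤˣ) else 1) =
      (if d.2 then -1 else 1) * if f.flip d.1 then -1 else 1 := by
    have : ∀ a b : Bool, (if xor a b then (-1 : ℤˣ) else 1) =
      (if a then -1 else 1) * if b then -1 else 1 := by decide
    exact this _ _
  have h5 : ∀ x : ℤˣ, x * x = 1 := Int.units_mul_self
  rw [h1, h2, h3, dartSign, dartSign, h4, f.vtx_dart]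
  change _ * (_ * ∏ e : {e : X.E // e ≠ d.1}, if f.flip e.1 then (-1 : ℤˣ) else 1) = _
  generalize (if f.flip d.1 then (-1 : ℤˣ) else 1) = x1
  have h6 : x1 * x1 = 1 := h5 x1
  have h7 := h5 (belowSign (f.V (X.vtx d)))
  generalize (if d.2 then (-1 : ℤˣ) else 1) = x2
  generalize ordSign V = x3
  generalize belowSign (X.vtx d) = x4
  generalize belowSign (f.V (X.vtx d)) = x5 at h7
  generalize (∏ e : {e : X.E // e ≠ d.1}, if f.flip e.1 then (-1 : ℤˣ) else 1) = x6
  calc x2 * x4 * (x3 * x6) = x2 * x4 * (x3 * x6) * (x1 * x1) * (x5 * x5) := by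
        rw [h6, h7, mul_one, mul_one]
    _ = _ := by simp only [mul_left_comm, mul_comm]

/-- The labels `u` and `w` are arbitrary, so that linearity of contraction in the labels can later
be read off from linearity of grafting. -/
theorem push_place_contract (X : OGraph O) {e : X.E} (he : ¬ X.IsLoop e)
    (u : LabelSpace O (X.H (X.vert e false))) (w : LabelSpace O (X.H (X.vert e true))) :
    (Loc.place ((X.contract e he).dart (none : Option _))
        (LabelSpace.graft O (X.half e false) (X.half e true) u w)).push (dartEmb e) =
      (Loc.place (X.dart (X.vert e false)) u).graft (e, false) (e, true)
        (Loc.place (X.dart (X.vert e true)) w) := by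
  have h := Loc.graft_place (X.dart (X.vert e false)) (X.dart (X.vert e true))
    (fun a b h => he (by
      have h' := congrArg X.vtx h
      rwa [vtx_dart, vtx_dart] at h')) (X.half e false) (X.half e true) u w
  have h1 : ∀ s, X.dart (X.vert e s) (X.half e s) = (e, s) :=
    fun s => X.ends.symm_apply_apply (e, s)
  rw [h1, h1] at h
  refine Eq.trans ?_ h.symm
  refine (Loc.push_place _ _ _).trans ?_
  refine congrArg (fun i => Loc.place i _) (Function.Embedding.ext ?_)
  rintro (a | a) <;> rfl

theorem push_loc_contract_none (X : OGraph O) {e : X.E} (he : ¬ X.IsLoop e) :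
    ((X.contract e he).loc (none : Option _)).push (dartEmb e) =
      (X.loc (X.vtx (e, false))).graft (e, false) (e, true) (X.loc (X.vtx (e, true))) :=
  X.push_place_contract he (X.label (X.vert e false)) (X.label (X.vert e true))

theorem push_loc_contract_some (X : OGraph O) {e : X.E} (he : ¬ X.IsLoop e)
    (v : {v : X.V // v ≠ X.vert e false ∧ v ≠ X.vert e true}) :
    ((X.contract e he).loc (some v)).push (dartEmb e) = X.loc v := by
  refine (Loc.push_place _ _ _).trans ?_
  rfl

theorem absorb_ne_of_not_isLoop {X : OGraph O} {e : X.E} (he : ¬ X.IsLoop e) (s : Bool) :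
    X.vtx (e, s) ≠ X.vtx (opp (e, s)) := by
  cases s
  · exact he
  · exact fun h => he h.symm

/-- A vertex of the contraction as a vertex of the original graph, the new vertex being one of the
ends of the edge. -/
def contractVFun (X : OGraph O) {e : X.E} (he : ¬ X.IsLoop e) (s : Bool) :
    X.ContractV e → {v : X.V // v ≠ X.vtx (e, s)}
  | none => ⟨X.vtx (opp (e, s)), (absorb_ne_of_not_isLoop he s).symm⟩
  | some v => ⟨v.1, by cases s; exacts [v.2.1, v.2.2]⟩

theorem contractVFun_bijective (X : OGraph O) {e : X.E} (he : ¬ X.IsLoop e) (s : Bool) :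
    Function.Bijective (X.contractVFun he s) := by
  have hs : ∀ v : {v : X.V // v ≠ X.vert e false ∧ v ≠ X.vert e true},
      v.1 ≠ X.vtx (opp (e, s)) := by
    intro v
    cases s
    exacts [v.2.2, v.2.1]
  constructor
  · rintro (_ | u) (_ | v) h
    · rfl
    · exact (hs v (congrArg Subtype.val h).symm).elim
    · exact (hs u (congrArg Subtype.val h)).elim
    · have h' := congrArg Subtype.val h
      exact congrArg some (Subtype.ext (show u.1 = v.1 from h'))
  · intro v
    by_cases h : v.1 = X.vtx (opp (e, s))
    · exact ⟨none, Subtype.ext h.symm⟩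
    · exact ⟨some ⟨v.1, by cases s; exacts [⟨v.2, h⟩, ⟨h, v.2⟩]⟩, rfl⟩

/-- The vertices of the contraction. -/
def contractVEquiv (X : OGraph O) {e : X.E} (he : ¬ X.IsLoop e) (s : Bool) :
    X.ContractV e ≃ {v : X.V // v ≠ X.vtx (e, s)} :=
  Equiv.ofBijective _ (X.contractVFun_bijective he s)

/-- The count for the terminal vertex leaves out the start of the edge; including it costs a sign
exactly if the start is the smaller of the two. -/
theorem contractSign_eq (X : OGraph O) (e : X.E) :
    X.contractSign e = belowSign (X.vtx (e, false)) *
      (belowSign (X.vtx (e, true)) *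
        if X.vtx (e, false) < X.vtx (e, true) then -1 else 1) := by
  rw [contractSign, pow_add, belowSign_eq, belowSign_eq]
  refine congrArg₂ (· * ·) rfl ?_
  change (-1) ^ Fintype.card {v : X.V // v < X.vtx (e, true) ∧ v ≠ X.vtx (e, false)} = _
  rw [Fintype.card_subtype, Fintype.card_subtype]
  split_ifs with h
  · have : Finset.univ.filter (fun v => v < X.vtx (e, true)) = insert (X.vtx (e, false))
        (Finset.univ.filter fun v => v < X.vtx (e, true) ∧ v ≠ X.vtx (e, false)) := by
      ext v
      by_cases hv : v = X.vtx (e, false) <;> simp [hv, h]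
    rw [this, Finset.card_insert_of_notMem (by simp), pow_succ, mul_assoc]
    simp
  · rw [mul_one]
    congr 2
    ext v
    simp only [Finset.mem_filter, Finset.mem_univ, true_and, and_iff_left_iff_imp]
    rintro hv rfl
    exact h hv

/-- The new vertex `⊥` has nothing below it and moves to the place of the surviving end, while the
other vertices keep their order. So the sign counts what lies below the surviving end once the other
end is gone. -/
theorem ordSign_contractVEquiv (X : OGraph O) {e : X.E} (he : ¬ X.IsLoop e) (s : Bool) :
    ordSign (X.contractVEquiv he s) = belowSign (X.vtx (opp (e, s))) *
      if X.vtx (e, s) < X.vtx (opp (e, s)) then -1 else 1 := by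
  let V := X.contractVEquiv he s
  let V' : {v : X.ContractV e // v ≠ ⊥} ≃ {v // v ≠ V ⊥} := puncture V rfl
  have h := ordSign_puncture V ⊥ V' (fun _ => rfl)
  have h1 : belowSign (⊥ : X.ContractV e) = 1 :=
    Finset.prod_eq_one fun v _ => if_neg not_lt_bot
  have h2 : ordSign V' = 1 := by
    refine ordSign_eq_one _ ?_
    rintro ⟨_ | u, hu⟩ ⟨_ | v, hv⟩ h
    · exact (hu rfl).elim
    · exact (hu rfl).elim
    · exact (hv rfl).elim
    · have h' : u < v := WithBot.coe_lt_coe.1 (show (u : X.ContractV e) < v from h)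
      exact h'
  rw [h1, mul_one] at h
  erw [h2, one_mul] at h
  refine h.trans ?_
  exact belowSign_subtype (V ⊥)

/-- The sign comparing the order of the two ends occurs in both factors. If the start is absorbed,
it occurs twice and cancels; if the terminal vertex is absorbed, it meets the opposite comparison,
and the product is the -1 in `dartSign`. -/
theorem exists_contract_iso (X : OGraph O) {e : X.E} (he : ¬ X.IsLoop e) (s : Bool) :
    ∃ g : Iso (X.contract e he) (X.absorb (e, s) (absorb_ne_of_not_isLoop he s)),
      X.contractSign e * g.sign = X.dartSign (e, s) ∧ g.E = Equiv.refl _ := by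
  have hs := absorb_ne_of_not_isLoop he s
  obtain ⟨g, hV, hE, hg⟩ := exists_iso_ordSign (X := X.contract e he)
    (Y := X.absorb (e, s) hs)
    (dartEmb e) (dartEmb e) (X.contractVEquiv he s) (Equiv.refl _) (fun _ => rfl) (by
      rintro (_ | v)
      · refine Eq.trans ?_ (X.push_loc_contract_none he).symm
        refine (push_loc_absorb hs _).trans ?_
        refine (if_pos rfl).trans ?_
        -- For the start the two grafts are literally the same; for the terminal vertex their
        -- arguments are exchanged.
        cases s
        · rfl
        · exact Loc.graft_comm (X.mem_loc.2 rfl) (X.mem_loc.2 rfl) (X.loc_disjoint hs)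
            ((X.card_loc _).trans' (by omega)) ((X.card_loc _).trans' (by omega))
      · refine Eq.trans ?_ (X.push_loc_contract_some he v).symm
        refine (push_loc_absorb hs _).trans ?_
        refine if_neg ?_
        cases s
        exacts [v.2.2, v.2.1])
  refine ⟨g, ?_, hE⟩
  have h5 : ∀ x : ℤˣ, x * x = 1 := Int.units_mul_self
  have h : g.sign = _ := hg.trans (ordSign_contractVEquiv X he s)
  rw [h, contractSign_eq, dartSign]
  have hne : X.vtx (e, false) ≠ X.vtx (e, true) := he
  have h6 := h5 (belowSign (X.vtx (e, true)))
  have h7 := h5 (belowSign (X.vtx (e, false)))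
  have h8 := h5 (if X.vtx (e, false) < X.vtx (e, true) then (-1 : ℤˣ) else 1)
  cases s
  · change belowSign (X.vtx (e, false)) *
      (belowSign (X.vtx (e, true)) *
        if X.vtx (e, false) < X.vtx (e, true) then -1 else 1) *
        (belowSign (X.vtx (e, true)) *
        if X.vtx (e, false) < X.vtx (e, true) then -1 else 1) = 1 * _
    rw [mul_assoc, mul_mul_mul_comm (belowSign (X.vtx (e, true))), h6, h8, one_mul, mul_one,
      one_mul]
  · change belowSign (X.vtx (e, false)) *
      (belowSign (X.vtx (e, true)) *
        if X.vtx (e, false) < X.vtx (e, true) then -1 else 1) *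
        (belowSign (X.vtx (e, false)) *
        if X.vtx (e, true) < X.vtx (e, false) then -1 else 1) = -1 * _
    rw [mul_mul_mul_comm, h7, one_mul, mul_assoc, mul_comm (-1)]
    congr 1
    rcases lt_or_gt_of_ne hne with h | h
    · simp [h, h.not_gt]
    · simp [h, h.not_gt]

theorem contracted_of_isLoop (X : OGraph O) {e : X.E} (he : X.IsLoop e) : X.contracted e = 0 :=
  dif_pos he

/-- The contraction of an edge as absorption of either of its ends. -/
theorem contracted_eq (X : OGraph O) (d : X.E × Bool) (h : X.vtx d ≠ X.vtx (opp d)) :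
    X.contracted d.1 = X.dartSign d • (X.absorb d h).cls := by
  have he : ¬ X.IsLoop d.1 := by
    intro he
    obtain ⟨e, s⟩ := d
    cases s
    · exact h he
    · exact h he.symm
  obtain ⟨g, hg, -⟩ := X.exists_contract_iso he d.2
  rw [contracted, dif_neg he, ← hg, mul_smul, ← Units.smul_def]
  congr 1
  exact cls_eq_of_iso g

theorem isLoop_iff (X : OGraph O) (d : X.E × Bool) : X.IsLoop d.1 ↔ X.vtx d = X.vtx (opp d) := by
  obtain ⟨e, s⟩ := d
  cases s
  · exact Iff.rfl
  · exact eq_comm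

theorem Iso.isLoop_iff {X Y : OGraph O} (f : Iso X Y) (e : X.E) :
    Y.IsLoop (f.E e) ↔ X.IsLoop e := by
  refine (OGraph.isLoop_iff Y (f.dart (e, false))).trans ?_
  rw [f.vtx_dart, f.vtx_dart_opp, f.V.injective.eq_iff]
  exact (OGraph.isLoop_iff X (e, false)).symm

theorem Iso.contracted_eq {X Y : OGraph O} (f : Iso X Y) (e : X.E) :
    X.contracted e = f.sign • Y.contracted (f.E e) := by
  by_cases he : X.IsLoop e
  · rw [contracted_of_isLoop _ he, contracted_of_isLoop _ ((f.isLoop_iff e).2 he), smul_zero]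
  · have h := absorb_ne_of_not_isLoop he false
    obtain ⟨g, hg, -⟩ := f.exists_absorb h
    rw [OGraph.contracted_eq X (e, false) h, cls_eq_of_iso g, smul_smul, hg, mul_smul]
    congr 1
    exact (OGraph.contracted_eq Y _ (f.absorb_ne h)).symm

end OGraph

section WellDefined

open scoped Classical

variable {k : Type*} [Field k] {O : CyclicOperad k}

/-! ### Linear maps on the space of graphs -/

namespace GraphSpace

variable {M : Type*} [AddCommGroup M] [Module k M]

theorem hom_ext {f g : GraphSpace O →ₗ[k] M} (h : ∀ X : OGraph O, f X.cls = g X.cls) : f = g := by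
  refine Submodule.linearMap_qext _ (Finsupp.lhom_ext' fun X => LinearMap.ext_ring ?_)
  exact h X

/-- A function on graphs which respects the relations. -/
structure Respects (f : OGraph O → M) : Prop where
  iso : ∀ {X Y : OGraph O} (φ : OGraph.Iso X Y), f X = φ.sign • f Y
  add : ∀ (X : OGraph O) (v : X.V) (a b : LabelSpace O (X.H v)),
    f (X.withLabel v (a + b)) = f (X.withLabel v a) + f (X.withLabel v b)
  smul : ∀ (X : OGraph O) (v : X.V) (c : k) (a : LabelSpace O (X.H v)),
    f (X.withLabel v (c • a)) = c • f (X.withLabel v a)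

theorem Respects.exists_lift {f : OGraph O → M} (hf : Respects f) :
    ∃ T : GraphSpace O →ₗ[k] M, ∀ X : OGraph O, T X.cls = f X := by
  refine ⟨Submodule.liftQ _ (Finsupp.lsum k fun X => LinearMap.toSpanSingleton k M (f X)) ?_,
    fun X => ?_⟩
  · rw [Submodule.span_le]
    rintro _ (⟨φ⟩ | ⟨X, v, a, b⟩ | ⟨X, v, c, a⟩)
    · rw [SetLike.mem_coe, LinearMap.mem_ker, map_sub]
      simp only [Finsupp.lsum_single, LinearMap.toSpanSingleton_apply, one_smul]
      rw [hf.iso φ, Units.smul_def, Int.cast_smul_eq_zsmul, sub_self]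
    · rw [SetLike.mem_coe, LinearMap.mem_ker, map_sub, map_sub]
      simp [hf.add X v a b]
    · rw [SetLike.mem_coe, LinearMap.mem_ker, map_sub]
      simp [hf.smul X v c a]
  · simp [OGraph.cls, Submodule.liftQ_apply]

theorem Respects.ofValues {f : OGraph O → M} (hf : Respects f) (X : OGraph O) :
    ofValues f X.cls = f X := by
  rw [GraphSpace.ofValues, dif_pos hf.exists_lift]
  exact hf.exists_lift.choose_spec X

end GraphSpace

namespace OGraph

theorem cls_withLabel_add (X : OGraph O) (v : X.V) (a b : LabelSpace O (X.H v)) :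
    (X.withLabel v (a + b)).cls = (X.withLabel v a).cls + (X.withLabel v b).cls := by
  have := (Submodule.Quotient.mk_eq_zero (Submodule.span k {z | GraphRel O z})).2
    (Submodule.subset_span (s := {z | GraphRel O z}) (GraphRel.add X v a b))
  rw [← Submodule.mkQ_apply, map_sub, map_sub, sub_sub, sub_eq_zero] at this
  exact this

theorem cls_withLabel_smul (X : OGraph O) (v : X.V) (c : k) (a : LabelSpace O (X.H v)) :
    (X.withLabel v (c • a)).cls = c • (X.withLabel v a).cls := by
  have := (Submodule.Quotient.mk_eq_zero (Submodule.span k {z | GraphRel O z})).2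
    (Submodule.subset_span (s := {z | GraphRel O z}) (GraphRel.smul X v c a))
  rw [← Submodule.mkQ_apply, map_sub, sub_eq_zero] at this
  refine this.trans ?_
  rw [cls, ← map_smul, Finsupp.smul_single, smul_eq_mul, mul_one]

theorem loc_withLabel_self (X : OGraph O) (v : X.V) (u : LabelSpace O (X.H v)) :
    (X.withLabel v u).loc v = Loc.place (X.dart v) u :=
  congrArg (Loc.place (X.dart v)) (by apply Function.update_self)

theorem loc_withLabel_of_ne (X : OGraph O) {v w : X.V} (u : LabelSpace O (X.H v)) (h : w ≠ v) :
    (X.withLabel v u).loc w = X.loc w :=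
  congrArg (Loc.place (X.dart w)) (by apply Function.update_of_ne h)

theorem cls_eq_of_loc_eq {X Y : OGraph O} {D : Type} (i : X.E × Bool ↪ D) (j : Y.E × Bool ↪ D)
    (V : X.V ≃ Y.V) (E : X.E ≃ Y.E) (hV : ∀ u v, u < v → V u < V v)
    (hE : ∀ p, j (E p.1, p.2) = i p)
    (hL : ∀ v, (Y.loc (V v)).push j = (X.loc v).push i) : X.cls = Y.cls := by
  obtain ⟨f, -, -, hf⟩ := exists_iso_ordSign i j V E hE hL
  rw [cls_eq_of_iso f, hf, ordSign_eq_one V hV, one_smul]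

/-- The contraction of an edge is linear in each label. -/
theorem exists_contract_withLabel (X : OGraph O) {e : X.E} (he : ¬ X.IsLoop e) (v : X.V) :
    ∃ (w : (X.contract e he).V)
      (φ : LabelSpace O (X.H v) →ₗ[k] LabelSpace O ((X.contract e he).H w)),
      ∀ u, ((X.withLabel v u).contract e he).cls = ((X.contract e he).withLabel w (φ u)).cls := by
  have key : ∀ u w (φu : LabelSpace O ((X.contract e he).H w)),
      (∀ x, (((X.contract e he).withLabel w φu).loc x).push (dartEmb e) =
        (((X.withLabel v u).contract e he).loc x).push (dartEmb e)) →
      ((X.withLabel v u).contract e he).cls = ((X.contract e he).withLabel w φu).cls :=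
    fun u w φu h => cls_eq_of_loc_eq (X := (X.withLabel v u).contract e he)
      (Y := (X.contract e he).withLabel w φu) (dartEmb e) (dartEmb e) (Equiv.refl _)
      (Equiv.refl _) (fun _ _ h => h) (fun _ => rfl) h
  have hsome : ∀ u (x : {v : X.V // v ≠ X.vert e false ∧ v ≠ X.vert e true}),
      x.1 ≠ v → (((X.withLabel v u).contract e he).loc (some x)).push (dartEmb e) =
        X.loc x.1 :=
    fun u x hx => ((X.withLabel v u).push_loc_contract_some he x).trans (X.loc_withLabel_of_ne u hx)
  -- The label of `v` enters the contraction as the first argument of the graft, as its second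
  -- argument, or unchanged; each dependence is linear.
  by_cases h₀ : v = X.vert e false
  · subst h₀
    refine ⟨(none : Option _), (LabelSpace.graft O (X.half e false) (X.half e true)).flip
      (X.label (X.vert e true)), fun u => key _ _ _ ?_⟩
    rintro (_ | x)
    · refine Eq.trans ?_ ((X.withLabel (X.vert e false) u).push_loc_contract_none he).symm
      refine (congrArg (Loc.push _) (loc_withLabel_self (X.contract e he) _ _)).trans ?_
      refine (X.push_place_contract he u (X.label (X.vert e true))).trans ?_
      exact congrArg₂ (Loc.graft _ _) (X.loc_withLabel_self _ u).symm
        (X.loc_withLabel_of_ne u (fun h => he h.symm)).symm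
    · refine Eq.trans ?_ (hsome u x x.2.1).symm
      refine (congrArg (Loc.push _) (loc_withLabel_of_ne (X.contract e he) _
        (Option.some_ne_none x))).trans ?_
      exact X.push_loc_contract_some he x
  by_cases h₁ : v = X.vert e true
  · subst h₁
    refine ⟨(none : Option _), LabelSpace.graft O (X.half e false) (X.half e true)
      (X.label (X.vert e false)), fun u => key _ _ _ ?_⟩
    rintro (_ | x)
    · refine Eq.trans ?_ ((X.withLabel (X.vert e true) u).push_loc_contract_none he).symm
      refine (congrArg (Loc.push _) (loc_withLabel_self (X.contract e he) _ _)).trans ?_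
      refine (X.push_place_contract he (X.label (X.vert e false)) u).trans ?_
      exact congrArg₂ (Loc.graft _ _) (X.loc_withLabel_of_ne u he).symm
        (X.loc_withLabel_self _ u).symm
    · refine Eq.trans ?_ (hsome u x x.2.2).symm
      refine (congrArg (Loc.push _) (loc_withLabel_of_ne (X.contract e he) _
        (Option.some_ne_none x))).trans ?_
      exact X.push_loc_contract_some he x
  refine ⟨some ⟨v, h₀, h₁⟩, LinearMap.id, fun u => key _ _ _ ?_⟩
  rintro (_ | x)
  · refine Eq.trans ?_ ((X.withLabel v u).push_loc_contract_none he).symm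
    refine (congrArg (Loc.push _) (loc_withLabel_of_ne (X.contract e he) _
      (Option.some_ne_none _).symm)).trans ?_
    refine (X.push_loc_contract_none he).trans ?_
    exact congrArg₂ (Loc.graft _ _) (X.loc_withLabel_of_ne u (Ne.symm h₀)).symm
      (X.loc_withLabel_of_ne u (Ne.symm h₁)).symm
  · by_cases hx : x.1 = v
    · obtain ⟨x, hx'⟩ := x
      obtain rfl : x = v := hx
      refine Eq.trans ?_ ((X.withLabel x u).push_loc_contract_some he ⟨x, hx'⟩).symm
      refine (congrArg (Loc.push _) (loc_withLabel_self (X.contract e he) _ _)).trans ?_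
      refine Eq.trans ?_ (X.loc_withLabel_self x u).symm
      exact (Loc.push_place _ _ _).trans rfl
    · refine Eq.trans ?_ (hsome u x hx).symm
      refine (congrArg (Loc.push _) (loc_withLabel_of_ne (X.contract e he) _ ?_)).trans ?_
      · exact fun h => hx (congrArg Subtype.val (Option.some.inj h))
      · exact X.push_loc_contract_some he x

theorem contracted_of_not_isLoop (X : OGraph O) {e : X.E} (he : ¬ X.IsLoop e) :
    X.contracted e = X.contractSign e • (X.contract e he).cls := dif_neg he

theorem contracted_withLabel_add (X : OGraph O) (e : X.E) (v : X.V) (a b : LabelSpace O (X.H v)) :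
    (X.withLabel v (a + b)).contracted e =
      (X.withLabel v a).contracted e + (X.withLabel v b).contracted e := by
  by_cases he : X.IsLoop e
  · have h (u) : (X.withLabel v u).contracted e = 0 := contracted_of_isLoop (X.withLabel v u) he
    rw [h, h, h, add_zero]
  · obtain ⟨w, φ, h⟩ := X.exists_contract_withLabel he v
    have h' (u) : (X.withLabel v u).contracted e =
        X.contractSign e • ((X.contract e he).withLabel w (φ u)).cls := by
      rw [← h]
      exact contracted_of_not_isLoop (X.withLabel v u) he
    rw [h', h', h', map_add, cls_withLabel_add, smul_add]

theorem contracted_withLabel_smul (X : OGraph O) (e : X.E) (v : X.V) (c : k)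
    (a : LabelSpace O (X.H v)) :
    (X.withLabel v (c • a)).contracted e = c • (X.withLabel v a).contracted e := by
  by_cases he : X.IsLoop e
  · have h (u) : (X.withLabel v u).contracted e = 0 := contracted_of_isLoop (X.withLabel v u) he
    rw [h, h, smul_zero]
  · obtain ⟨w, φ, h⟩ := X.exists_contract_withLabel he v
    have h' (u) : (X.withLabel v u).contracted e =
        X.contractSign e • ((X.contract e he).withLabel w (φ u)).cls := by
      rw [← h]
      exact contracted_of_not_isLoop (X.withLabel v u) he
    rw [h', h', map_smul, cls_withLabel_smul, smul_comm]

theorem respects_boundary : GraphSpace.Respects (OGraph.boundary (O := O)) where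
  iso f := by
    rw [boundary, boundary, Finset.smul_sum, ← f.E.sum_comp]
    exact Finset.sum_congr rfl fun e _ => f.contracted_eq e
  add X v a b := by
    exact (Finset.sum_congr rfl fun e _ => X.contracted_withLabel_add e v a b).trans
      Finset.sum_add_distrib
  smul X v c a := by
    rw [boundary, boundary, Finset.smul_sum]
    exact Finset.sum_congr rfl fun e _ => X.contracted_withLabel_smul e v c a

/-! ### Attaching polygons -/

theorem DirectedEdges.injective {X : OGraph O} {i : ℕ} (p : X.DirectedEdges i) :
    Function.Injective p.1 := fun _ _ h => p.2 (congrArg Prod.fst h)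

/-- The permutation of the darts which defines the attachment of a polygon. -/
abbrev DirectedEdges.perm {X : OGraph O} {i : ℕ} (p : X.DirectedEdges i) :
    Equiv.Perm (X.E × Bool) := List.formPerm (List.ofFn p.1)

theorem loc_attach (X : OGraph O) {i : ℕ} (p : X.DirectedEdges i) (v : X.V) :
    (X.attach p).loc v = (X.loc v).push p.perm.symm.toEmbedding :=
  (Loc.push_place (O := O) p.perm.symm.toEmbedding (X.dart v) (X.label v)).symm

/-- Cyclic permutations are natural for injections. This is applied to the dart map of an
isomorphism and to the inclusion of the darts of a contraction. -/
theorem formPerm_map_ofFn {A B : Type} {_ : DecidableEq A} {_ : DecidableEq B} (φ : A ↪ B) {i : ℕ}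
    (p : Fin i → A) (hp : Function.Injective p) (a : A) :
    List.formPerm (List.ofFn fun j => φ (p j)) (φ a) = φ (List.formPerm (List.ofFn p) a) := by
  have hn := List.nodup_ofFn.2 hp
  have hn' : (List.ofFn fun j => φ (p j)).Nodup := List.nodup_ofFn.2 (φ.injective.comp hp)
  by_cases ha : ∃ j, p j = a
  · obtain ⟨j, rfl⟩ := ha
    have h1 := List.formPerm_apply_getElem _ hn j (by simp)
    have h2 := List.formPerm_apply_getElem _ hn' j (by simp)
    simp only [List.getElem_ofFn, List.length_ofFn] at h1 h2
    exact h2.trans (congrArg φ h1.symm)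
  · rw [List.formPerm_apply_of_notMem, List.formPerm_apply_of_notMem]
    · simpa [List.mem_ofFn] using ha
    · simpa [List.mem_ofFn] using ha

theorem formPerm_of_forall_ne {A : Type} [DecidableEq A] {i : ℕ} (p : Fin i → A) (a : A)
    (ha : ∀ j, p j ≠ a) : List.formPerm (List.ofFn p) a = a := by
  rw [List.formPerm_apply_of_notMem]
  simpa [List.mem_ofFn] using ha

/-- The image of a sequence of directed edges under an isomorphism. -/
def Iso.directedEdges {X Y : OGraph O} (f : Iso X Y) (i : ℕ) :
    X.DirectedEdges i ≃ Y.DirectedEdges i :=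
  ((Equiv.refl (Fin i)).arrowCongr f.dart).subtypeEquiv fun p => by
    change _ ↔ Function.Injective fun j => f.E (p j).1
    exact (Function.Injective.of_comp_iff f.E.injective (fun j => (p j).1)).symm

/-- The isomorphism induced after attaching a polygon. -/
theorem Iso.exists_attach {X Y : OGraph O} (f : Iso X Y) {i : ℕ} (p : X.DirectedEdges i) :
    ∃ g : Iso (X.attach p) (Y.attach (f.directedEdges i p)), g.sign = f.sign ∧ g.E = f.E := by
  obtain ⟨g, hV, hE, hf⟩ := exists_iso (X := X.attach p) (Y := Y.attach (f.directedEdges i p))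
    f.dart.toEmbedding (Function.Embedding.refl _) f.V f.E f.flip (fun _ => rfl) (by
      intro v
      refine (Loc.push_refl _).trans ?_
      refine (loc_attach Y _ _).trans ?_
      refine Eq.trans ?_ (congrArg (Loc.push _) (loc_attach X p v).symm)
      refine (congrArg (Loc.push _) (f.loc_eq v)).trans ?_
      refine (Loc.push_push _ _ _).trans (Eq.trans ?_ (Loc.push_push _ _ _).symm)
      congr 1
      refine Function.Embedding.ext fun d => ?_
      change (f.directedEdges i p).perm.symm (f.dart d) = f.dart (p.perm.symm d)
      rw [Equiv.symm_apply_eq]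
      have : (f.directedEdges i p).perm (f.dart (p.perm.symm d)) = f.dart (p.perm (p.perm.symm d)) :=
        formPerm_map_ofFn f.dart.toEmbedding p.1 p.injective (p.perm.symm d)
      refine Eq.trans ?_ this.symm
      rw [Equiv.apply_symm_apply])
  refine ⟨g, ?_, hE⟩
  rw [g.sign_eq, f.sign_eq, hf, hV]
  rfl

theorem respects_attachSum (i : ℕ) :
    GraphSpace.Respects (fun X : OGraph O => X.attachSum i) where
  iso {X _} f := by
    rw [attachSum, attachSum, Finset.smul_sum, ← (f.directedEdges i).sum_comp]
    refine Finset.sum_congr rfl fun p _ => ?_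
    obtain ⟨g, hg, -⟩ := f.exists_attach p
    rw [cls_eq_of_iso g, hg]
  add X v a b := by
    exact (Finset.sum_congr rfl fun p _ => (X.attach p).cls_withLabel_add v a b).trans
      Finset.sum_add_distrib
  smul X v c a := by
    rw [attachSum, attachSum, Finset.smul_sum]
    exact Finset.sum_congr rfl fun p _ => (X.attach p).cls_withLabel_smul v c a

theorem respects_attachContract (i : ℕ) [NeZero i] :
    GraphSpace.Respects (fun X : OGraph O => X.attachContract i) where
  iso {X Y} f := by
    rw [attachContract, attachContract, Finset.smul_sum, ← (f.directedEdges i).sum_comp]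
    refine Finset.sum_congr rfl fun p _ => ?_
    obtain ⟨g, hg, hE⟩ := f.exists_attach p
    refine (g.contracted_eq _).trans ?_
    rw [hg, hE]
    rfl
  add X v a b := by
    exact (Finset.sum_congr rfl fun p _ => (X.attach p).contracted_withLabel_add _ v a b).trans
      Finset.sum_add_distrib
  smul X v c a := by
    rw [attachContract, attachContract, Finset.smul_sum]
    exact Finset.sum_congr rfl fun p _ => (X.attach p).contracted_withLabel_smul _ v c a

end OGraph

theorem graphBoundary_cls (X : OGraph O) : graphBoundary O X.cls = X.boundary :=
  OGraph.respects_boundary.ofValues X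

theorem polygonOp_cls (i : ℕ) [NeZero i] (X : OGraph O) :
    polygonOp O i X.cls = X.attachContract i :=
  (OGraph.respects_attachContract i).ofValues X

theorem attachOp_cls (i : ℕ) (X : OGraph O) : attachOp O i X.cls = X.attachSum i :=
  (OGraph.respects_attachSum i).ofValues X

end WellDefined

section SquareZero

open scoped Classical

variable {k : Type*} [Field k] {O : CyclicOperad k}

namespace OGraph

/-! ### Contraction of two edges -/

variable {X : OGraph O}

/-- The dart `c` as a dart of the graph in which the edge `e` is contracted. -/
abbrev liftDart {E : Type} {e : E} (c : E × Bool) (h : c.1 ≠ e) : {f : E // f ≠ e} × Bool :=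
  (⟨c.1, h⟩, c.2)

theorem vtx_absorb_liftDart {d c : X.E × Bool} (hd : X.vtx d ≠ X.vtx (opp d)) (hcd : c.1 ≠ d.1)
    (h : X.vtx c ≠ X.vtx d) : (X.absorb d hd).vtx (liftDart c hcd) = ⟨X.vtx c, h⟩ :=
  X.absorbV_of_ne d hd h

theorem absorb_absorb_ne {d c : X.E × Bool} (hd : X.vtx d ≠ X.vtx (opp d))
    (hc : X.vtx c ≠ X.vtx (opp c)) (hcd : c.1 ≠ d.1) (h : X.vtx c ≠ X.vtx d)
    (h₁ : X.vtx (opp d) ≠ X.vtx c) :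
    (X.absorb d hd).vtx (liftDart c hcd) ≠ (X.absorb d hd).vtx (opp (liftDart c hcd)) := by
  rw [vtx_absorb_liftDart hd hcd h]
  change _ ≠ X.absorbV d hd (X.vtx (opp c))
  by_cases h' : X.vtx (opp c) = X.vtx d
  · rw [h', absorbV_self]
    exact fun e => h₁ (congrArg Subtype.val e).symm
  · rw [absorbV_of_ne _ _ _ h']
    exact fun e => hc (congrArg Subtype.val e)

/-- The labels after two contractions, where the removed vertices `X.vtx d` and `X.vtx c` are not
ends of the other edge. -/
theorem absorbLoc_absorb {d c : X.E × Bool} (hd : X.vtx d ≠ X.vtx (opp d))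
    (hc : X.vtx c ≠ X.vtx (opp c)) (hcd : c.1 ≠ d.1) (h : X.vtx c ≠ X.vtx d)
    (h₁ : X.vtx (opp d) ≠ X.vtx c) (h₂ : X.vtx (opp c) ≠ X.vtx d) {v : X.V}
    (hv : v ≠ X.vtx d) :
    ((X.absorb d hd).absorbLoc (liftDart c hcd) ⟨v, hv⟩).push (dartEmb d.1) =
      if v = X.vtx (opp c) then (X.loc (X.vtx c)).graft c (opp c) (X.absorbLoc d v)
      else X.absorbLoc d v := by
  have e₁ : (X.absorb d hd).vtx (liftDart c hcd) = ⟨X.vtx c, h⟩ := X.absorbV_of_ne d hd h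
  have e₂ : (X.absorb d hd).vtx (opp (liftDart c hcd)) = ⟨X.vtx (opp c), h₂⟩ :=
    X.absorbV_of_ne d hd h₂
  have hne := absorb_absorb_ne hd hc hcd h h₁
  by_cases hvc : v = X.vtx (opp c)
  · subst hvc
    rw [if_pos rfl]
    unfold absorbLoc
    rw [if_pos e₂.symm, Loc.push_graft (dartEmb d.1) (mem_loc _ |>.2 rfl) (mem_loc _ |>.2 rfl)
      (loc_disjoint _ hne), e₁, e₂]
    have p₁ := push_loc_absorb hd ⟨X.vtx c, h⟩
    have p₂ := push_loc_absorb hd ⟨X.vtx (opp c), h₂⟩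
    rw [p₁, p₂]
    have : X.absorbLoc d (X.vtx c) = X.loc (X.vtx c) := if_neg h₁.symm
    rw [this]
    rfl
  · rw [if_neg hvc]
    conv_lhs => unfold absorbLoc
    rw [if_neg (fun e => hvc (congrArg Subtype.val (e.trans e₂)))]
    exact push_loc_absorb hd ⟨v, hv⟩

/-- The two contractions interact only at a common far end `v`. There they are grafts at two
different legs of `v`, which commute by parallel associativity. -/
theorem graft_absorbLoc_comm {d c : X.E × Bool} (hcd : c.1 ≠ d.1) (h : X.vtx c ≠ X.vtx d)
    (h₁ : X.vtx (opp d) ≠ X.vtx c) (h₂ : X.vtx (opp c) ≠ X.vtx d) (v : X.V) :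
    (if v = X.vtx (opp c) then (X.loc (X.vtx c)).graft c (opp c) (X.absorbLoc d v)
      else X.absorbLoc d v) =
    if v = X.vtx (opp d) then (X.loc (X.vtx d)).graft d (opp d) (X.absorbLoc c v)
      else X.absorbLoc c v := by
  unfold absorbLoc
  by_cases hvc : v = X.vtx (opp c)
  · by_cases hvd : v = X.vtx (opp d)
    · rw [if_pos hvc, if_pos hvd, if_pos hvc, if_pos hvd]
      rw [← hvc, ← hvd]
      have m₁ : opp c ∈ (X.loc v).1 := X.mem_loc.2 hvc.symm
      have m₂ : opp d ∈ (X.loc v).1 := X.mem_loc.2 hvd.symm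
      have n₁ : v ≠ X.vtx c := fun e => h₁ (hvd.symm.trans e)
      have n₂ : v ≠ X.vtx d := fun e => h₂ (hvc.symm.trans e)
      have card := fun w => (X.card_loc w)
      have card2 : ∀ w, 2 ≤ Nat.card (X.loc w).1 := fun w => by have := card w; omega
      have card1 : ∀ w, 1 ≤ Nat.card (X.loc w).1 := fun w => by have := card w; omega
      have hop : opp c ≠ opp d := fun e => hcd (show (opp c).1 = (opp d).1 by rw [e])
      -- Symmetry of grafting moves the label of `v` into the first argument, here for the inner
      -- graft and in `outer` for the second one, so that both sides take the form needed by
      -- `Loc.graft_graft`.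
      have swap : ∀ {a b : X.E × Bool}, b ∈ (X.loc v).1 → v ≠ X.vtx a →
          (X.loc (X.vtx a)).graft a b (X.loc v) = (X.loc v).graft b a (X.loc (X.vtx a)) :=
        fun hb n => Loc.graft_comm (X.mem_loc.2 rfl) hb (X.loc_disjoint n.symm) (card2 _) (card2 _)
      have outer : ∀ {a b c' d' : X.E × Bool}, a ∈ (X.loc v).1 → b ∈ (X.loc v).1 → a ≠ b →
          v ≠ X.vtx c' → v ≠ X.vtx d' → X.vtx c' ≠ X.vtx d' →
          (X.loc (X.vtx c')).graft c' b ((X.loc v).graft a d' (X.loc (X.vtx d'))) =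
          ((X.loc v).graft a d' (X.loc (X.vtx d'))).graft b c' (X.loc (X.vtx c')) := by
        intro a b c' d' ha hb hab n₁ n₂ n₃
        have hs := Loc.graft_fst ha (X.mem_loc.2 rfl : d' ∈ (X.loc (X.vtx d')).1) (X.loc_disjoint n₂)
        refine Loc.graft_comm (X.mem_loc.2 rfl) ?_ ?_ (card2 _) ?_
        · rw [hs]
          exact Or.inl ⟨hb, fun e => hab e.symm⟩
        · rw [hs, Set.disjoint_union_right]
          exact ⟨(X.loc_disjoint n₁.symm).mono_right Set.sdiff_subset,
            (X.loc_disjoint n₃).mono_right Set.sdiff_subset⟩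
        · have := Loc.card_graft ha (X.mem_loc.2 rfl : d' ∈ (X.loc (X.vtx d')).1)
            (X.loc_disjoint n₂) (card _) (card _)
          omega
      rw [swap m₂ n₂, swap m₁ n₁, outer m₂ m₁ hop.symm n₁ n₂ h, outer m₁ m₂ hop n₂ n₁ h.symm]
      exact Loc.graft_graft m₂ m₁ (X.mem_loc.2 rfl) (X.mem_loc.2 rfl) hop.symm
        (X.loc_disjoint n₂) (X.loc_disjoint n₁) (X.loc_disjoint h.symm) (card _) (card1 _) (card1 _)
    · rw [if_pos hvc, if_neg hvd, if_pos hvc, if_neg hvd, hvc]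
  · by_cases hvd : v = X.vtx (opp d)
    · rw [if_neg hvc, if_pos hvd, if_neg hvc, if_pos hvd, hvd]
    · rw [if_neg hvc, if_neg hvd, if_neg hvc, if_neg hvd]

/-- Removing two points in either order. -/
def punctureComm {A : Type} {a b : A} (h : b ≠ a) :
    {x : {x : A // x ≠ a} // x ≠ ⟨b, h⟩} ≃ {x : {x : A // x ≠ b} // x ≠ ⟨a, h.symm⟩} where
  toFun x := ⟨⟨x.1.1, fun e => x.2 (Subtype.ext e)⟩, fun e => x.1.2 (congrArg Subtype.val e)⟩
  invFun x := ⟨⟨x.1.1, fun e => x.2 (Subtype.ext e)⟩, fun e => x.1.2 (congrArg Subtype.val e)⟩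
  left_inv _ := rfl
  right_inv _ := rfl

/-- Both results have the vertices other than the two removed ones, in the inherited order, so their
identification carries no sign. -/
theorem cls_absorb_absorb {d c : X.E × Bool} (hd : X.vtx d ≠ X.vtx (opp d))
    (hc : X.vtx c ≠ X.vtx (opp c)) (hcd : c.1 ≠ d.1) (h : X.vtx c ≠ X.vtx d)
    (h₁ : X.vtx (opp d) ≠ X.vtx c) (h₂ : X.vtx (opp c) ≠ X.vtx d) :
    ((X.absorb d hd).absorb (liftDart c hcd) (absorb_absorb_ne hd hc hcd h h₁)).cls =
      ((X.absorb c hc).absorb (liftDart d hcd.symm)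
        (absorb_absorb_ne hc hd hcd.symm h.symm h₂)).cls := by
  have e₁ : (X.absorb d hd).vtx (liftDart c hcd) = ⟨X.vtx c, h⟩ := X.absorbV_of_ne d hd h
  have e₂ : (X.absorb c hc).vtx (liftDart d hcd.symm) = ⟨X.vtx d, h.symm⟩ :=
    X.absorbV_of_ne c hc h.symm
  let V₁ : {x : {x : X.V // x ≠ X.vtx d} // x ≠ (X.absorb d hd).vtx (liftDart c hcd)} ≃
      {x : {x : X.V // x ≠ X.vtx d} // x ≠ ⟨X.vtx c, h⟩} :=
    Equiv.subtypeEquivRight fun x => by rw [e₁]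
  let V₂ : {x : {x : X.V // x ≠ X.vtx c} // x ≠ (X.absorb c hc).vtx (liftDart d hcd.symm)} ≃
      {x : {x : X.V // x ≠ X.vtx c} // x ≠ ⟨X.vtx d, h.symm⟩} :=
    Equiv.subtypeEquivRight fun x => by rw [e₂]
  refine cls_eq_of_loc_eq
    (X := (X.absorb d hd).absorb (liftDart c hcd) (absorb_absorb_ne hd hc hcd h h₁))
    (Y := (X.absorb c hc).absorb (liftDart d hcd.symm)
        (absorb_absorb_ne hc hd hcd.symm h.symm h₂))
    ((dartEmb (⟨c.1, hcd⟩ : {e // e ≠ d.1})).trans (dartEmb d.1))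
    ((dartEmb (⟨d.1, hcd.symm⟩ : {e // e ≠ c.1})).trans (dartEmb c.1))
    (V₁.trans ((punctureComm h).trans V₂.symm)) (punctureComm hcd) (fun _ _ h => h)
    (fun _ => rfl) ?_
  intro v
  refine (Loc.push_push (O := O) _ _ _).symm.trans (Eq.trans ?_ (Loc.push_push (O := O) _ _ _))
  refine (congrArg (Loc.push _)
      (push_loc_absorb (absorb_absorb_ne hc hd hcd.symm h.symm h₂) _)).trans
    (Eq.trans ?_ (congrArg (Loc.push _)
      (push_loc_absorb (absorb_absorb_ne hd hc hcd h h₁) v)).symm)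
  refine (absorbLoc_absorb hc hd hcd.symm h.symm h₂ h₁ _).trans
    (Eq.trans ?_ (absorbLoc_absorb hd hc hcd h h₁ h₂ _).symm)
  exact (graft_absorbLoc_comm hcd h h₁ h₂ _).symm

/-- Removing `d`'s vertex first affects the count below `c`'s vertex only if it lies there. Of the
two orders of contraction exactly one picks up -1. -/
theorem dartSign_absorb {d c : X.E × Bool} (hd : X.vtx d ≠ X.vtx (opp d)) (hcd : c.1 ≠ d.1)
    (h : X.vtx c ≠ X.vtx d) :
    (X.absorb d hd).dartSign (liftDart c hcd) =
      X.dartSign c * if X.vtx d < X.vtx c then -1 else 1 := by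
  rw [dartSign, dartSign, vtx_absorb_liftDart hd hcd h, mul_assoc]
  exact congrArg _ (belowSign_subtype ⟨X.vtx c, h⟩)

/-- The contraction of `e`, followed by the contraction of `f`. -/
def contractedTwice (X : OGraph O) (e f : X.E) : GraphSpace O :=
  if h : ¬ X.IsLoop e ∧ f ≠ e then X.contractSign e • (X.contract e h.1).contracted ⟨f, h.2⟩ else 0

theorem contractedTwice_eq (d : X.E × Bool) (hd : X.vtx d ≠ X.vtx (opp d)) {f : X.E}
    (hf : f ≠ d.1) :
    X.contractedTwice d.1 f = X.dartSign d • (X.absorb d hd).contracted ⟨f, hf⟩ := by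
  have he : ¬ X.IsLoop d.1 := fun h => hd ((X.isLoop_iff d).1 h)
  obtain ⟨g, hg, hE⟩ := X.exists_contract_iso he d.2
  rw [contractedTwice, dif_pos ⟨he, hf⟩, ← hg, mul_smul]
  refine congrArg _ ((g.contracted_eq _).trans ?_)
  rw [hE]
  rfl

theorem contractedTwice_eq_zero {e f : X.E} (h : X.IsLoop f) : X.contractedTwice e f = 0 := by
  by_cases he : X.IsLoop e
  · exact dif_neg fun h => h.1 he
  by_cases hf : f = e
  · exact dif_neg fun h => h.2 hf
  rw [contractedTwice_eq (e, false) he hf, contracted_of_isLoop, smul_zero]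
  refine (isLoop_iff (X.absorb (e, false) he) (⟨f, hf⟩, false)).2 ?_
  exact congrArg (X.absorbV (e, false) he) h

/-- Contracting one of two parallel edges turns the other into a loop. -/
theorem contractedTwice_eq_zero_of_parallel {e f : X.E} {s t : Bool}
    (h₁ : X.vtx (f, s) = X.vtx (e, t)) (h₂ : X.vtx (f, !s) = X.vtx (e, !t)) :
    X.contractedTwice e f = 0 := by
  by_cases he : X.IsLoop e
  · exact dif_neg fun h => h.1 he
  by_cases hf : f = e
  · exact dif_neg fun h => h.2 hf
  have he' := absorb_ne_of_not_isLoop he t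
  rw [contractedTwice_eq (e, t) he' hf, contracted_of_isLoop, smul_zero]
  refine (isLoop_iff (X.absorb (e, t) he') (⟨f, hf⟩, s)).2 ?_
  change X.absorbV (e, t) he' (X.vtx (f, s)) = X.absorbV (e, t) he' (X.vtx (f, !s))
  rw [h₁, h₂, absorbV_self]
  exact (X.absorbV_of_ne _ _ he'.symm).symm

/-- Two edges, neither loops nor parallel, share at most one vertex. Taking the ends away from a
shared vertex gives vertices which are distinct and not incident to the other edge, so they can be
absorbed in either order. -/
theorem exists_nonincident_ends {A : Type} {g h : Bool → A} (hg : g false ≠ g true)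
    (hh : h false ≠ h true) (hgh : ¬ ∃ s t, h s = g t ∧ h (!s) = g (!t)) :
    ∃ s t, h s ≠ g t ∧ g (!t) ≠ h s ∧ h (!s) ≠ g t := by
  have hg' : ∀ t, g t ≠ g (!t) := by rintro (_ | _); exacts [hg, hg.symm]
  have hh' : ∀ t, h t ≠ h (!t) := by rintro (_ | _); exacts [hh, hh.symm]
  by_cases h0 : ∃ t, h false = g t
  · obtain ⟨t, ht⟩ := h0
    refine ⟨true, !t, fun e => hgh ⟨false, t, ht, e⟩, ?_, ?_⟩
    · rw [Bool.not_not, ← ht]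
      exact hh
    · change h false ≠ _
      rw [ht]
      exact hg' t
  · push Not at h0
    by_cases h1 : h true = g false
    · exact ⟨false, true, h0 _, (h0 _).symm, fun e => hg (h1.symm.trans e)⟩
    · exact ⟨false, false, h0 _, (h0 _).symm, h1⟩

/-- Loops, equal edges and parallel edges give zero on both sides. Otherwise suitable ends can be
absorbed in either order with the same result, and `dartSign_absorb` supplies the -1. -/
theorem contractedTwice_antisymm (X : OGraph O) (e f : X.E) :
    X.contractedTwice e f = - X.contractedTwice f e := by
  by_cases he : X.IsLoop e
  · rw [contractedTwice_eq_zero (e := f) he, neg_zero]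
    exact dif_neg fun h => h.1 he
  by_cases hf : X.IsLoop f
  · rw [contractedTwice_eq_zero (e := e) hf, zero_eq_neg]
    exact dif_neg fun h => h.1 hf
  by_cases hfe : f = e
  · rw [contractedTwice, contractedTwice, dif_neg (fun h => h.2 hfe),
      dif_neg (fun h => h.2 hfe.symm), neg_zero]
  by_cases hpar : ∃ s t, X.vtx (f, s) = X.vtx (e, t) ∧ X.vtx (f, !s) = X.vtx (e, !t)
  · obtain ⟨s, t, h₁, h₂⟩ := hpar
    rw [contractedTwice_eq_zero_of_parallel h₁ h₂,
      contractedTwice_eq_zero_of_parallel h₁.symm h₂.symm, neg_zero]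
  have he' : X.vtx (e, false) ≠ X.vtx (e, true) := he
  have hf' : X.vtx (f, false) ≠ X.vtx (f, true) := hf
  obtain ⟨s, t, h, h₁, h₂⟩ :=
    exists_nonincident_ends (g := fun t => X.vtx (e, t)) (h := fun s => X.vtx (f, s)) he' hf' hpar
  have hd := absorb_ne_of_not_isLoop he t
  have hc := absorb_ne_of_not_isLoop hf s
  have n₁ := absorb_absorb_ne hd hc hfe h h₁
  have n₂ := absorb_absorb_ne hc hd (Ne.symm hfe) h.symm h₂
  have c₁ := contracted_eq _ _ n₁
  have c₂ := contracted_eq _ _ n₂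
  rw [contractedTwice_eq (e, t) hd hfe, contractedTwice_eq (f, s) hc (Ne.symm hfe)]
  refine (congrArg _ c₁).trans (Eq.trans ?_ (congrArg (fun z => - (X.dartSign (f, s) • z)) c₂).symm)
  rw [dartSign_absorb hd hfe h, dartSign_absorb hc (Ne.symm hfe) h.symm,
    cls_absorb_absorb hd hc hfe h h₁ h₂, smul_smul, smul_smul, ← mul_assoc, ← mul_assoc,
    mul_comm (X.dartSign (f, s))]
  rcases lt_or_gt_of_ne h with hlt | hlt
  · rw [if_neg hlt.not_gt, if_pos hlt, mul_one, mul_neg_one, Units.neg_smul, neg_neg]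
  · rw [if_neg hlt.not_gt, if_pos hlt, mul_one, mul_neg_one, Units.neg_smul]

end OGraph

theorem graphBoundary_contracted (X : OGraph O) (e : X.E) :
    graphBoundary O (X.contracted e) = ∑ f, X.contractedTwice e f := by
  by_cases he : X.IsLoop e
  · rw [OGraph.contracted_of_isLoop X he, map_zero]
    exact (Finset.sum_eq_zero fun f _ => dif_neg fun h => h.1 he).symm
  · rw [OGraph.contracted_of_not_isLoop X he, Units.smul_def, map_zsmul, graphBoundary_cls,
      OGraph.boundary, Fintype.sum_eq_add_sum_subtype_ne _ e, Finset.smul_sum]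
    have : X.contractedTwice e e = 0 := dif_neg fun h => h.2 rfl
    rw [this, zero_add]
    refine Finset.sum_congr rfl fun f _ => ?_
    rw [OGraph.contractedTwice, dif_pos ⟨he, f.2⟩]
    rfl

theorem graphBoundary_graphBoundary [CharZero k] : graphBoundary O ∘ₗ graphBoundary O = 0 := by
  refine GraphSpace.hom_ext fun X => ?_
  rw [LinearMap.comp_apply, graphBoundary_cls, OGraph.boundary, map_sum]
  simp only [graphBoundary_contracted]
  have h : ∑ e, ∑ f, X.contractedTwice e f = - ∑ e, ∑ f, X.contractedTwice e f := by
    conv_lhs => rw [Finset.sum_comm]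
    rw [← Finset.sum_neg_distrib]
    refine Finset.sum_congr rfl fun e _ => ?_
    rw [← Finset.sum_neg_distrib]
    exact Finset.sum_congr rfl fun f _ => X.contractedTwice_antisymm f e
  have h2 : (2 : k) • ∑ e, ∑ f, X.contractedTwice e f = 0 := by
    rw [two_smul]
    nth_rewrite 1 [h]
    exact neg_add_cancel _
  exact (smul_eq_zero.1 h2).resolve_left two_ne_zero

end SquareZero

section PolygonHomotopy

open scoped Classical

variable {k : Type*} [Field k] {O : CyclicOperad k}

namespace OGraph

/-! ### Contraction of edges after attaching a polygon -/

theorem formPerm_ofFn_apply {A : Type} [DecidableEq A] {i : ℕ} [NeZero i] {p : Fin i → A}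
    (hp : Function.Injective p) (j : Fin i) : List.formPerm (List.ofFn p) (p j) = p (j + 1) := by
  have h := List.formPerm_apply_getElem _ (List.nodup_ofFn.2 hp) j (by simp)
  simp only [List.getElem_ofFn, List.length_ofFn] at h
  refine h.trans (congrArg p (Fin.ext ?_))
  rw [Fin.val_add, Fin.val_one']
  simp

theorem formPerm_ofFn_rotate {A : Type} [DecidableEq A] {i : ℕ} [NeZero i] {p : Fin i → A}
    (hp : Function.Injective p) (j : Fin i) :
    List.formPerm (List.ofFn fun a => p (a + j)) = List.formPerm (List.ofFn p) := by
  have hq : Function.Injective fun a => p (a + j) := hp.comp (add_left_injective j)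
  ext x
  by_cases hx : ∃ a, p a = x
  · obtain ⟨a, rfl⟩ := hx
    have h := formPerm_ofFn_apply hq (a - j)
    simp only [sub_add_cancel] at h
    rw [h, formPerm_ofFn_apply hp]
    congr 1
    abel
  · push Not at hx
    rw [formPerm_of_forall_ne _ _ hx, formPerm_of_forall_ne _ _ fun a => hx _]

variable {X : OGraph O} {i : ℕ}

theorem DirectedEdges.perm_of_forall_ne (p : X.DirectedEdges i) {d : X.E × Bool}
    (h : ∀ j, (p.1 j).1 ≠ d.1) : p.perm d = d :=
  formPerm_of_forall_ne _ _ fun j e => h j (by rw [e])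

/-- The cyclic rotations of a sequence of directed edges. -/
def DirectedEdges.rotate (X : OGraph O) [NeZero i] (j : Fin i) :
    X.DirectedEdges i ≃ X.DirectedEdges i :=
  ((Equiv.addRight j).symm.arrowCongr (Equiv.refl _)).subtypeEquiv fun p => by
    change _ ↔ Function.Injective ((fun a => (p a).1) ∘ Equiv.addRight j)
    exact (Function.Injective.of_comp_iff' (fun a => (p a).1) (Equiv.addRight j).bijective).symm

/-- The attachment depends only on the cyclic order of the directed edges, because it is defined by
their cyclic permutation. -/
theorem attach_rotate [NeZero i] (j : Fin i) (p : X.DirectedEdges i) :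
    X.attach (DirectedEdges.rotate X j p) = X.attach p := by
  have h : (DirectedEdges.rotate X j p).perm = p.perm := formPerm_ofFn_rotate p.injective j
  change ({ X with ends := (DirectedEdges.rotate X j p).perm.trans X.ends } : OGraph O) = _
  rw [h]
  rfl

/-- For fixed position j, rotation by j is a bijection of the tuples which brings the j-th polygon
edge to position 0 and keeps the attached graph. So all i positions give the same sum. -/
theorem sum_contracted_polygon (X : OGraph O) [NeZero i] :
    ∑ p : X.DirectedEdges i, ∑ j, (X.attach p).contracted (p.1 j).1 =
      i • X.attachContract i := by
  rw [Finset.sum_comm]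
  have : ∀ j : Fin i, ∑ p : X.DirectedEdges i, (X.attach p).contracted (p.1 j).1 =
      X.attachContract i := by
    intro j
    refine (Finset.sum_congr rfl fun p _ => ?_).trans ((DirectedEdges.rotate X j).sum_comp _)
    have h0 : (p.1 j).1 = ((DirectedEdges.rotate X j p).1 0).1 :=
      congrArg (fun a => (p.1 a).1) (zero_add j).symm
    -- The two attached graphs are equal only propositionally, hence the heterogeneous comparison of
    -- their edges.
    have h : ∀ (Y Z : OGraph O) (_ : Y = Z) (e : Y.E) (e' : Z.E), HEq e e' →
        Y.contracted e = Z.contracted e' := by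
      rintro Y _ rfl e _ h
      rw [eq_of_heq h]
    exact h _ _ (attach_rotate j p).symm _ _ (heq_of_eq h0)
  rw [Finset.sum_congr rfl fun j _ => this j]
  simp

/-- A sequence of directed edges of the contraction as a sequence of directed edges of the graph. -/
def liftEdges {d : X.E × Bool} (hd : X.vtx d ≠ X.vtx (opp d)) (i : ℕ) :
    (X.absorb d hd).DirectedEdges i ≃ {p : X.DirectedEdges i // ∀ j, (p.1 j).1 ≠ d.1} where
  toFun q := ⟨⟨fun j => dartEmb d.1 (q.1 j), fun _ _ h => q.2 (Subtype.ext h)⟩,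
    fun j => (q.1 j).1.2⟩
  invFun p := ⟨fun j => liftDart (p.1.1 j) (p.2 j), fun _ _ h => p.1.2 (congrArg Subtype.val h)⟩
  left_inv _ := rfl
  right_inv _ := rfl

theorem absorbLoc_attach {d : X.E × Bool} (hd : X.vtx d ≠ X.vtx (opp d)) (p : X.DirectedEdges i)
    (hp : ∀ j, (p.1 j).1 ≠ d.1) (v : X.V) :
    (X.attach p).absorbLoc d v = (X.absorbLoc d v).push p.perm.symm.toEmbedding := by
  have e₁ : p.perm d = d := p.perm_of_forall_ne hp
  have e₂ : p.perm (opp d) = opp d := p.perm_of_forall_ne (d := opp d) hp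
  have v₁ : (X.attach p).vtx d = X.vtx d := congrArg X.vtx e₁
  have v₂ : (X.attach p).vtx (opp d) = X.vtx (opp d) := congrArg X.vtx e₂
  unfold absorbLoc
  by_cases h : v = X.vtx (opp d)
  · refine (if_pos (h.trans v₂.symm)).trans ?_
    rw [if_pos h, v₁, v₂, loc_attach, loc_attach,
      Loc.push_graft _ (X.mem_loc.2 rfl) (X.mem_loc.2 rfl) (X.loc_disjoint hd)]
    have f₁ : p.perm.symm.toEmbedding d = d := (Equiv.symm_apply_eq _).2 e₁.symm
    have f₂ : p.perm.symm.toEmbedding (opp d) = opp d := (Equiv.symm_apply_eq _).2 e₂.symm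
    rw [f₁, f₂]
    rfl
  · refine (if_neg (fun e => h (e.trans v₂))).trans ?_
    rw [if_neg h, loc_attach]

/-- A polygon away from the edge of `d` fixes both its halves, so the same grafting takes place
before and after the attachment. The vertices and their order agree, so there is no sign. -/
theorem cls_absorb_attach {d : X.E × Bool} (hd : X.vtx d ≠ X.vtx (opp d))
    (q : (X.absorb d hd).DirectedEdges i)
    (h' : (X.attach (liftEdges hd i q).1).vtx d ≠ (X.attach (liftEdges hd i q).1).vtx (opp d)) :
    ((X.attach (liftEdges hd i q).1).absorb d h').cls = ((X.absorb d hd).attach q).cls := by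
  let p := (liftEdges hd i q).1
  have hp : ∀ j, (p.1 j).1 ≠ d.1 := (liftEdges hd i q).2
  have e₁ : p.perm d = d := p.perm_of_forall_ne hp
  refine cls_eq_of_loc_eq (X := (X.attach p).absorb d h') (Y := (X.absorb d hd).attach q)
    (dartEmb d.1) (dartEmb d.1)
    (Equiv.subtypeEquivRight fun v => by
      change v ≠ X.vtx (p.perm d) ↔ v ≠ X.vtx d
      rw [e₁])
    (Equiv.refl _) (fun _ _ h => h) (fun _ => rfl) fun v => ?_
  refine Eq.trans ?_ (push_loc_absorb h' v).symm
  refine Eq.trans ?_ (absorbLoc_attach hd p hp v.1).symm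
  refine (congrArg (Loc.push _) (loc_attach (X.absorb d hd) q _)).trans ?_
  refine (Loc.push_push (O := O) _ _ _).trans ?_
  refine Eq.trans ?_ (congrArg (Loc.push _) (push_loc_absorb hd ⟨v.1, ?_⟩))
  swap
  · exact fun h => v.2 (h.trans (congrArg X.vtx e₁).symm)
  refine Eq.trans ?_ (Loc.push_push (O := O) _ _ _).symm
  refine congrArg (fun f => Loc.push f _) (Function.Embedding.ext fun x => ?_)
  change dartEmb d.1 (q.perm.symm x) = p.perm.symm (dartEmb d.1 x)
  symm
  rw [Equiv.symm_apply_eq]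
  have : p.perm (dartEmb d.1 (q.perm.symm x)) = dartEmb d.1 (q.perm (q.perm.symm x)) :=
    formPerm_map_ofFn (dartEmb d.1) q.1 q.injective (q.perm.symm x)
  refine Eq.trans ?_ this.symm
  rw [Equiv.apply_symm_apply]

/-- Tuples avoiding `e` are the tuples of the contraction by `e`. If `e` is a loop, it remains one
after every such attachment, and both sides vanish. -/
theorem sum_contracted_attach (X : OGraph O) (i : ℕ) (e : X.E) :
    ∑ p : {p : X.DirectedEdges i // ∀ j, (p.1 j).1 ≠ e}, (X.attach p.1).contracted e =
      attachOp O i (X.contracted e) := by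
  have hv : ∀ (p : {p : X.DirectedEdges i // ∀ j, (p.1 j).1 ≠ e}) s,
      (X.attach p.1).vtx (e, s) = X.vtx (e, s) :=
    fun p s => congrArg X.vtx (p.1.perm_of_forall_ne (d := (e, s)) p.2)
  by_cases he : X.IsLoop e
  · rw [contracted_of_isLoop X he, map_zero]
    refine Finset.sum_eq_zero fun p _ => contracted_of_isLoop _ ?_
    exact (hv p false).trans (Eq.trans he (hv p true).symm)
  · have hd := absorb_ne_of_not_isLoop he false
    have h' : ∀ p : {p : X.DirectedEdges i // ∀ j, (p.1 j).1 ≠ e},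
        (X.attach p.1).vtx (e, false) ≠ (X.attach p.1).vtx (opp (e, false)) := fun p => by
      rw [hv p false, show (X.attach p.1).vtx (opp (e, false)) = X.vtx (e, true) from hv p true]
      exact hd
    rw [contracted_eq X (e, false) hd, Units.smul_def, map_zsmul, attachOp_cls, attachSum,
      Finset.smul_sum, ← (liftEdges hd i).sum_comp]
    refine Finset.sum_congr (Finset.ext fun _ => by simp) fun q _ => ?_
    refine (contracted_eq (X.attach (liftEdges hd i q).1) (e, false) (h' (liftEdges hd i q))).trans ?_
    refine (congrArg (fun z => (X.attach (liftEdges hd i q).1).dartSign (e, false) • z)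
      (cls_absorb_attach hd q (h' (liftEdges hd i q)))).trans ?_
    have : (X.attach (liftEdges hd i q).1).dartSign (e, false) = X.dartSign (e, false) :=
      congrArg (fun v : X.V => (if (false : Bool) then (-1 : ℤˣ) else 1) * belowSign v)
        (hv (liftEdges hd i q) false)
    exact congrArg (fun s : ℤˣ => s • ((X.absorb (e, false) hd).attach q).cls) this

theorem sum_eq_sum_add_sum_ite {A M : Type*} [Fintype A] [AddCommMonoid M] {g : Fin i → A}
    (hg : Function.Injective g) (c : A → M) :
    ∑ a, c a = ∑ j, c (g j) + ∑ a, if ∀ j, g j ≠ a then c a else 0 := by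
  rw [← Finset.sum_filter_add_sum_filter_not Finset.univ (fun a => ∀ j, g j ≠ a) c, add_comm,
    ← Finset.sum_filter, ← Finset.sum_image (f := c) (g := g) (fun a _ b _ h => hg h)]
  congr 2
  ext e
  simp

theorem boundary_attach (X : OGraph O) (p : X.DirectedEdges i) :
    (X.attach p).boundary = ∑ j, (X.attach p).contracted (p.1 j).1 +
      ∑ e : X.E, if ∀ j, (p.1 j).1 ≠ e then (X.attach p).contracted e else 0 :=
  sum_eq_sum_add_sum_ite p.2 fun e : X.E => (X.attach p).contracted e

end OGraph

/-- The source of the homotopy: edges of the polygon give the first summand by rotation, and all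
other edges give the second because their contraction commutes with the attachment. -/
theorem graphBoundary_attachOp (i : ℕ) [NeZero i] (z : GraphSpace O) :
    graphBoundary O (attachOp O i z) =
      i • polygonOp O i z + attachOp O i (graphBoundary O z) := by
  have : graphBoundary O ∘ₗ attachOp O i = i • polygonOp O i + attachOp O i ∘ₗ graphBoundary O := by
    refine GraphSpace.hom_ext fun X => ?_
    rw [LinearMap.comp_apply, attachOp_cls, OGraph.attachSum, map_sum, LinearMap.add_apply,
      LinearMap.smul_apply, polygonOp_cls, LinearMap.comp_apply, graphBoundary_cls,
      OGraph.boundary, map_sum, ← X.sum_contracted_polygon]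
    simp only [graphBoundary_cls, OGraph.boundary_attach, Finset.sum_add_distrib]
    congr 1
    rw [Finset.sum_comm]
    refine Finset.sum_congr rfl fun e _ => ?_
    rw [← X.sum_contracted_attach i e, ← Finset.sum_filter]
    exact (Finset.sum_subtype _ (by simp) _)
  exact LinearMap.congr_fun this z

/-- The cyclic permutation of a single half-edge is trivial, so attaching a 2-gon does nothing; the
factor 2 counts the directions of the edge. -/
theorem polygonOp_one : polygonOp O 1 = 2 • graphBoundary O := by
  refine GraphSpace.hom_ext fun X => ?_
  rw [polygonOp_cls, LinearMap.smul_apply, graphBoundary_cls, OGraph.boundary,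
    OGraph.attachContract]
  let φ : X.E × Bool ≃ X.DirectedEdges 1 :=
    { toFun := fun d => ⟨fun _ => d, Function.injective_of_subsingleton _⟩
      invFun := fun p => p.1 0
      left_inv := fun _ => rfl
      right_inv := fun p => Subtype.ext (funext fun j => by rw [Subsingleton.elim j 0]) }
  rw [← φ.sum_comp, Fintype.sum_prod_type, Finset.smul_sum]
  refine Finset.sum_congr rfl fun e _ => ?_
  have h : ∀ s, (X.attach (φ (e, s))).contracted e = X.contracted e := by
    intro s
    have : (φ (e, s)).perm = 1 := by
      simp [OGraph.DirectedEdges.perm, φ]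
    change OGraph.contracted ({ X with ends := (φ (e, s)).perm.trans X.ends } : OGraph O) e = _
    rw [this]
    rfl
  rw [Fintype.sum_bool, two_smul]
  exact congrArg₂ (· + ·) (h true) (h false)

end PolygonHomotopy

/-! ### Graphs split into unions of components -/

namespace OGraph

open scoped Classical

variable {k : Type*} [Field k] {O : CyclicOperad k}

/-- A function on the vertices which takes the same values at both ends of each edge. -/
structure Splitting (X : OGraph O) (ι : Type) where
  idx : X.V → ι
  idx_opp : ∀ d, idx (X.vtx (opp d)) = idx (X.vtx d)

theorem Connected.eq_of_joined {X : OGraph O} (h : X.Connected) {A : Type} (g : X.V → A)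
    (hg : ∀ d, g (X.vtx (opp d)) = g (X.vtx d)) (u v : X.V) : g u = g v := by
  induction h.2 u v with
  | rel u v h =>
    obtain ⟨e, rfl, rfl⟩ := h
    exact hg (e, true)
  | refl => rfl
  | symm _ _ _ ih => exact ih.symm
  | trans _ _ _ _ _ ih₁ ih₂ => exact ih₁.trans ih₂

namespace Splitting

variable {X Y : OGraph O} {ι ι' : Type} (P : Splitting X ι) (Q : Splitting Y ι')

/-- The value at both ends of an edge. -/
def edge (e : X.E) : ι := P.idx (X.vtx (e, false))

theorem idx_vtx (d : X.E × Bool) : P.idx (X.vtx d) = P.edge d.1 := by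
  obtain ⟨e, _ | _⟩ := d
  · rfl
  · exact P.idx_opp (e, false)

/-- The subgraph of the vertices and edges with value `i`. -/
def fiber (i : ι) : OGraph O where
  V := {v // P.idx v = i}
  E := {e // P.edge e = i}
  H v := X.H v.1
  ends := (Equiv.prodSubtypeFstEquivSubtypeProd (p := fun e => P.edge e = i)).symm.trans
    ((X.ends.subtypeEquiv fun d => by rw [← P.idx_vtx]; rfl).trans
      (Equiv.subtypeSigmaEquiv X.H fun v => P.idx v = i))
  valence v := X.valence v.1
  label v := X.label v.1

/-- The vertices of a subgraph as vertices of the whole graph. -/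
def fiberVert (i : ι) : (P.fiber i).V ↪ X.V := ⟨Subtype.val, Subtype.val_injective⟩

/-- The darts of a subgraph as darts of the whole graph. -/
def fiberDart (i : ι) : (P.fiber i).E × Bool ↪ X.E × Bool :=
  (Function.Embedding.subtype _).prodMap (Function.Embedding.refl _)

theorem loc_fiber (i : ι) (v : (P.fiber i).V) :
    ((P.fiber i).loc v).push (P.fiberDart i) = X.loc v.1 := by
  refine (Loc.push_place _ _ _).trans ?_
  refine congrArg (fun f => Loc.place f (X.label v.1)) (Function.Embedding.ext fun h => ?_)
  change P.fiberDart i ((P.fiber i).ends.symm ⟨v, h⟩) = X.ends.symm ⟨v.1, h⟩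
  rfl

/-- The vertices with value `i`. -/
def verts (i : ι) : Finset X.V := Finset.univ.filter fun v => P.idx v = i

theorem mem_verts {i : ι} {v : X.V} : v ∈ P.verts i ↔ P.idx v = i := by simp [verts]

theorem map_fiberVert (i : ι) : Finset.univ.map (P.fiberVert i) = P.verts i := by
  ext v
  rw [mem_verts, Finset.mem_map]
  exact ⟨by rintro ⟨w, _, rfl⟩; exact w.2, fun h => ⟨⟨v, h⟩, Finset.mem_univ _, rfl⟩⟩

theorem card_fiber (i : ι) : Fintype.card (P.fiber i).V = (P.verts i).card :=
  Fintype.card_subtype _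

/-- The sign of moving the vertices with value `i` before those with value `j`. -/
def cross (i j : ι) : ℤˣ := ∏ u ∈ P.verts i, ∏ v ∈ P.verts j, if v < u then -1 else 1

/-- Each pair with one vertex in either part contributes -1 to exactly one of the two signs. The
product is the Koszul sign. -/
theorem cross_mul_cross {i j : ι} (h : i ≠ j) :
    P.cross i j * P.cross j i = (-1) ^ ((P.verts i).card * (P.verts j).card) := by
  rw [cross, cross, Finset.prod_comm (s := P.verts j), ← Finset.prod_mul_distrib, pow_mul',
    ← Finset.prod_const]
  refine Finset.prod_congr rfl fun u hu => ?_
  rw [← Finset.prod_mul_distrib, ← Finset.prod_const]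
  refine Finset.prod_congr rfl fun v hv => ?_
  have : u ≠ v := by
    rintro rfl
    exact h ((P.mem_verts.1 hu).symm.trans (P.mem_verts.1 hv))
  rcases lt_or_gt_of_ne this with h | h <;> simp [h, h.not_gt]

theorem exists_iso_fiber (f : Iso X Y) (b : ι ≃ ι') (h : ∀ v, Q.idx (f.V v) = b (P.idx v))
    (i : ι) : ∃ g : Iso (P.fiber i) (Q.fiber (b i)), g.sign = pairProd (P.verts i) (revSign f.V) *
      ∏ e ∈ Finset.univ.filter (fun e => P.edge e = i), if f.flip e then -1 else 1 := by
  have hE : ∀ e, Q.edge (f.E e) = b (P.edge e) := by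
    intro e
    rw [← P.idx_vtx (e, false), ← h, ← f.vtx_dart, Q.idx_vtx]
    rfl
  obtain ⟨g, h₁, h₂, h₃⟩ := exists_iso (X := P.fiber i) (Y := Q.fiber (b i))
    ((P.fiberDart i).trans f.dart.toEmbedding) (Q.fiberDart (b i))
    (f.V.subtypeEquiv fun v => by rw [h, b.apply_eq_iff_eq])
    (f.E.subtypeEquiv fun e => by rw [hE, b.apply_eq_iff_eq])
    (fun e => f.flip e.1) (fun _ => rfl) (fun v => by
      refine (Q.loc_fiber (b i) _).trans ((f.loc_eq v.1).trans ?_)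
      refine (congrArg (Loc.push _) (P.loc_fiber i v)).symm.trans ?_
      exact Loc.push_push (O := O) _ _ _)
  refine ⟨g, ?_⟩
  rw [g.sign_eq, h₁, h₃]
  congr 1
  · rw [← P.map_fiberVert, pairProd_map (revSign_comm f.V.injective)]
    rfl
  · exact (Finset.prod_subtype _ (by simp) (fun e => if f.flip e then (-1 : ℤˣ) else 1)).symm

/-- A pair across two parts is out of order on one side and not on the other exactly if the
isomorphism reverses it. -/
theorem cross_map (f : Iso X Y) (b : ι ≃ ι') (h : ∀ v, Q.idx (f.V v) = b (P.idx v))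
    {i j : ι} (hij : i ≠ j) :
    P.cross i j = (∏ u ∈ P.verts i, ∏ v ∈ P.verts j, revSign f.V u v) * Q.cross (b i) (b j) := by
  have hv : ∀ i, Q.verts (b i) = (P.verts i).map f.V.toEmbedding := by
    intro i
    ext v
    obtain ⟨v, rfl⟩ := f.V.surjective v
    simp [verts, h]
  rw [cross, cross, hv, hv, Finset.prod_map, ← Finset.prod_mul_distrib]
  refine Finset.prod_congr rfl fun u hu => ?_
  rw [Finset.prod_map, ← Finset.prod_mul_distrib]
  refine Finset.prod_congr rfl fun v hv => ?_
  have huv : v ≠ u := by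
    rintro rfl
    exact hij ((P.mem_verts.1 hu).symm.trans (P.mem_verts.1 hv))
  rw [revSign_comm f.V.injective]
  change _ = _ * if f.V v < f.V u then (-1 : ℤˣ) else 1
  by_cases h1 : v < u <;> by_cases h2 : f.V v < f.V u <;> simp [revSign, h1, h2]

end Splitting

end OGraph

/-! ### Products of components -/

section Products

open scoped Classical

variable {k : Type*} [Field k] {O : CyclicOperad k}

variable (O) in
theorem exists_extend_ι : ∃ u : GraphSpace O →ₗ[k] SymGraph O,
    u ∘ₗ (Primitive O).subtype = SymGraph.ι O := LinearMap.exists_extend _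

variable (O) in
/-- A linear extension of the inclusion of `P𝒢^O` into its symmetric algebra to all graphs. -/
def extendι : GraphSpace O →ₗ[k] SymGraph O := (exists_extend_ι O).choose

theorem map_units_smul {M N : Type*} [AddCommGroup M] [Module k M] [AddCommGroup N] [Module k N]
    (f : M →ₗ[k] N) (s : ℤˣ) (x : M) : f (s • x) = s • f x := by
  rw [Units.smul_def, Units.smul_def, map_zsmul]

theorem extendι_apply (x : Primitive O) : extendι O x = SymGraph.ι O x :=
  LinearMap.congr_fun (exists_extend_ι O).choose_spec x

theorem extendι_cls {X : OGraph O} (hX : X.Connected) :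
    extendι O X.cls = SymGraph.ι O (X.prim hX) := extendι_apply (X.prim hX)

theorem SymGraph.ι_mul_ι {X Y : OGraph O} (hX : X.Connected) (hY : Y.Connected) :
    SymGraph.ι O (X.prim hX) * SymGraph.ι O (Y.prim hY) =
      ((-1 : ℤˣ) ^ (Fintype.card X.V * Fintype.card Y.V)) •
        (SymGraph.ι O (Y.prim hY) * SymGraph.ι O (X.prim hX)) := by
  have h := RingQuot.mkAlgHom_rel k (SymRel.comm X Y hX hY)
  rw [map_mul, map_smul, map_mul] at h
  refine h.trans ?_
  rw [Units.smul_def, ← Int.cast_smul_eq_zsmul k]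
  push_cast
  rfl

namespace OGraph.Splitting

variable {X Y : OGraph O} {ι ι' : Type} (P : Splitting X ι) (Q : Splitting Y ι')

/-- The product of the subgraphs with values in a list, with the sign of the corresponding
reordering of the vertices. -/
def prod : List ι → SymGraph O
  | [] => 1
  -- Using `extendι` makes the product meaningful without a proof that the subgraphs are connected.
  | i :: l => (l.map (P.cross i)).prod • (extendι O (P.fiber i).cls * prod l)

theorem prod_cons (i : ι) (l : List ι) :
    P.prod (i :: l) = (l.map (P.cross i)).prod • (extendι O (P.fiber i).cls * P.prod l) := rfl

/-- Exchanging adjacent factors changes the crossing signs by `cross_mul_cross`, which is the sign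
of graded commutativity. -/
theorem prod_perm (hP : ∀ i, (P.fiber i).Connected) {l l' : List ι} (h : l.Perm l')
    (hl : l.Nodup) : P.prod l = P.prod l' := by
  induction h with
  | nil => rfl
  | cons i h ih =>
    rw [prod_cons, prod_cons, ih (List.nodup_cons.1 hl).2, (h.map _).prod_eq]
  | swap i j l =>
    have hij : j ≠ i := by
      rintro rfl
      simp at hl
    rw [prod_cons, prod_cons, prod_cons, prod_cons]
    simp only [List.map_cons, List.prod_cons]
    rw [mul_smul_comm, mul_smul_comm, smul_smul, smul_smul, ← mul_assoc, ← mul_assoc,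
      extendι_cls (hP i), extendι_cls (hP j), SymGraph.ι_mul_ι (hP j) (hP i), smul_mul_assoc,
      smul_smul]
    congr 1
    rw [card_fiber, card_fiber, ← P.cross_mul_cross hij]
    have : ∀ x : ℤˣ, x * x = 1 := Int.units_mul_self
    generalize P.cross j i = a
    generalize P.cross i j = b
    have ha := this a
    calc _ = (a * a) * (b * (l.map (P.cross j)).prod * (l.map (P.cross i)).prod) := by
          simp only [mul_assoc, mul_left_comm, mul_comm]
      _ = _ := by
          rw [ha]; simp only [mul_assoc, mul_left_comm, mul_comm, one_mul]
  | trans h₁ _ ih₁ ih₂ => exact (ih₁ hl).trans (ih₂ (h₁.nodup_iff.1 hl))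

/-- The sign of an isomorphism is distributed over pairs of vertices. Pairs inside a part give,
together with the reversed edges there, the sign of the isomorphism of subgraphs; pairs across parts
account for the change of the crossing signs. -/
theorem prod_map_iso (f : Iso X Y) (b : ι ≃ ι') (h : ∀ v, Q.idx (f.V v) = b (P.idx v))
    {l : List ι} (hl : l.Nodup) :
    P.prod l = (pairProd (Finset.univ.filter fun v => P.idx v ∈ l) (revSign f.V) *
      ∏ e ∈ Finset.univ.filter (fun e => P.edge e ∈ l), if f.flip e then -1 else 1) •
        Q.prod (l.map b) := by
  induction l with
  | nil => simp [prod, pairProd_empty]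
  | cons i l ih =>
    rw [List.nodup_cons] at hl
    have h₁ : (Finset.univ.filter fun v => P.idx v ∈ i :: l) =
        P.verts i ∪ Finset.univ.filter fun v => P.idx v ∈ l := by
      ext v
      simp [verts]
    have h₂ : Disjoint (P.verts i) (Finset.univ.filter fun v => P.idx v ∈ l) := by
      rw [Finset.disjoint_left]
      intro v h₁ h₂
      rw [mem_verts] at h₁
      simp only [Finset.mem_filter, h₁] at h₂
      exact hl.1 h₂.2
    have h₃ : (Finset.univ.filter fun e => P.edge e ∈ i :: l) =
        (Finset.univ.filter fun e => P.edge e = i) ∪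
          Finset.univ.filter fun e => P.edge e ∈ l := by
      ext v
      simp
    have h₄ : Disjoint (Finset.univ.filter fun e => P.edge e = i)
        (Finset.univ.filter fun e => P.edge e ∈ l) := by
      rw [Finset.disjoint_left]
      intro v h₁ h₂
      simp only [Finset.mem_filter] at h₁ h₂
      exact hl.1 (h₁.2 ▸ h₂.2)
    have h₅ : (l.map (P.cross i)).prod =
        (∏ u ∈ P.verts i, ∏ v ∈ Finset.univ.filter (fun v => P.idx v ∈ l), revSign f.V u v) *
          ((l.map b).map (Q.cross (b i))).prod := by
      clear h₁ h₂ h₃ h₄ ih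
      induction l with
      | nil => simp
      | cons j l ih =>
        simp only [List.mem_cons, not_or] at hl
        rw [List.nodup_cons] at hl
        have e : (Finset.univ.filter fun v => P.idx v ∈ j :: l) =
            P.verts j ∪ Finset.univ.filter fun v => P.idx v ∈ l := by
          ext v
          simp [verts]
        rw [e]
        have e₂ : ∀ u, ∏ v ∈ P.verts j ∪ Finset.univ.filter (fun v => P.idx v ∈ l),
            revSign f.V u v = (∏ v ∈ P.verts j, revSign f.V u v) *
              ∏ v ∈ Finset.univ.filter (fun v => P.idx v ∈ l), revSign f.V u v := by
          intro u
          refine Finset.prod_union (Finset.disjoint_left.2 fun v h₁ h₂ => ?_)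
          rw [mem_verts] at h₁
          simp only [Finset.mem_filter, h₁] at h₂
          exact hl.2.1 h₂.2
        simp only [e₂, List.map_cons, List.prod_cons, Finset.prod_mul_distrib]
        rw [ih ⟨hl.1.2, hl.2.2⟩, P.cross_map Q f b h hl.1.1]
        simp only [mul_assoc, mul_left_comm, mul_comm]
    obtain ⟨g, hg⟩ := P.exists_iso_fiber Q f b h i
    rw [List.map_cons, prod_cons, prod_cons, ih hl.2, cls_eq_of_iso g, hg, h₁, h₃,
      pairProd_union (revSign_comm f.V.injective) h₂, Finset.prod_union h₄, h₅,
      map_units_smul, smul_mul_assoc, mul_smul_comm, smul_smul, smul_smul, smul_smul]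
    congr 1
    ac_rfl

/-- The product of all components does not depend on the way they are indexed. -/
theorem prod_eq_of_iso (f : Iso X Y) (hP : ∀ i, (P.fiber i).Connected)
    (hQ : ∀ i, (Q.fiber i).Connected) {l : List ι} {l' : List ι'} (hl : l.Nodup)
    (hl' : l'.Nodup) (h : ∀ i, i ∈ l) (h' : ∀ i, i ∈ l') :
    P.prod l = f.sign • Q.prod l' := by
  -- Connected graphs are nonempty, so every index has a representative vertex; these define the
  -- bijection of the index sets.
  let v (i : ι) : X.V := (hP i).1.some.1
  have hv : ∀ i, P.idx (v i) = i := fun i => (hP i).1.some.2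
  let w (i : ι') : Y.V := (hQ i).1.some.1
  have hw : ∀ i, Q.idx (w i) = i := fun i => (hQ i).1.some.2
  -- The index of the image vertex is constant along edges, hence on each connected subgraph; so `f`
  -- carries components to components.
  have h₁ : ∀ x y, P.idx x = P.idx y → Q.idx (f.V x) = Q.idx (f.V y) := by
    intro x y h
    refine (hP (P.idx y)).eq_of_joined (fun x => Q.idx (f.V x.1)) (fun d => ?_) ⟨x, h⟩ ⟨y, rfl⟩
    change Q.idx (f.V (X.vtx (opp (P.fiberDart _ d)))) = Q.idx (f.V (X.vtx (P.fiberDart _ d)))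
    rw [← f.vtx_dart, ← f.vtx_dart, Q.idx_vtx, Q.idx_vtx]
    rfl
  have h₂ : ∀ x y, Q.idx x = Q.idx y → P.idx (f.V.symm x) = P.idx (f.V.symm y) := by
    intro x y h
    refine (hQ (Q.idx y)).eq_of_joined (fun x => P.idx (f.V.symm x.1)) (fun d => ?_) ⟨x, h⟩ ⟨y, rfl⟩
    have e : ∀ d, f.V.symm (Y.vtx d) = X.vtx (f.dart.symm d) := by
      intro d
      rw [Equiv.symm_apply_eq, ← f.vtx_dart, Equiv.apply_symm_apply]
    change P.idx (f.V.symm (Y.vtx (opp (Q.fiberDart _ d)))) =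
      P.idx (f.V.symm (Y.vtx (Q.fiberDart _ d)))
    rw [e, e, P.idx_vtx, P.idx_vtx]
    rfl
  let b : ι ≃ ι' :=
    { toFun := fun i => Q.idx (f.V (v i))
      invFun := fun i => P.idx (f.V.symm (w i))
      left_inv := fun i => by
        have : P.idx (f.V.symm (w (Q.idx (f.V (v i))))) = P.idx (f.V.symm (f.V (v i))) :=
          h₂ _ _ (hw _)
        simpa [hv] using this
      right_inv := fun i => by
        have : Q.idx (f.V (v (P.idx (f.V.symm (w i))))) = Q.idx (f.V (f.V.symm (w i))) :=
          h₁ _ _ (hv _)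
        simpa [hw] using this }
  have hb : ∀ x, Q.idx (f.V x) = b (P.idx x) := fun x => h₁ _ _ (hv _).symm
  rw [P.prod_map_iso Q f b hb hl, f.sign_eq, ordSign]
  have e₁ : (Finset.univ.filter fun v => P.idx v ∈ l) = Finset.univ := by simp [h]
  have e₂ : (Finset.univ.filter fun v => P.edge v ∈ l) = Finset.univ := by simp [h]
  rw [e₁, e₂]
  congr 1
  refine Q.prod_perm hQ ?_ (hl.map b.injective)
  refine (List.perm_ext_iff_of_nodup (hl.map b.injective) hl').2 fun i => ?_
  simp only [h', iff_true, List.mem_map]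
  exact ⟨b.symm i, h _, b.apply_symm_apply i⟩

end OGraph.Splitting

end Products

/-! ### The map to the symmetric algebra -/

namespace OGraph

open scoped Classical

variable {k : Type*} [Field k] {O : CyclicOperad k}

theorem eqvGen_opp (X : OGraph O) (d : X.E × Bool) :
    Relation.EqvGen X.Joined (X.vtx d) (X.vtx (opp d)) := by
  obtain ⟨e, _ | _⟩ := d
  · exact .rel _ _ ⟨e, rfl, rfl⟩
  · exact .symm _ _ (.rel _ _ ⟨e, rfl, rfl⟩)

theorem Connected.of_surjective {X Y : OGraph O} (h : X.Connected) (g : X.V → Y.V)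
    (hg : Function.Surjective g)
    (hj : ∀ e, Relation.EqvGen Y.Joined (g (X.vtx (e, false))) (g (X.vtx (e, true)))) :
    Y.Connected := by
  refine ⟨h.1.map g, fun u v => ?_⟩
  obtain ⟨u, rfl⟩ := hg u
  obtain ⟨v, rfl⟩ := hg v
  induction h.2 u v with
  | rel u v h =>
    obtain ⟨e, rfl, rfl⟩ := h
    exact hj e
  | refl => exact .refl _
  | symm _ _ _ ih => exact .symm _ _ ih
  | trans _ _ _ _ _ ih₁ ih₂ => exact .trans _ _ _ ih₁ ih₂

theorem Iso.connected {X Y : OGraph O} (f : Iso X Y) (h : X.Connected) : Y.Connected := by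
  refine h.of_surjective f.V f.V.surjective fun e => ?_
  rw [← f.vtx_dart]
  have := f.vtx_dart_opp (e, false)
  change _ = f.V (X.vtx (e, true)) at this
  rw [← this]
  exact Y.eqvGen_opp _

theorem exists_iso_refl (X : OGraph O) : ∃ f : Iso X X, f.sign = 1 := by
  obtain ⟨f, -, -, hf⟩ := exists_iso_ordSign (X := X) (Y := X) (Function.Embedding.refl _)
    (Function.Embedding.refl _) (Equiv.refl _) (Equiv.refl _) (fun _ => rfl) (fun _ => rfl)
  exact ⟨f, hf.trans (ordSign_eq_one _ fun _ _ h => h)⟩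

theorem exists_splitting (X : OGraph O) :
    ∃ (n : ℕ) (P : Splitting X (Fin n)), ∀ i, (P.fiber i).Connected := by
  have : Fintype (Quot X.Joined) := Fintype.ofFinite _
  let q := Fintype.equivFin (Quot X.Joined)
  let P : Splitting X (Fin (Fintype.card (Quot X.Joined))) :=
    { idx := fun v => q (Quot.mk _ v)
      idx_opp := fun d => congrArg q (Quot.eqvGen_sound (X.eqvGen_opp d)).symm }
  refine ⟨_, P, fun i => ⟨?_, ?_⟩⟩
  · obtain ⟨v, hv⟩ := Quot.exists_rep (q.symm i)
    exact ⟨⟨v, by change q _ = i; rw [hv, q.apply_symm_apply]⟩⟩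
  · have : ∀ u v, Relation.EqvGen X.Joined u v → ∀ (hu : P.idx u = i) (hv : P.idx v = i),
        Relation.EqvGen (P.fiber i).Joined ⟨u, hu⟩ ⟨v, hv⟩ := by
      intro u v h
      induction h with
      | rel u v h =>
        obtain ⟨e, rfl, rfl⟩ := h
        exact fun hu hv => .rel _ _ ⟨⟨e, hu⟩, rfl, rfl⟩
      | refl => exact fun _ _ => .refl _
      | symm _ _ _ ih => exact fun hu hv => .symm _ _ (ih hv hu)
      | trans u v w h _ ih₁ ih₂ =>
        intro hu hw
        have hv : P.idx v = i := (congrArg q (Quot.eqvGen_sound h)).symm.trans hu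
        exact .trans _ _ _ (ih₁ hu hv) (ih₂ hv hw)
    rintro ⟨u, hu⟩ ⟨v, hv⟩
    exact this u v (Quot.eqvGen_exact (q.injective (hu.trans hv.symm))) hu hv

/-- The product of the components of a graph. -/
def componentProd (X : OGraph O) : SymGraph O :=
  X.exists_splitting.choose_spec.choose.prod (List.finRange _)

theorem componentProd_eq {X Y : OGraph O} (f : Iso X Y) {ι : Type} (P : Splitting Y ι)
    (hP : ∀ i, (P.fiber i).Connected) {l : List ι} (hl : l.Nodup) (h : ∀ i, i ∈ l) :
    X.componentProd = f.sign • P.prod l :=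
  Splitting.prod_eq_of_iso _ P f X.exists_splitting.choose_spec.choose_spec hP
    (List.nodup_finRange _) hl List.mem_finRange h

theorem componentProd_eq_prod {X : OGraph O} {ι : Type} (P : Splitting X ι)
    (hP : ∀ i, (P.fiber i).Connected) {l : List ι} (hl : l.Nodup) (h : ∀ i, i ∈ l) :
    X.componentProd = P.prod l := by
  obtain ⟨f, hf⟩ := X.exists_iso_refl
  rw [componentProd_eq f P hP hl h, hf, one_smul]

namespace Splitting

variable {X : OGraph O} {ι : Type} (P : Splitting X ι)

/-- The same splitting after a change of the label of `v`. -/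
def withLabel (v : X.V) (u : LabelSpace O (X.H v)) : Splitting (X.withLabel v u) ι where
  idx := P.idx
  idx_opp := P.idx_opp

theorem fiber_withLabel_of_ne {v : X.V} (u : LabelSpace O (X.H v)) {i : ι} (h : i ≠ P.idx v) :
    (P.withLabel v u).fiber i = P.fiber i := by
  have : (fun w : {w // P.idx w = i} => Function.update X.label v u w.1) =
      fun w : {w // P.idx w = i} => X.label w.1 :=
    funext fun w => Function.update_of_ne (fun e => h (w.2.symm.trans (congrArg P.idx e))) _ _
  exact congrArg (fun L : (∀ w : {w // P.idx w = i}, LabelSpace O (X.H w.1)) =>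
    ({ P.fiber i with label := L } : OGraph O)) this

theorem fiber_withLabel_self (v : X.V) (u : LabelSpace O (X.H v)) :
    (P.withLabel v u).fiber (P.idx v) = (P.fiber (P.idx v)).withLabel ⟨v, rfl⟩ u := by
  have : (fun w : {w // P.idx w = P.idx v} => Function.update X.label v u w.1) =
      Function.update (fun w : {w // P.idx w = P.idx v} => X.label w.1) ⟨v, rfl⟩ u := by
    funext w
    by_cases h : w = ⟨v, rfl⟩
    · subst h
      rw [Function.update_self, Function.update_self]
    · rw [Function.update_of_ne h, Function.update_of_ne (fun e => h (Subtype.ext e))]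
  exact congrArg (fun L : (∀ w : {w // P.idx w = P.idx v}, LabelSpace O (X.H w.1)) =>
    ({ P.fiber (P.idx v) with label := L } : OGraph O)) this

theorem prod_withLabel {v : X.V} (u : LabelSpace O (X.H v)) {l : List ι} (h : P.idx v ∉ l) :
    (P.withLabel v u).prod l = P.prod l := by
  induction l with
  | nil => rfl
  | cons i l ih =>
    rw [List.mem_cons, not_or] at h
    rw [prod_cons, prod_cons, ih h.2, P.fiber_withLabel_of_ne u (Ne.symm h.1)]
    rfl

end Splitting

/-- Changing the label of one vertex affects a single component, and the product is linear in that
component. -/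
theorem respects_componentProd : GraphSpace.Respects (componentProd (O := O)) := by
  have key : ∀ (X : OGraph O) (v : X.V), ∃ (s : ℤˣ) (Y : OGraph O) (w : Y.V)
      (φ : LabelSpace O (X.H v) →ₗ[k] LabelSpace O (Y.H w)) (b : SymGraph O),
      ∀ u, (X.withLabel v u).componentProd =
        s • (extendι O (Y.withLabel w (φ u)).cls * b) := by
    intro X v
    obtain ⟨n, P, hP⟩ := X.exists_splitting
    -- The component of `v` is listed first, so that the remaining factor `P.prod l` and the
    -- crossing signs do not involve its label.
    let l := (List.finRange n).erase (P.idx v)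
    have hl : (P.idx v :: l).Nodup := List.nodup_cons.2
      ⟨(List.nodup_finRange n).not_mem_erase, (List.nodup_finRange n).erase _⟩
    refine ⟨(l.map (P.cross (P.idx v))).prod, P.fiber (P.idx v), ⟨v, rfl⟩, LinearMap.id,
      P.prod l, fun u => ?_⟩
    rw [componentProd_eq_prod (P.withLabel v u) hP hl
      fun i => by
        by_cases h : i = P.idx v
        · simp [h]
        · exact List.mem_cons_of_mem _ ((List.mem_erase_of_ne h).2 (List.mem_finRange i)),
      Splitting.prod_cons, P.prod_withLabel u (List.nodup_cons.1 hl).1, P.fiber_withLabel_self]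
    rfl
  refine ⟨fun {X Y} φ => ?_, fun X v a b => ?_, fun X v c a => ?_⟩
  · exact componentProd_eq φ _ Y.exists_splitting.choose_spec.choose_spec
      (List.nodup_finRange _) List.mem_finRange
  · obtain ⟨s, Y, w, φ, z, h⟩ := key X v
    rw [h, h, h, map_add, cls_withLabel_add, map_add, add_mul]
    exact smul_add _ _ _
  · obtain ⟨s, Y, w, φ, z, h⟩ := key X v
    rw [h, h, map_smul, cls_withLabel_smul, map_smul, smul_mul_assoc, smul_comm]

/-! #### Disjoint unions -/

section DisjointUnion

variable {n : ℕ} (X : Fin n → OGraph O)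

/-- The darts of a summand of a disjoint union. -/
def unionDart (j : Fin n) : (X j).E × Bool ↪ (disjointUnion X).E × Bool :=
  (Function.Embedding.sigmaMk (β := fun j => (X j).E) j).prodMap (Function.Embedding.refl _)

theorem loc_disjointUnion (j : Fin n) (v : (X j).V) :
    (disjointUnion X).loc (toLex ⟨j, v⟩) = ((X j).loc v).push (unionDart X j) := by
  refine Eq.trans ?_ (Loc.push_place (O := O) _ _ _).symm
  refine congrArg (fun f => Loc.place f ((X j).label v)) (Function.Embedding.ext fun h => ?_)
  rfl

/-- The splitting of a disjoint union. -/
def unionSplitting : Splitting (disjointUnion X) (Fin n) where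
  idx v := (ofLex v).1
  idx_opp _ := rfl

theorem exists_iso_unionSplitting (j : Fin n) :
    ∃ f : Iso (X j) ((unionSplitting X).fiber j), f.sign = 1 := by
  let V : (X j).V ≃ {v : Σₗ j, (X j).V // (ofLex v).1 = j} :=
    Equiv.ofBijective (fun v => ⟨toLex ⟨j, v⟩, rfl⟩) ⟨fun u v h => by
      simpa using congrArg (fun x => ofLex x.1) h, by rintro ⟨⟨i, v⟩, rfl⟩; exact ⟨v, rfl⟩⟩
  let E : (X j).E ≃ {e : Σ j, (X j).E // e.1 = j} :=
    Equiv.ofBijective (fun v => ⟨⟨j, v⟩, rfl⟩) ⟨fun u v h => by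
      simpa using congrArg Subtype.val h, by rintro ⟨⟨i, v⟩, rfl⟩; exact ⟨v, rfl⟩⟩
  obtain ⟨f, -, -, hf⟩ := exists_iso_ordSign (X := X j) (Y := (unionSplitting X).fiber j)
    (unionDart X j) ((unionSplitting X).fiberDart j) V E (fun p => rfl) (fun v =>
      ((unionSplitting X).loc_fiber j _).trans (loc_disjointUnion X j v))
  exact ⟨f, hf.trans (ordSign_eq_one _ fun u v h => Sigma.Lex.right _ _ h)⟩

/-- The lexicographic order puts the vertices of earlier summands first, so an increasing list has
trivial crossing signs. -/
theorem prod_unionSplitting (hX : ∀ j, (X j).Connected) {l : List (Fin n)}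
    (hl : l.Pairwise (· < ·)) :
    (unionSplitting X).prod l = SymGraph.prod (l.map fun j => ⟨X j, hX j⟩) := by
  induction l with
  | nil => rfl
  | cons i l ih =>
    rw [List.pairwise_cons] at hl
    obtain ⟨f, hf⟩ := exists_iso_unionSplitting X i
    have h₁ : (l.map ((unionSplitting X).cross i)).prod = 1 := by
      refine List.prod_eq_one fun s hs => ?_
      obtain ⟨j, hj, rfl⟩ := List.mem_map.1 hs
      refine Finset.prod_eq_one fun u hu => Finset.prod_eq_one fun v hv => if_neg ?_
      rw [Splitting.mem_verts] at hu hv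
      refine not_lt_of_gt ?_
      have : (ofLex u).1 < (ofLex v).1 := by
        change (unionSplitting X).idx u < (unionSplitting X).idx v
        rw [hu, hv]
        exact hl.1 j hj
      exact Sigma.Lex.left _ _ this
    rw [Splitting.prod_cons, h₁, one_smul, ih hl.2]
    have := cls_eq_of_iso f
    rw [hf, one_smul] at this
    rw [← this, extendι_cls (hX i)]
    rfl

theorem componentProd_disjointUnion (hX : ∀ j, (X j).Connected) :
    (disjointUnion X).componentProd = SymGraph.prod (List.ofFn fun j => ⟨X j, hX j⟩) := by
  rw [componentProd_eq_prod (unionSplitting X) (fun i =>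
      (exists_iso_unionSplitting X i).choose.connected (hX i)) (List.nodup_finRange n)
      List.mem_finRange, prod_unionSplitting X hX (List.pairwise_lt_finRange n), List.ofFn_eq_map]

end DisjointUnion

theorem Splitting.exists_iso_disjointUnion {X : OGraph O} {n : ℕ} (P : Splitting X (Fin n)) :
    Nonempty (Iso X (disjointUnion P.fiber)) := by
  let V : X.V ≃ Σₗ j, {v // P.idx v = j} := (Equiv.sigmaFiberEquiv P.idx).symm.trans toLex
  let E : X.E ≃ Σ j, {e // P.edge e = j} := (Equiv.sigmaFiberEquiv P.edge).symm
  obtain ⟨f, -⟩ := exists_iso_ordSign (X := X) (Y := disjointUnion P.fiber)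
    (Function.Embedding.refl _) (E.symm.prodCongr (Equiv.refl _)).toEmbedding V E
    (fun p => Prod.ext (E.symm_apply_apply p.1) rfl) (fun v => by
      refine (congrArg (Loc.push _) (loc_disjointUnion P.fiber (P.idx v) ⟨v, rfl⟩)).trans ?_
      refine (Loc.push_push (O := O) _ _ _).trans ?_
      exact (P.loc_fiber (P.idx v) ⟨v, rfl⟩).trans (Loc.push_refl _).symm)
  exact ⟨f⟩

end OGraph

/-! ### Existence of the component map and its value on arbitrary graphs. -/

section ComponentMap

open scoped Classical

variable {k : Type*} [Field k] (O : CyclicOperad k)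

theorem exists_isComponentMap : ∃ S, IsComponentMap O S := by
  obtain ⟨S, hS⟩ := OGraph.respects_componentProd.exists_lift (O := O)
  exact ⟨S, fun n X hX => (hS _).trans (OGraph.componentProd_disjointUnion X hX)⟩

theorem isComponentMap_componentMap : IsComponentMap O (componentMap O) := by
  rw [componentMap, dif_pos (exists_isComponentMap O)]
  exact (exists_isComponentMap O).choose_spec

variable {O}

/-- The defining property fixes the map on all graphs, since each graph is up to sign the disjoint
union of its components; both sides transform in the same way under this isomorphism. -/
theorem componentMap_cls (X : OGraph O) : componentMap O X.cls = X.componentProd := by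
  obtain ⟨n, P, hP⟩ := X.exists_splitting
  obtain ⟨f⟩ := P.exists_iso_disjointUnion
  rw [OGraph.cls_eq_of_iso f, map_units_smul, isComponentMap_componentMap O n P.fiber hP,
    OGraph.respects_componentProd.iso f, OGraph.componentProd_disjointUnion _ hP]

theorem componentMap_eq_prod {X : OGraph O} {ι : Type} (P : OGraph.Splitting X ι)
    (hP : ∀ i, (P.fiber i).Connected) {l : List ι} (hl : l.Nodup) (h : ∀ i, i ∈ l) :
    componentMap O X.cls = P.prod l :=
  (componentMap_cls X).trans (OGraph.componentProd_eq_prod P hP hl h)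

end ComponentMap

/-! ### Derivations of the symmetric algebra -/

section Derivations

open scoped Classical

variable {k : Type*} [Field k] {O : CyclicOperad k}

theorem Primitive.induction {p : Primitive O → Prop}
    (h : ∀ (X : OGraph O) (hX : X.Connected), p (X.prim hX))
    (hadd : ∀ a b, p a → p b → p (a + b)) (hsmul : ∀ (c : k) a, p a → p (c • a))
    (hzero : p 0) (x : Primitive O) : p x := by
  obtain ⟨x, hx⟩ := x
  induction hx using Submodule.span_induction with
  | mem x hx =>
    obtain ⟨X, hX, rfl⟩ := hx
    exact h X hX
  | zero => exact hzero
  | add x y hx hy h₁ h₂ => exact hadd _ _ h₁ h₂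
  | smul c x hx h => exact hsmul c _ h

namespace SymGraph

theorem prod_cons (X : {X : OGraph O // X.Connected}) (l : List {X : OGraph O // X.Connected}) :
    prod (X :: l) = ι O (X.1.prim X.2) * prod l := by
  simp [prod]

/-- The span contains 1 and is stable under left multiplication by generators, hence by every
element of the algebra. -/
theorem span_prod : Submodule.span k (Set.range (prod (O := O))) = ⊤ := by
  rw [eq_top_iff]
  have key : ∀ a : TensorAlgebra k (Primitive O), ∀ b ∈ Submodule.span k (Set.range (prod (O := O))),
      RingQuot.mkAlgHom k (SymRel O) a * b ∈ Submodule.span k (Set.range (prod (O := O))) := by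
    intro a
    induction a using TensorAlgebra.induction with
    | algebraMap c =>
      intro b hb
      rw [AlgHom.commutes, ← Algebra.smul_def]
      exact Submodule.smul_mem _ _ hb
    | ι x =>
      intro b hb
      change SymGraph.ι O x * b ∈ _
      induction x using Primitive.induction with
      | h X hX =>
        induction hb using Submodule.span_induction with
        | mem b hb =>
          obtain ⟨l, rfl⟩ := hb
          exact Submodule.subset_span ⟨⟨X, hX⟩ :: l, prod_cons _ _⟩
        | zero => rw [mul_zero]; exact Submodule.zero_mem _
        | add a b _ _ ha hb => rw [mul_add]; exact Submodule.add_mem _ ha hb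
        | smul c a _ ha => rw [mul_smul_comm]; exact Submodule.smul_mem _ _ ha
      | hadd x y hx hy => rw [map_add, add_mul]; exact Submodule.add_mem _ hx hy
      | hsmul c x hx => rw [map_smul, smul_mul_assoc]; exact Submodule.smul_mem _ _ hx
      | hzero => rw [map_zero, zero_mul]; exact Submodule.zero_mem _
    | mul x y hx hy =>
      intro b hb
      rw [map_mul, mul_assoc]
      exact hx _ (hy _ hb)
    | add x y hx hy =>
      intro b hb
      rw [map_add, add_mul]
      exact Submodule.add_mem _ (hx _ hb) (hy _ hb)
  intro z _
  obtain ⟨a, rfl⟩ := RingQuot.mkAlgHom_surjective k (SymRel O) z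
  have := key a 1 (Submodule.subset_span ⟨[], rfl⟩)
  rwa [mul_one] at this

theorem hom_ext {M : Type*} [AddCommGroup M] [Module k M] {f g : SymGraph O →ₗ[k] M}
    (h : ∀ l, f (prod l) = g (prod l)) : f = g :=
  LinearMap.ext_on span_prod (by rintro _ ⟨l, rfl⟩; exact h l)

theorem mem_of_prod_mem (p : Submodule k (SymGraph O)) (f : SymGraph O →ₗ[k] SymGraph O)
    (h : ∀ l, f (prod l) ∈ p) (z : SymGraph O) : f z ∈ p := by
  have : z ∈ Submodule.span k (Set.range (prod (O := O))) := by rw [span_prod]; trivial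
  induction this using Submodule.span_induction with
  | mem z hz => obtain ⟨l, rfl⟩ := hz; exact h l
  | zero => rw [map_zero]; exact Submodule.zero_mem _
  | add a b _ _ ha hb => rw [map_add]; exact Submodule.add_mem _ ha hb
  | smul c a _ ha => rw [map_smul]; exact Submodule.smul_mem _ _ ha

theorem prod_mem_degree (l : List {X : OGraph O // X.Connected}) :
    prod l ∈ degree O (l.map fun X => Fintype.card X.1.V).sum :=
  Submodule.subset_span ⟨l, rfl, rfl⟩

theorem ι_mem_degree {X : OGraph O} (hX : X.Connected) :
    ι O (X.prim hX) ∈ degree O (Fintype.card X.V) :=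
  Submodule.subset_span ⟨[⟨X, hX⟩], by simp, by simp [prod]⟩

theorem one_mem_degree : (1 : SymGraph O) ∈ degree O 0 :=
  Submodule.subset_span ⟨[], rfl, rfl⟩

theorem proj_mem_power (i : ℕ) (z : SymGraph O) : proj O i z ∈ power O i := by
  refine mem_of_prod_mem _ _ (fun l => ?_) z
  rw [proj_prod]
  split_ifs with h
  · exact Submodule.subset_span ⟨l, h, rfl⟩
  · exact Submodule.zero_mem _

theorem proj_mem_degree (i : ℕ) {v : ℕ} {z : SymGraph O} (hz : z ∈ degree O v) :
    proj O i z ∈ degree O v := by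
  induction hz using Submodule.span_induction with
  | mem z hz =>
    obtain ⟨l, hl, rfl⟩ := hz
    rw [proj_prod]
    split_ifs with h
    · exact Submodule.subset_span ⟨l, hl, rfl⟩
    · exact Submodule.zero_mem _
  | zero => rw [map_zero]; exact Submodule.zero_mem _
  | add a b _ _ ha hb => rw [map_add]; exact Submodule.add_mem _ ha hb
  | smul c a _ ha => rw [map_smul]; exact Submodule.smul_mem _ _ ha

theorem ι_mul_mem_power {i : ℕ} {z : SymGraph O} (hz : z ∈ power O i) (x : Primitive O) :
    ι O x * z ∈ power O (i + 1) := by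
  induction x using Primitive.induction with
  | h X hX =>
    induction hz using Submodule.span_induction with
    | mem b hb =>
      obtain ⟨l, hl, rfl⟩ := hb
      exact Submodule.subset_span ⟨⟨X, hX⟩ :: l, by simp [hl], prod_cons _ _⟩
    | zero => rw [mul_zero]; exact Submodule.zero_mem _
    | add a b _ _ ha hb => rw [mul_add]; exact Submodule.add_mem _ ha hb
    | smul c a _ ha => rw [mul_smul_comm]; exact Submodule.smul_mem _ _ ha
  | hadd x y hx hy => rw [map_add, add_mul]; exact Submodule.add_mem _ hx hy
  | hsmul c x hx => rw [map_smul, smul_mul_assoc]; exact Submodule.smul_mem _ _ hx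
  | hzero => rw [map_zero, zero_mul]; exact Submodule.zero_mem _

theorem proj_of_mem_power {i j : ℕ} {z : SymGraph O} (hz : z ∈ power O j) :
    proj O i z = if j = i then z else 0 := by
  induction hz using Submodule.span_induction with
  | mem z hz => obtain ⟨l, rfl, rfl⟩ := hz; exact proj_prod l i
  | zero => simp
  | add a b _ _ ha hb => rw [map_add, ha, hb]; split_ifs <;> simp
  | smul c a _ ha => rw [map_smul, ha]; split_ifs <;> simp

theorem units_pow_smul (n : ℕ) (z : SymGraph O) : ((-1 : ℤˣ) ^ n) • z = ((-1 : k) ^ n) • z := by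
  rw [Units.smul_def, ← Int.cast_smul_eq_zsmul k]
  push_cast
  rfl

/-- Graded commutativity of generators propagates through products one factor at a time. -/
theorem mul_ι_of_mem_degree {v : ℕ} {z : SymGraph O} (hz : z ∈ degree O v) {X : OGraph O}
    (hX : X.Connected) :
    z * ι O (X.prim hX) = (-1 : k) ^ (v * Fintype.card X.V) • (ι O (X.prim hX) * z) := by
  induction hz using Submodule.span_induction with
  | mem z hz =>
    obtain ⟨l, rfl, rfl⟩ := hz
    induction l with
    | nil => simp [prod]
    | cons Y l ih =>
      rw [prod_cons, mul_assoc, ih, mul_smul_comm, ← mul_assoc, ι_mul_ι Y.2 hX, units_pow_smul,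
        smul_mul_assoc, smul_smul, ← pow_add, mul_assoc, List.map_cons, List.sum_cons, add_mul,
        add_comm]
  | zero => simp
  | add a b _ _ ha hb => rw [add_mul, ha, hb, mul_add, smul_add]
  | smul c a _ ha => rw [smul_mul_assoc, ha, mul_smul_comm, smul_comm]

end SymGraph

open SymGraph

namespace IsGradedDerivation

variable {d : ℕ} {D D' : SymGraph O →ₗ[k] SymGraph O}

theorem map_one (hD : IsGradedDerivation d D) : D 1 = 0 := by
  have := hD 0 1 one_mem_degree 1
  simpa using this

theorem ι_mul (hD : IsGradedDerivation d D) {X : OGraph O} (hX : X.Connected) (b : SymGraph O) :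
    D (ι O (X.prim hX) * b) = D (ι O (X.prim hX)) * b +
      (-1 : k) ^ (d * Fintype.card X.V) • (ι O (X.prim hX) * D b) :=
  hD _ _ (ι_mem_degree hX) b

theorem ext (hD : IsGradedDerivation d D) (hD' : IsGradedDerivation d D')
    (h : ∀ (X : OGraph O) (hX : X.Connected), D (ι O (X.prim hX)) = D' (ι O (X.prim hX))) :
    D = D' := by
  refine SymGraph.hom_ext fun l => ?_
  induction l with
  | nil => exact hD.map_one.trans hD'.map_one.symm
  | cons X l ih => rw [prod_cons, hD.ι_mul, hD'.ι_mul, ih, h]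

end IsGradedDerivation

/-- The number of vertices is invariant under isomorphism and change of labels, so its sign gives a
linear map. It supplies the Koszul sign in the extension of derivations. -/
theorem exists_signι (d : ℕ) : ∃ σ : Primitive O →ₗ[k] SymGraph O, ∀ (X : OGraph O)
    (hX : X.Connected), σ (X.prim hX) = (-1 : k) ^ (d * Fintype.card X.V) • ι O (X.prim hX) := by
  have h : GraphSpace.Respects fun X : OGraph O =>
      (-1 : k) ^ (d * Fintype.card X.V) • extendι O X.cls := by
    refine ⟨fun {X Y} φ => ?_, fun X v a b => ?_, fun X v c a => ?_⟩
    · rw [OGraph.cls_eq_of_iso φ, map_units_smul, Fintype.card_congr φ.V, smul_comm]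
    · rw [OGraph.cls_withLabel_add, map_add, smul_add]
      rfl
    · rw [OGraph.cls_withLabel_smul, map_smul, smul_comm]
      rfl
  obtain ⟨T, hT⟩ := h.exists_lift
  refine ⟨T ∘ₗ (Primitive O).subtype, fun X hX => (hT X).trans ?_⟩
  rw [extendι_cls hX]

/-- The generators are sent to the upper triangular matrices with rows (±x, f x) and (0, x), the
sign being that of `exists_signι`. If this respects graded commutativity, it extends to an algebra
map, and multiplicativity of its upper right entry is the graded Leibniz rule. The condition on
parities is what makes the relation hold in that entry. -/
theorem exists_extendDerivation (d : ℕ) (f : Primitive O →ₗ[k] SymGraph O)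
    (hf : ∀ (X : OGraph O) (hX : X.Connected), ∃ m, f (X.prim hX) ∈ degree O m ∧
      (-1 : k) ^ m = (-1 : k) ^ (Fintype.card X.V + d)) :
    ∃ D, IsGradedDerivation d D ∧ ∀ x, D (SymGraph.ι O x) = f x := by
  obtain ⟨σ, hσ⟩ := exists_signι (O := O) d
  let ψ : Primitive O →ₗ[k] Matrix (Fin 2) (Fin 2) (SymGraph O) :=
    { toFun := fun x => !![σ x, f x; 0, ι O x]
      map_add' := fun x y => by
        ext i j; fin_cases i <;> fin_cases j <;> simp
      map_smul' := fun c x => by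
        ext i j; fin_cases i <;> fin_cases j <;> simp }
  have hf' : ∀ (X Y : OGraph O) (hX : X.Connected) (hY : Y.Connected),
      f (X.prim hX) * ι O (Y.prim hY) =
        (-1 : k) ^ ((Fintype.card X.V + d) * Fintype.card Y.V) •
          (ι O (Y.prim hY) * f (X.prim hX)) := by
    intro X Y hX hY
    obtain ⟨m, hm, e⟩ := hf X hX
    rw [mul_ι_of_mem_degree hm hY, pow_mul, e, ← pow_mul]
  have hι : ∀ (X Y : OGraph O) (hX : X.Connected) (hY : Y.Connected),
      ι O (X.prim hX) * ι O (Y.prim hY) = (-1 : k) ^ (Fintype.card X.V * Fintype.card Y.V) •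
        (ι O (Y.prim hY) * ι O (X.prim hX)) :=
    fun X Y hX hY => mul_ι_of_mem_degree (ι_mem_degree hX) hY
  have one : ∀ n : ℕ, (-1 : k) ^ n * (-1 : k) ^ n = 1 := fun n => by
    rw [← pow_add, ← two_mul, pow_mul, neg_one_sq, one_pow]
  let φ : SymGraph O →ₐ[k] Matrix (Fin 2) (Fin 2) (SymGraph O) :=
    RingQuot.liftAlgHom k ⟨TensorAlgebra.lift k ψ, by
      rintro _ _ ⟨X, Y, hX, hY⟩
      rw [map_mul, map_smul, map_mul, TensorAlgebra.lift_ι_apply, TensorAlgebra.lift_ι_apply]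
      ext i j
      fin_cases i <;> fin_cases j
      · simp only [ψ, LinearMap.coe_mk, AddHom.coe_mk, Matrix.mul_apply, Fin.sum_univ_two,
          Matrix.smul_apply]
        simp [hσ, hι X Y hX hY, smul_smul, mul_assoc, mul_comm, mul_left_comm]
      -- The upper right entry: moving the values of `f` past the generators, with the parity
      -- prescribed by `hf`, exchanges the two summands of the Leibniz expression.
      · simp only [ψ, LinearMap.coe_mk, AddHom.coe_mk, Matrix.mul_apply, Fin.sum_univ_two,
          Matrix.smul_apply]
        simp only [Fin.zero_eta, Fin.isValue, Matrix.of_apply, Matrix.cons_val', Matrix.cons_val_zero,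
          Matrix.cons_val_one, Fin.mk_one, Matrix.cons_val_fin_one, hσ, smul_mul_assoc,
          hf' X Y hX hY, hf' Y X hY hX, smul_add, smul_smul]
        rw [add_comm]
        congr 2
        · rw [← pow_add]
          congr 1
          ring
        · rw [add_mul, pow_add, ← mul_assoc, mul_comm (Fintype.card Y.V), one, one_mul]
      · simp [ψ, Matrix.mul_apply]
      · simp only [ψ, LinearMap.coe_mk, AddHom.coe_mk, Matrix.mul_apply, Fin.sum_univ_two,
          Matrix.smul_apply]
        simp [hι X Y hX hY]⟩
  have hφ : ∀ x, φ (ι O x) = ψ x := fun x => by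
    simp [φ, ι, RingQuot.liftAlgHom_mkAlgHom_apply]
  have h₁ : ∀ l, φ (prod l) 1 0 = 0 ∧ φ (prod l) 1 1 = prod l ∧
      φ (prod l) 0 0 = (-1 : k) ^ (d * (l.map fun X => Fintype.card X.1.V).sum) • prod l := by
    intro l
    induction l with
    | nil => simp [prod]
    | cons X l ih =>
      rw [prod_cons, map_mul, hφ]
      simp [Matrix.mul_apply, ψ, ih, hσ, smul_smul, ← pow_add, mul_add, add_comm]
  let E (i j : Fin 2) : SymGraph O →ₗ[k] SymGraph O :=
    (Matrix.entryLinearMap k (SymGraph O) i j) ∘ₗ φ.toLinearMap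
  have h₂ : ∀ z, φ z 1 1 = z := fun z =>
    LinearMap.congr_fun (f := E 1 1) (g := LinearMap.id) (SymGraph.hom_ext fun l => (h₁ l).2.1) z
  have h₃ : ∀ v, ∀ z ∈ degree O v, φ z 0 0 = (-1 : k) ^ (d * v) • z := by
    intro v z hz
    change E 0 0 z = _
    induction hz using Submodule.span_induction with
    | mem z hz => obtain ⟨l, rfl, rfl⟩ := hz; exact (h₁ l).2.2
    | zero => simp
    | add a b _ _ ha hb => rw [map_add, ha, hb, smul_add]
    | smul c a _ ha => rw [map_smul, ha, smul_comm]
  refine ⟨E 0 1, fun v a ha b => ?_, fun x => ?_⟩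
  · change φ (a * b) 0 1 = φ a 0 1 * b + _ • (a * φ b 0 1)
    rw [map_mul, Matrix.mul_apply, Fin.sum_univ_two, h₂, h₃ v a ha, smul_mul_assoc, add_comm]
  · change φ (ι O x) 0 1 = _
    rw [hφ]
    rfl

theorem extendDerivation_spec (d : ℕ) (f : Primitive O →ₗ[k] SymGraph O)
    (hf : ∀ (X : OGraph O) (hX : X.Connected), ∃ m, f (X.prim hX) ∈ degree O m ∧
      (-1 : k) ^ m = (-1 : k) ^ (Fintype.card X.V + d)) :
    IsGradedDerivation d (extendDerivation d f) ∧
      ∀ x, extendDerivation d f (SymGraph.ι O x) = f x := by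
  have h := exists_extendDerivation d f hf
  rw [extendDerivation, dif_pos h]
  exact h.choose_spec

end Derivations

/-! ### The boundary operators and the component map -/

namespace OGraph

open scoped Classical

variable {k : Type*} [Field k] {O : CyclicOperad k}

/-- Paths map to paths under the surjection of vertices, the contracted edge becoming constant. -/
theorem absorb_connected {X : OGraph O} (hX : X.Connected) {d : X.E × Bool}
    (h : X.vtx d ≠ X.vtx (opp d)) : (X.absorb d h).Connected := by
  refine hX.of_surjective (X.absorbV d h)
    (fun v => ⟨v.1, X.absorbV_of_ne d h v.2⟩) fun e => ?_
  by_cases he : e = d.1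
  · have : X.absorbV d h (X.vtx d) = X.absorbV d h (X.vtx (opp d)) := by
      rw [absorbV_self, absorbV_of_ne _ _ _ h.symm]
    obtain ⟨f, _ | _⟩ := d
    · subst he
      change X.absorbV _ h (X.vtx (e, false)) = X.absorbV _ h (X.vtx (e, true)) at this
      rw [this]
      exact .refl _
    · subst he
      change X.absorbV _ h (X.vtx (e, true)) = X.absorbV _ h (X.vtx (e, false)) at this
      rw [this]
      exact .refl _
  · exact .rel _ _ ⟨⟨e, he⟩, rfl, rfl⟩

theorem contracted_mem_primitive {X : OGraph O} (hX : X.Connected) (e : X.E) :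
    X.contracted e ∈ Primitive O := by
  by_cases he : X.IsLoop e
  · rw [contracted_of_isLoop X he]
    exact Submodule.zero_mem _
  · rw [contracted_eq X (e, false) (absorb_ne_of_not_isLoop he false), Units.smul_def]
    exact zsmul_mem ((X.absorb _ _).prim (absorb_connected hX _)).2 _

theorem exists_iso_sign_eq_one {X Y : OGraph O} {D : Type} (i : X.E × Bool ↪ D)
    (j : Y.E × Bool ↪ D) (V : X.V ≃ Y.V) (E : X.E ≃ Y.E) (hV : ∀ u v, u < v → V u < V v)
    (hE : ∀ p, j (E p.1, p.2) = i p)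
    (hL : ∀ v, (Y.loc (V v)).push j = (X.loc v).push i) : ∃ f : Iso X Y, f.sign = 1 := by
  obtain ⟨f, -, -, hf⟩ := exists_iso_ordSign i j V E hE hL
  exact ⟨f, hf.trans (ordSign_eq_one V hV)⟩

namespace Splitting

variable {X : OGraph O} {ι : Type} (P : Splitting X ι)

/-- The vertices with values in a list. -/
def vertsIn (l : List ι) : Finset X.V := Finset.univ.filter fun v => P.idx v ∈ l

theorem mem_vertsIn {l : List ι} {v : X.V} : v ∈ P.vertsIn l ↔ P.idx v ∈ l := by simp [vertsIn]

theorem vertsIn_cons (i : ι) (l : List ι) : P.vertsIn (i :: l) = P.verts i ∪ P.vertsIn l := by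
  ext v
  simp [mem_vertsIn, mem_verts]

theorem verts_disjoint_vertsIn {i : ι} {l : List ι} (h : i ∉ l) :
    Disjoint (P.verts i) (P.vertsIn l) :=
  Finset.disjoint_left.2 fun _ h₁ h₂ => h (P.mem_verts.1 h₁ ▸ P.mem_vertsIn.1 h₂)

theorem prod_map_cross (i : ι) {l : List ι} (hl : l.Nodup) :
    (l.map (P.cross i)).prod =
      ∏ u ∈ P.verts i, ∏ v ∈ P.vertsIn l, if v < u then -1 else 1 := by
  induction l with
  | nil => simp [vertsIn]
  | cons j l ih =>
    rw [List.nodup_cons] at hl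
    have e : ∀ u, ∏ v ∈ P.vertsIn (j :: l), (if v < u then (-1 : ℤˣ) else 1) =
        (∏ v ∈ P.verts j, if v < u then -1 else 1) *
          ∏ v ∈ P.vertsIn l, if v < u then -1 else 1 := fun u => by
      rw [vertsIn_cons, Finset.prod_union (P.verts_disjoint_vertsIn hl.1)]
    simp only [e, List.map_cons, List.prod_cons, Finset.prod_mul_distrib, ih hl.2]
    rfl

/-- A splitting remains a splitting after contraction of an edge. -/
def absorb (d : X.E × Bool) (h : X.vtx d ≠ X.vtx (opp d)) : Splitting (X.absorb d h) ι where
  idx v := P.idx v.1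
  idx_opp p := by
    have : ∀ p : X.E × Bool, P.idx (X.absorbV d h (X.vtx p)).1 = P.edge p.1 := by
      intro p
      by_cases hp : X.vtx p = X.vtx d
      · rw [hp, absorbV_self, ← P.idx_vtx, hp]
        exact P.idx_opp d
      · rw [absorbV_of_ne _ _ _ hp, ← P.idx_vtx]
    exact (this (dartEmb d.1 (opp p))).trans (this (dartEmb d.1 p)).symm

theorem absorb_edge (d : X.E × Bool) (h : X.vtx d ≠ X.vtx (opp d)) (e : {e : X.E // e ≠ d.1}) :
    (P.absorb d h).edge e = P.edge e.1 := by
  change P.idx (X.absorbV d h (X.vtx (e.1, false))).1 = _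
  by_cases hp : X.vtx (e.1, false) = X.vtx d
  · rw [hp, absorbV_self, ← P.idx_vtx (e.1, false), hp]
    exact P.idx_opp d
  · rw [absorbV_of_ne _ _ _ hp]
    rfl

theorem exists_iso_fiber_absorb_of_ne {d : X.E × Bool} (h : X.vtx d ≠ X.vtx (opp d)) {i : ι}
    (hi : P.edge d.1 ≠ i) : ∃ f : Iso (P.fiber i) ((P.absorb d h).fiber i), f.sign = 1 := by
  let V : {v // P.idx v = i} ≃ {v : {v // v ≠ X.vtx d} // P.idx v.1 = i} :=
    { toFun := fun v => ⟨⟨v.1, fun e => hi (by rw [← v.2, e, P.idx_vtx])⟩, v.2⟩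
      invFun := fun v => ⟨v.1.1, v.2⟩
      left_inv := fun _ => rfl
      right_inv := fun _ => rfl }
  let E : {e // P.edge e = i} ≃ {e : {e // e ≠ d.1} // (P.absorb d h).edge e = i} :=
    { toFun := fun e => ⟨⟨e.1, fun he => hi (by rw [← e.2, he])⟩,
        (P.absorb_edge d h _).trans e.2⟩
      invFun := fun e => ⟨e.1.1, (P.absorb_edge d h _).symm.trans e.2⟩
      left_inv := fun _ => rfl
      right_inv := fun _ => rfl }
  refine exists_iso_sign_eq_one (X := P.fiber i) (Y := (P.absorb d h).fiber i) (P.fiberDart i)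
    (((P.absorb d h).fiberDart i).trans (dartEmb d.1)) V E (fun _ _ h => h) (fun _ => rfl)
    fun v => ?_
  refine (Loc.push_push (O := O) _ _ _).symm.trans ?_
  refine (congrArg (Loc.push _) ((P.absorb d h).loc_fiber i (V v))).trans ?_
  refine (push_loc_absorb h _).trans (Eq.trans ?_ (P.loc_fiber i v).symm)
  refine if_neg fun e => hi ?_
  rw [← v.2]
  exact ((congrArg P.idx e).trans (P.idx_vtx _)).symm

theorem absorbLoc_fiber {i : ι} {d : (P.fiber i).E × Bool}
    (h : (P.fiber i).vtx d ≠ (P.fiber i).vtx (opp d)) (v : (P.fiber i).V) :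
    ((P.fiber i).absorbLoc d v).push (P.fiberDart i) = X.absorbLoc (P.fiberDart i d) v.1 := by
  by_cases hv : v = (P.fiber i).vtx (opp d)
  · rw [absorbLoc, if_pos hv, Loc.push_graft _ ((P.fiber i).mem_loc.2 rfl)
      ((P.fiber i).mem_loc.2 rfl) ((P.fiber i).loc_disjoint h), loc_fiber, loc_fiber]
    exact (if_pos (congrArg Subtype.val hv)).symm
  · rw [absorbLoc, if_neg hv, loc_fiber]
    exact (if_neg fun e => hv (Subtype.ext e)).symm

theorem exists_iso_fiber_absorb {i : ι} {d : (P.fiber i).E × Bool}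
    (h : (P.fiber i).vtx d ≠ (P.fiber i).vtx (opp d))
    (h' : X.vtx (P.fiberDart i d) ≠ X.vtx (opp (P.fiberDart i d))) :
    ∃ f : Iso ((P.fiber i).absorb d h) ((P.absorb (P.fiberDart i d) h').fiber i), f.sign = 1 := by
  let V : {v : {v // P.idx v = i} // v ≠ (P.fiber i).vtx d} ≃
      {v : {v // v ≠ X.vtx (P.fiberDart i d)} // P.idx v.1 = i} :=
    { toFun := fun v => ⟨⟨v.1.1, fun e => v.2 (Subtype.ext e)⟩, v.1.2⟩
      invFun := fun v => ⟨⟨v.1.1, v.2⟩, fun e => v.1.2 (congrArg Subtype.val e)⟩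
      left_inv := fun _ => rfl
      right_inv := fun _ => rfl }
  let E : {e : {e // P.edge e = i} // e ≠ d.1} ≃
      {e : {e // e ≠ (P.fiberDart i d).1} // (P.absorb (P.fiberDart i d) h').edge e = i} :=
    { toFun := fun e => ⟨⟨e.1.1, fun he => e.2 (Subtype.ext he)⟩,
        (P.absorb_edge _ h' _).trans e.1.2⟩
      invFun := fun e => ⟨⟨e.1.1, (P.absorb_edge _ h' _).symm.trans e.2⟩,
        fun he => e.1.2 (congrArg Subtype.val he)⟩
      left_inv := fun _ => rfl
      right_inv := fun _ => rfl }
  refine exists_iso_sign_eq_one (X := (P.fiber i).absorb d h)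
    (Y := (P.absorb (P.fiberDart i d) h').fiber i) ((dartEmb d.1).trans (P.fiberDart i))
    (((P.absorb _ h').fiberDart i).trans (dartEmb (P.fiberDart i d).1)) V E (fun _ _ h => h)
    (fun _ => rfl) fun v => ?_
  refine (Loc.push_push (O := O) _ _ _).symm.trans ?_
  refine (congrArg (Loc.push _) ((P.absorb _ h').loc_fiber i (V v))).trans ?_
  refine (push_loc_absorb h' _).trans ?_
  refine Eq.trans ?_ (Loc.push_push (O := O) _ _ _)
  exact (P.absorbLoc_fiber h v.1).symm.trans (congrArg (Loc.push _) (push_loc_absorb h v).symm)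

theorem absorb_connected (hP : ∀ i, (P.fiber i).Connected) {d : X.E × Bool}
    (h : X.vtx d ≠ X.vtx (opp d)) (i : ι) : ((P.absorb d h).fiber i).Connected := by
  by_cases hi : P.edge d.1 = i
  · obtain ⟨f, -⟩ := P.exists_iso_fiber_absorb (i := i) (d := (⟨d.1, hi⟩, d.2))
      (fun e => h (congrArg Subtype.val e)) h
    exact f.connected (OGraph.absorb_connected (hP i) _)
  · obtain ⟨f, -⟩ := P.exists_iso_fiber_absorb_of_ne h hi
    exact f.connected (hP i)

theorem map_verts_absorb (d : X.E × Bool) (h : X.vtx d ≠ X.vtx (opp d)) (i : ι) :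
    ((P.absorb d h).verts i).map (Function.Embedding.subtype _) = (P.verts i).erase (X.vtx d) := by
  ext v
  rw [Finset.mem_erase, mem_verts, Finset.mem_map]
  constructor
  · rintro ⟨w, hw, rfl⟩
    exact ⟨w.2, (P.absorb d h).mem_verts.1 hw⟩
  · rintro ⟨h₁, h₂⟩
    exact ⟨⟨v, h₁⟩, (P.absorb d h).mem_verts.2 h₂, rfl⟩

theorem map_vertsIn_absorb (d : X.E × Bool) (h : X.vtx d ≠ X.vtx (opp d)) (l : List ι) :
    ((P.absorb d h).vertsIn l).map (Function.Embedding.subtype _) =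
      (P.vertsIn l).erase (X.vtx d) := by
  ext v
  rw [Finset.mem_erase, mem_vertsIn, Finset.mem_map]
  constructor
  · rintro ⟨w, hw, rfl⟩
    exact ⟨w.2, (P.absorb d h).mem_vertsIn.1 hw⟩
  · rintro ⟨h₁, h₂⟩
    exact ⟨⟨v, h₁⟩, (P.absorb d h).mem_vertsIn.2 h₂, rfl⟩

theorem prod_map_cross_absorb (d : X.E × Bool) (h : X.vtx d ≠ X.vtx (opp d)) (i : ι) {l : List ι}
    (hl : l.Nodup) : (l.map ((P.absorb d h).cross i)).prod =
      ∏ u ∈ (P.verts i).erase (X.vtx d), ∏ v ∈ (P.vertsIn l).erase (X.vtx d),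
        if v < u then -1 else 1 := by
  rw [prod_map_cross _ _ hl, ← P.map_verts_absorb d h, ← P.map_vertsIn_absorb d h,
    Finset.prod_map]
  refine Finset.prod_congr rfl fun u _ => ?_
  rw [Finset.prod_map]
  rfl

/-- The sign of moving a vertex before all vertices with values in a list. -/
def belowIn (l : List ι) (a : X.V) : ℤˣ := ∏ v ∈ P.vertsIn l, if v < a then -1 else 1

theorem belowIn_cons {i : ι} {l : List ι} (h : i ∉ l) (a : X.V) :
    P.belowIn (i :: l) a = (∏ v ∈ P.verts i, if v < a then -1 else 1) * P.belowIn l a := by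
  rw [belowIn, vertsIn_cons, Finset.prod_union (P.verts_disjoint_vertsIn h)]
  rfl

/-- Removing a vertex of the part `i` removes its crossings with the vertices of `l`, which are
those below it. -/
theorem prod_map_cross_of_eq {d : X.E × Bool} (h : X.vtx d ≠ X.vtx (opp d)) {i : ι} {l : List ι}
    (hl : (i :: l).Nodup) (hi : P.edge d.1 = i) : (l.map (P.cross i)).prod =
      P.belowIn l (X.vtx d) * (l.map ((P.absorb d h).cross i)).prod := by
  rw [List.nodup_cons] at hl
  have h₁ : X.vtx d ∈ P.verts i := P.mem_verts.2 ((P.idx_vtx d).trans hi)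
  have h₂ : X.vtx d ∉ P.vertsIn l := Finset.disjoint_left.1 (P.verts_disjoint_vertsIn hl.1) h₁
  rw [prod_map_cross_absorb _ _ _ _ hl.2, prod_map_cross _ _ hl.2, Finset.erase_eq_of_notMem h₂,
    ← Finset.mul_prod_erase _ _ h₁]
  rfl

/-- The removed vertex lies in `l` and crosses the vertices of part `i` above it. Counting those
below instead introduces -1 for every vertex of the part, which is the Koszul sign of an odd
derivation passing the factor `i`. -/
theorem prod_map_cross_of_mem {d : X.E × Bool} (h : X.vtx d ≠ X.vtx (opp d)) {i : ι} {l : List ι}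
    (hl : (i :: l).Nodup) (hi : P.edge d.1 ∈ l) : (l.map (P.cross i)).prod =
      (-1) ^ (P.verts i).card * (∏ v ∈ P.verts i, if v < X.vtx d then -1 else 1) *
        (l.map ((P.absorb d h).cross i)).prod := by
  rw [List.nodup_cons] at hl
  have h₁ : X.vtx d ∈ P.vertsIn l := P.mem_vertsIn.2 (by rwa [P.idx_vtx d])
  have h₂ : X.vtx d ∉ P.verts i := Finset.disjoint_right.1 (P.verts_disjoint_vertsIn hl.1) h₁
  rw [prod_map_cross_absorb _ _ _ _ hl.2, prod_map_cross _ _ hl.2, Finset.erase_eq_of_notMem h₂,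
    ← Finset.prod_const, ← Finset.prod_mul_distrib, ← Finset.prod_mul_distrib]
  refine Finset.prod_congr rfl fun u hu => ?_
  rw [← Finset.mul_prod_erase _ _ h₁]
  congr 1
  have : u ≠ X.vtx d := fun e => h₂ (e ▸ hu)
  rcases lt_or_gt_of_ne this with h | h <;> simp [h, h.not_gt]

theorem prod_absorb_of_notMem {d : X.E × Bool} (h : X.vtx d ≠ X.vtx (opp d)) {l : List ι}
    (hl : l.Nodup) (hi : P.edge d.1 ∉ l) : (P.absorb d h).prod l = P.prod l := by
  induction l with
  | nil => rfl
  | cons i l ih =>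
    rw [List.mem_cons, not_or] at hi
    have hl' := List.nodup_cons.1 hl
    obtain ⟨f, hf⟩ := P.exists_iso_fiber_absorb_of_ne h hi.1
    have h₁ : X.vtx d ∉ P.verts i := fun h => hi.1 ((P.idx_vtx d).symm.trans (P.mem_verts.1 h))
    have h₂ : X.vtx d ∉ P.vertsIn l := fun h => hi.2 (P.idx_vtx d ▸ P.mem_vertsIn.1 h)
    rw [prod_cons, prod_cons, ih hl'.2 hi.2, cls_eq_of_iso f, hf, one_smul,
      prod_map_cross_absorb _ _ _ _ hl'.2, prod_map_cross _ _ hl'.2, Finset.erase_eq_of_notMem h₁,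
      Finset.erase_eq_of_notMem h₂]

end Splitting

end OGraph

/-! ### The component map and the projections commute with the boundary operators. -/

section ChainMap

open scoped Classical

variable {k : Type*} [Field k] {O : CyclicOperad k}

open SymGraph OGraph

theorem graphBoundary_mem_primitive (x : Primitive O) : graphBoundary O x ∈ Primitive O := by
  induction x using Primitive.induction with
  | h X hX =>
    change graphBoundary O X.cls ∈ _
    rw [graphBoundary_cls]
    exact Submodule.sum_mem _ fun e _ => contracted_mem_primitive hX e
  | hadd x y hx hy => rw [Submodule.coe_add, map_add]; exact Submodule.add_mem _ hx hy
  | hsmul c x hx => rw [Submodule.coe_smul, map_smul]; exact Submodule.smul_mem _ _ hx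
  | hzero => rw [Submodule.coe_zero, map_zero]; exact Submodule.zero_mem _

theorem componentMap_cls_of_connected {X : OGraph O} (hX : X.Connected) :
    componentMap O X.cls = SymGraph.ι O (X.prim hX) := by
  let P : Splitting X Unit := ⟨fun _ => (), fun _ => rfl⟩
  obtain ⟨g, hg⟩ := exists_iso_sign_eq_one (X := X) (Y := P.fiber ()) (Function.Embedding.refl _)
    (P.fiberDart ()) (Equiv.subtypeUnivEquiv fun _ => rfl).symm
    (Equiv.subtypeUnivEquiv fun _ => rfl).symm (fun _ _ h => h) (fun _ => rfl)
    (fun v => (P.loc_fiber () ⟨v, rfl⟩).trans (Loc.push_refl _).symm)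
  have h' := componentMap_eq_prod P (fun _ => g.connected hX) (l := [()]) (by simp) (by simp)
  rw [h', Splitting.prod_cons, ← extendι_cls hX, cls_eq_of_iso g, hg]
  simp [Splitting.prod]

theorem componentMap_primitive (x : Primitive O) : componentMap O x = SymGraph.ι O x := by
  induction x using Primitive.induction with
  | h X hX => exact componentMap_cls_of_connected hX
  | hadd x y hx hy => rw [Submodule.coe_add, map_add, map_add, hx, hy]
  | hsmul c x hx => rw [Submodule.coe_smul, map_smul, map_smul, hx]
  | hzero => rw [Submodule.coe_zero, map_zero, map_zero]

theorem componentMap_cls_mem_degree (X : OGraph O) :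
    componentMap O X.cls ∈ degree O (Fintype.card X.V) := by
  obtain ⟨n, P, hP⟩ := X.exists_splitting
  obtain ⟨f⟩ := P.exists_iso_disjointUnion
  rw [cls_eq_of_iso f, map_units_smul, Units.smul_def,
    isComponentMap_componentMap O n P.fiber hP]
  refine zsmul_mem ?_ _
  have h := prod_mem_degree (List.ofFn fun j => (⟨P.fiber j, hP j⟩ : {X : OGraph O // X.Connected}))
  have e : Fintype.card X.V = ∑ j, Fintype.card (P.fiber j).V :=
    (Fintype.card_congr (Equiv.sigmaFiberEquiv P.idx).symm).trans
      (Fintype.card_sigma.trans (Finset.sum_congr rfl fun _ _ => Fintype.card_congr (Equiv.refl _)))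
  rw [List.map_ofFn, List.sum_ofFn] at h
  rw [e]
  exact h

theorem componentMap_contracted_mem_degree (X : OGraph O) (e : X.E) {n : ℕ}
    (hn : Fintype.card X.V = n + 1) : componentMap O (X.contracted e) ∈ degree O n := by
  by_cases he : X.IsLoop e
  · rw [contracted_of_isLoop X he, map_zero]
    exact Submodule.zero_mem _
  · have h := absorb_ne_of_not_isLoop he false
    rw [contracted_eq X (e, false) h, map_units_smul, Units.smul_def]
    have hc := card_absorb h
    rw [hn, Nat.add_right_cancel_iff] at hc
    rw [← hc]
    exact zsmul_mem (componentMap_cls_mem_degree _) _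

theorem exists_card_eq {X : OGraph O} (hX : X.Connected) : ∃ n, Fintype.card X.V = n + 1 :=
  have := hX.1
  Nat.exists_eq_succ_of_ne_zero Fintype.card_ne_zero

theorem neg_one_pow_add_two (n : ℕ) : (-1 : k) ^ n = (-1 : k) ^ (n + 1 + 1) := by
  rw [pow_succ, pow_succ, mul_assoc]
  simp

theorem symBoundary_spec : IsGradedDerivation 1 (symBoundary O) ∧
    ∀ x, symBoundary O (SymGraph.ι O x) = componentMap O (graphBoundary O x) := by
  refine extendDerivation_spec 1 _ fun X hX => ?_
  obtain ⟨n, hn⟩ := exists_card_eq hX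
  -- Contraction lowers the number n + 1 of vertices by one, and n has the parity of (n + 1) + 1
  -- required of an odd derivation.
  refine ⟨n, ?_, by rw [hn]; exact neg_one_pow_add_two n⟩
  change componentMap O (graphBoundary O X.cls) ∈ _
  rw [graphBoundary_cls, OGraph.boundary, map_sum]
  exact Submodule.sum_mem _ fun e _ => componentMap_contracted_mem_degree X e hn

variable (O) in
theorem isGradedDerivation_symBoundary : IsGradedDerivation 1 (symBoundary O) := symBoundary_spec.1

theorem symBoundary_ι (x : Primitive O) :
    symBoundary O (SymGraph.ι O x) = SymGraph.ι O ⟨_, graphBoundary_mem_primitive x⟩ :=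
  (symBoundary_spec.2 x).trans (componentMap_primitive ⟨_, graphBoundary_mem_primitive x⟩)

/-- Contractions of connected graphs remain connected, so the number of factors does not change;
this makes the projections chain maps. -/
theorem symBoundary_mem_power {i : ℕ} {z : SymGraph O} (hz : z ∈ power O i) :
    symBoundary O z ∈ power O i := by
  induction hz using Submodule.span_induction with
  | mem z hz =>
    obtain ⟨l, rfl, rfl⟩ := hz
    induction l with
    | nil =>
      have : symBoundary O (SymGraph.prod []) = 0 := (isGradedDerivation_symBoundary O).map_one
      rw [this]
      exact Submodule.zero_mem _
    | cons X l ih =>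
      rw [SymGraph.prod_cons, (isGradedDerivation_symBoundary O).ι_mul, symBoundary_ι]
      refine Submodule.add_mem _ ?_ (Submodule.smul_mem _ _ ?_)
      · exact ι_mul_mem_power (Submodule.subset_span ⟨l, rfl, rfl⟩) _
      · exact ι_mul_mem_power ih _
  | zero => rw [map_zero]; exact Submodule.zero_mem _
  | add a b _ _ ha hb => rw [map_add]; exact Submodule.add_mem _ ha hb
  | smul c a _ ha => rw [map_smul]; exact Submodule.smul_mem _ _ ha

theorem symBoundary_proj (i : ℕ) (z : SymGraph O) :
    symBoundary O (proj O i z) = proj O i (symBoundary O z) := by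
  refine LinearMap.congr_fun (f := symBoundary O ∘ₗ proj O i) (g := proj O i ∘ₗ symBoundary O)
    (SymGraph.hom_ext fun l => ?_) z
  have h : SymGraph.prod l ∈ power O l.length := Submodule.subset_span ⟨l, rfl, rfl⟩
  rw [LinearMap.comp_apply, LinearMap.comp_apply, proj_prod,
    proj_of_mem_power (symBoundary_mem_power h)]
  split_ifs
  · rfl
  · exact map_zero _

namespace OGraph.Splitting

variable {X : OGraph O} {ι : Type} (P : Splitting X ι)

/-- The contribution of an edge to the boundary of a product of components. -/
def boundaryTerm (l : List ι) (e : X.E) : SymGraph O :=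
  if h : X.vtx (e, false) ≠ X.vtx (opp (e, false)) then
    P.belowIn l (X.vtx (e, false)) • (P.absorb (e, false) h).prod l else 0

/-- The edge lies in a later factor: the first factor is unchanged, and the sign for passing it is
that of the Leibniz rule, by `prod_map_cross_of_mem`. -/
theorem boundaryTerm_cons_of_mem (hP : ∀ i, (P.fiber i).Connected) {i : ι} {l : List ι}
    (hl : (i :: l).Nodup) {e : X.E} (he : P.edge e ∈ l) :
    P.boundaryTerm (i :: l) e = (l.map (P.cross i)).prod •
      ((-1 : k) ^ (1 * Fintype.card (P.fiber i).V) •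
        (SymGraph.ι O ((P.fiber i).prim (hP i)) * P.boundaryTerm l e)) := by
  rw [boundaryTerm, boundaryTerm]
  split_ifs with h
  · have hi : P.edge e ≠ i := fun h => (List.nodup_cons.1 hl).1 (h ▸ he)
    obtain ⟨f, hf⟩ := P.exists_iso_fiber_absorb_of_ne (d := (e, false)) h hi
    have hc := cls_eq_of_iso f
    rw [hf, one_smul] at hc
    rw [prod_cons, ← hc, extendι_cls (hP i), one_mul, ← units_pow_smul, mul_smul_comm, smul_smul,
      smul_smul, smul_smul, P.belowIn_cons (List.nodup_cons.1 hl).1,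
      P.prod_map_cross_of_mem h hl he, card_fiber]
    congr 1
    generalize ((-1 : ℤˣ) ^ (P.verts i).card) = a
    have ha : a * a = 1 := Int.units_mul_self a
    generalize (∏ v ∈ P.verts i, if v < X.vtx (e, false) then (-1 : ℤˣ) else 1) = b
    generalize P.belowIn l (X.vtx (e, false)) = c
    generalize (l.map ((P.absorb (e, false) h).cross i)).prod = q
    calc b * c * q = (a * a) * (b * q * c) := by rw [ha, one_mul]; ac_rfl
      _ = _ := by ac_rfl
  · rw [mul_zero, smul_zero]
    exact (smul_zero _).symm

theorem belowSign_fiber (i : ι) (v : (P.fiber i).V) :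
    belowSign v = ∏ w ∈ P.verts i, if w < v.1 then -1 else 1 := by
  rw [← P.map_fiberVert i, Finset.prod_map]
  rfl

/-- The edge lies in the first factor. The vertices below its start in that component give the sign
of the contraction there, and those in other components are absorbed by the crossing signs. -/
theorem boundaryTerm_cons_of_eq (hP : ∀ i, (P.fiber i).Connected) {i : ι} {l : List ι}
    (hl : (i :: l).Nodup) (e : (P.fiber i).E) :
    P.boundaryTerm (i :: l) e.1 = (l.map (P.cross i)).prod •
      (componentMap O ((P.fiber i).contracted e) * P.prod l) := by
  have hi : P.edge e.1 ∉ l := fun h => (List.nodup_cons.1 hl).1 (e.2 ▸ h)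
  by_cases he : (P.fiber i).IsLoop e
  · rw [contracted_of_isLoop _ he, map_zero, zero_mul]
    refine Eq.trans ?_ (smul_zero _).symm
    exact dif_neg (not_not.2 (congrArg Subtype.val he))
  · have h := absorb_ne_of_not_isLoop he false
    have h' : X.vtx (e.1, false) ≠ X.vtx (opp (e.1, false)) := fun h' => h (Subtype.ext h')
    obtain ⟨f, hf⟩ := P.exists_iso_fiber_absorb (d := (e, false)) h h'
    have hc := cls_eq_of_iso f
    rw [hf, one_smul] at hc
    have hs : (P.fiber i).dartSign (e, false) =
        ∏ w ∈ P.verts i, if w < X.vtx (e.1, false) then -1 else 1 :=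
      (one_mul _).trans (P.belowSign_fiber i _)
    rw [contracted_eq (P.fiber i) (e, false) h, map_units_smul,
      componentMap_cls_of_connected (OGraph.absorb_connected (hP i) h),
      ← extendι_cls (OGraph.absorb_connected (hP i) h), hc, hs,
      P.prod_map_cross_of_eq (d := (e.1, false)) h' hl e.2, boundaryTerm, dif_pos h', prod_cons,
      P.belowIn_cons (List.nodup_cons.1 hl).1,
      P.prod_absorb_of_notMem (d := (e.1, false)) h' (List.nodup_cons.1 hl).2 hi, smul_mul_assoc,
      smul_smul, smul_smul]
    congr 1
    ac_rfl

/-- Induction with the Leibniz rule: edges of the first component and edges of the others account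
for its two summands. -/
theorem symBoundary_prod (hP : ∀ i, (P.fiber i).Connected) {l : List ι} (hl : l.Nodup) :
    symBoundary O (P.prod l) =
      ∑ e ∈ Finset.univ.filter (fun e => P.edge e ∈ l), P.boundaryTerm l e := by
  induction l with
  | nil => simpa [prod] using (isGradedDerivation_symBoundary O).map_one
  | cons i l ih =>
    have h₃ : (Finset.univ.filter fun e => P.edge e ∈ i :: l) =
        (Finset.univ.filter fun e => P.edge e = i) ∪
          Finset.univ.filter fun e => P.edge e ∈ l := by
      ext v
      simp
    have h₄ : Disjoint (Finset.univ.filter fun e => P.edge e = i)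
        (Finset.univ.filter fun e => P.edge e ∈ l) := by
      rw [Finset.disjoint_left]
      intro v h₁ h₂
      simp only [Finset.mem_filter] at h₁ h₂
      exact (List.nodup_cons.1 hl).1 (h₁.2 ▸ h₂.2)
    rw [h₃, Finset.sum_union h₄, prod_cons, map_units_smul, extendι_cls (hP i),
      (isGradedDerivation_symBoundary O).ι_mul, ih (List.nodup_cons.1 hl).2, symBoundary_spec.2]
    refine (smul_add _ _ _).trans (congrArg₂ (· + ·) ?_ ?_)
    · have e₁ : graphBoundary O ((P.fiber i).prim (hP i)) = (P.fiber i).boundary :=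
        graphBoundary_cls _
      rw [e₁, OGraph.boundary, map_sum, Finset.sum_mul, Finset.smul_sum]
      refine (Finset.sum_congr rfl fun e _ => (P.boundaryTerm_cons_of_eq hP hl e).symm).trans ?_
      exact (Finset.sum_subtype _ (by simp) (fun e => P.boundaryTerm (i :: l) e)).symm
    · rw [Finset.mul_sum, Finset.smul_sum, Finset.smul_sum]
      refine Finset.sum_congr rfl fun e he => ?_
      exact (P.boundaryTerm_cons_of_mem hP hl (Finset.mem_filter.1 he).2).symm

end OGraph.Splitting

/-- Both sides are sums over the edges. Contracting an edge leaves the division into components as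
it is, so the terms can be compared one by one. -/
theorem symBoundary_componentMap (z : GraphSpace O) :
    symBoundary O (componentMap O z) = componentMap O (graphBoundary O z) := by
  refine LinearMap.congr_fun (f := symBoundary O ∘ₗ componentMap O)
    (g := componentMap O ∘ₗ graphBoundary O) (GraphSpace.hom_ext fun X => ?_) z
  obtain ⟨n, P, hP⟩ := X.exists_splitting
  have hn := List.nodup_finRange n
  rw [LinearMap.comp_apply, LinearMap.comp_apply,
    componentMap_eq_prod P hP hn List.mem_finRange, P.symBoundary_prod hP hn, graphBoundary_cls,
    OGraph.boundary, map_sum]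
  refine Finset.sum_congr (by simp) fun e _ => ?_
  by_cases he : X.IsLoop e
  · rw [contracted_of_isLoop _ he, map_zero]
    exact dif_neg (not_not.2 he)
  · have h := absorb_ne_of_not_isLoop he false
    rw [contracted_eq X (e, false) h, map_units_smul,
      componentMap_eq_prod (P.absorb _ h) (P.absorb_connected hP h) hn List.mem_finRange,
      Splitting.boundaryTerm, dif_pos h]
    congr 1
    -- For the list of all components every vertex is counted, and the dart at the start of the edge
    -- carries no additional sign.
    rw [Splitting.belowIn, Splitting.vertsIn, OGraph.dartSign]
    simp [belowSign]

end ChainMap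

/-! ### The null-homotopy on the symmetric algebra. -/

section Main

open scoped Classical

variable {k : Type*} [Field k] {O : CyclicOperad k}

open SymGraph OGraph

theorem fission_spec (i : ℕ) [NeZero i] : IsGradedDerivation 1 (fission O i) ∧
    ∀ x : Primitive O, fission O i (SymGraph.ι O x) =
      (2 : k)⁻¹ • SymGraph.proj O i (componentMap O (polygonOp O i x)) := by
  refine extendDerivation_spec 1 _ fun X hX => ?_
  obtain ⟨n, hn⟩ := exists_card_eq hX
  refine ⟨n, ?_, by rw [hn]; exact neg_one_pow_add_two n⟩
  change (2 : k)⁻¹ • SymGraph.proj O i (componentMap O (polygonOp O i X.cls)) ∈ _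
  refine Submodule.smul_mem _ _ (proj_mem_degree i ?_)
  rw [polygonOp_cls, attachContract, map_sum]
  exact Submodule.sum_mem _ fun p _ => componentMap_contracted_mem_degree (X.attach p) _ hn

theorem fissionHomotopy_mem_degree (i : ℕ) (X : OGraph O) :
    (2 * i : k)⁻¹ • SymGraph.proj O i (componentMap O (attachOp O i X.cls)) ∈
      degree O (Fintype.card X.V) := by
  refine Submodule.smul_mem _ _ (proj_mem_degree i ?_)
  rw [attachOp_cls, attachSum, map_sum]
  exact Submodule.sum_mem _ fun p _ => componentMap_cls_mem_degree (X.attach p)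

theorem fissionHomotopy_spec (i : ℕ) [NeZero i] : IsGradedDerivation 0 (fissionHomotopy O i) ∧
    ∀ x : Primitive O, fissionHomotopy O i (SymGraph.ι O x) =
      (2 * i : k)⁻¹ • SymGraph.proj O i (componentMap O (attachOp O i x)) :=
  extendDerivation_spec 0 _ fun X _ =>
    ⟨Fintype.card X.V, fissionHomotopy_mem_degree i X, rfl⟩

theorem symBoundary_ι_mem_degree {X : OGraph O} (hX : X.Connected) {n : ℕ}
    (hn : Fintype.card X.V = n + 1) : symBoundary O (SymGraph.ι O (X.prim hX)) ∈ degree O n := by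
  rw [symBoundary_spec.2]
  change componentMap O (graphBoundary O X.cls) ∈ _
  rw [graphBoundary_cls, OGraph.boundary, map_sum]
  exact Submodule.sum_mem _ fun e _ => componentMap_contracted_mem_degree X e hn

/-- On generators this is ∂_G² = 0 on graphs. In the square of an odd derivation on a product, the
mixed terms occur with the signs (-1)^n and (-1)^(n + 1) and cancel. -/
theorem symBoundary_symBoundary [CharZero k] : symBoundary O ∘ₗ symBoundary O = 0 := by
  have hD := isGradedDerivation_symBoundary O
  refine SymGraph.hom_ext fun l => ?_
  induction l with
  | nil =>
    have : symBoundary O (SymGraph.prod []) = 0 := hD.map_one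
    rw [LinearMap.comp_apply, this, map_zero]
    rfl
  | cons X l ih =>
    obtain ⟨X, hX⟩ := X
    obtain ⟨n, hn⟩ := exists_card_eq hX
    rw [LinearMap.zero_apply, LinearMap.comp_apply] at ih ⊢
    have h : symBoundary O (symBoundary O (SymGraph.ι O (X.prim hX))) = 0 := by
      rw [symBoundary_spec.2, symBoundary_componentMap]
      have := LinearMap.congr_fun (graphBoundary_graphBoundary (O := O)) (X.prim hX)
      rw [LinearMap.comp_apply, LinearMap.zero_apply] at this
      rw [this, map_zero]
    rw [SymGraph.prod_cons, hD.ι_mul, map_add, map_smul, hD n _ (symBoundary_ι_mem_degree hX hn),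
      hD.ι_mul, h, ih, hn, mul_zero, smul_zero, add_zero, zero_mul, zero_add, ← add_smul, one_mul,
      one_mul, pow_succ, mul_neg_one, add_neg_cancel, zero_smul]

/-- Both derivations agree on generators: the factor 1/2 compensates ∂_1 = 2 ∂_G, and π_1 does
nothing because contractions of a connected graph are connected. -/
theorem fission_one [CharZero k] : fission O 1 = symBoundary O := by
  refine (fission_spec 1).1.ext (isGradedDerivation_symBoundary O) fun X hX => ?_
  rw [(fission_spec 1).2, polygonOp_one, symBoundary_ι, LinearMap.smul_apply, map_nsmul, map_nsmul,
    componentMap_primitive ⟨_, graphBoundary_mem_primitive (X.prim hX)⟩]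
  have : SymGraph.ι O ⟨_, graphBoundary_mem_primitive (X.prim hX)⟩ ∈ power O (0 + 1) := by
    have := ι_mul_mem_power (O := O) (i := 0) (z := 1) (Submodule.subset_span ⟨[], rfl, rfl⟩)
      ⟨_, graphBoundary_mem_primitive (X.prim hX)⟩
    rwa [mul_one] at this
  rw [proj_of_mem_power this, if_pos rfl, ← Nat.cast_smul_eq_nsmul k, smul_smul]
  norm_num

/-- On generators this is the identity of `graphBoundary_attachOp`, pushed through S and π_i. On
products both sides obey the same Leibniz rule, since the mixed terms of the commutator cancel. -/
theorem fission_eq [CharZero k] (i : ℕ) [NeZero i] : fission O i =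
    symBoundary O ∘ₗ fissionHomotopy O i - fissionHomotopy O i ∘ₗ symBoundary O := by
  have hD := isGradedDerivation_symBoundary O
  have hθ := (fission_spec (O := O) i).1
  have hν := (fissionHomotopy_spec (O := O) i).1
  refine SymGraph.hom_ext fun l => ?_
  induction l with
  | nil =>
    have h₁ : symBoundary O (SymGraph.prod []) = 0 := hD.map_one
    have h₂ : fissionHomotopy O i (SymGraph.prod []) = 0 := hν.map_one
    have h₃ : fission O i (SymGraph.prod []) = 0 := hθ.map_one
    rw [LinearMap.sub_apply, LinearMap.comp_apply, LinearMap.comp_apply, h₁, h₂, h₃, map_zero,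
      map_zero, sub_zero]
  | cons X l ih =>
    obtain ⟨X, hX⟩ := X
    obtain ⟨n, hn⟩ := exists_card_eq hX
    rw [LinearMap.sub_apply, LinearMap.comp_apply, LinearMap.comp_apply] at ih ⊢
    have hi : (i : k) ≠ 0 := Nat.cast_ne_zero.2 (NeZero.ne i)
    have h : fission O i (SymGraph.ι O (X.prim hX)) =
        symBoundary O (fissionHomotopy O i (SymGraph.ι O (X.prim hX))) -
          fissionHomotopy O i (symBoundary O (SymGraph.ι O (X.prim hX))) := by
      rw [symBoundary_ι, (fissionHomotopy_spec i).2, (fissionHomotopy_spec i).2,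
        (fission_spec i).2, map_smul, symBoundary_proj, symBoundary_componentMap,
        graphBoundary_attachOp, map_add, map_add, smul_add, add_sub_cancel_right, map_nsmul,
        map_nsmul, ← Nat.cast_smul_eq_nsmul k, smul_smul]
      -- The i positions of the contracted polygon edge turn the normalization 1/(2i) of the
      -- homotopy into the factor 1/2 of the fission operator.
      congr 1
      field_simp
    -- The homotopy preserves the number of vertices, so the boundary passes its value with the same
    -- sign as it passes `X`.
    have hνX : fissionHomotopy O i (SymGraph.ι O (X.prim hX)) ∈ degree O (Fintype.card X.V) := by
      rw [(fissionHomotopy_spec i).2]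
      exact fissionHomotopy_mem_degree i X
    rw [SymGraph.prod_cons, hθ.ι_mul, hν.ι_mul, hD.ι_mul, map_add, map_add, map_smul, map_smul,
      hD _ _ hνX, hD.ι_mul, hν.ι_mul, hν n _ (symBoundary_ι_mem_degree hX hn), ih, h]
    simp only [zero_mul, pow_zero, one_smul, sub_mul, mul_sub, smul_add, smul_sub]
    abel

theorem symBoundary_fission_add [CharZero k] (i : ℕ) [NeZero i] :
    symBoundary O ∘ₗ fission O i + fission O i ∘ₗ symBoundary O = 0 := by
  have h : ∀ z, symBoundary O (symBoundary O z) = 0 :=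
    fun z => LinearMap.congr_fun symBoundary_symBoundary z
  ext z
  simp [fission_eq, h]

theorem homologyMap_fission [CharZero k] (i : ℕ) [NeZero i]
    (h : symBoundary O ∘ₗ fission O i + fission O i ∘ₗ symBoundary O = 0) :
    homologyMap (symBoundary O) (fission O i) h = 0 := by
  refine LinearMap.ext fun z => ?_
  obtain ⟨⟨z, hz⟩, rfl⟩ := Submodule.mkQ_surjective _ z
  refine (Submodule.Quotient.mk_eq_zero _).2 ?_
  -- On a cycle the second term of the commutator vanishes, so the homotopy provides a primitive.
  refine ⟨fissionHomotopy O i z, ?_⟩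
  change _ = fission O i z
  rw [LinearMap.mem_ker] at hz
  rw [fission_eq, LinearMap.sub_apply, LinearMap.comp_apply, LinearMap.comp_apply, hz, map_zero,
    sub_zero]

end Main

end

theorem mainTheorem7 {k : Type*} [Field k] [CharZero k] (O : CyclicOperad k) :
    -- all the operators are well defined, and given by their defining formulas
    (∀ X : OGraph O, graphBoundary O X.cls = X.boundary) ∧
    (∀ (i : ℕ) [NeZero i] (X : OGraph O), polygonOp O i X.cls = X.attachContract i) ∧
    (∀ (i : ℕ) [NeZero i] (X : OGraph O), attachOp O i X.cls = X.attachSum i) ∧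
    IsComponentMap O (componentMap O) ∧
    (IsGradedDerivation 1 (symBoundary O) ∧
      ∀ x : Primitive O, ∃ h : graphBoundary O x ∈ Primitive O,
        symBoundary O (SymGraph.ι O x) = SymGraph.ι O ⟨graphBoundary O x, h⟩) ∧
    (∀ (i : ℕ) [NeZero i], IsGradedDerivation 1 (fission O i) ∧
      ∀ x : Primitive O, fission O i (SymGraph.ι O x) =
        (2 : k)⁻¹ • SymGraph.proj O i (componentMap O (polygonOp O i x))) ∧
    (∀ (i : ℕ) [NeZero i], IsGradedDerivation 0 (fissionHomotopy O i) ∧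
      ∀ x : Primitive O, fissionHomotopy O i (SymGraph.ι O x) =
        (2 * i : k)⁻¹ • SymGraph.proj O i (componentMap O (attachOp O i x))) ∧
    -- the graph complex and its symmetric algebra are complexes, and `θ_1 = ∂_G`
    graphBoundary O ∘ₗ graphBoundary O = 0 ∧
    symBoundary O ∘ₗ symBoundary O = 0 ∧
    fission O 1 = symBoundary O ∧
    ∀ (i : ℕ) [NeZero i],
      (∀ x : Primitive O, fission O i (SymGraph.ι O x) ∈ SymGraph.power O i ∧
        fissionHomotopy O i (SymGraph.ι O x) ∈ SymGraph.power O i) ∧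
      -- `θ_i` is compatible with the boundary operator and induces zero on homology
      (∃ h : symBoundary O ∘ₗ fission O i + fission O i ∘ₗ symBoundary O = 0,
        homologyMap (symBoundary O) (fission O i) h = 0) ∧
      -- canonically: attaching a polygon without contraction is a null-homotopy
      fission O i = symBoundary O ∘ₗ fissionHomotopy O i - fissionHomotopy O i ∘ₗ symBoundary O := by
  have h : ∀ (i : ℕ) [NeZero i], symBoundary O ∘ₗ fission O i + fission O i ∘ₗ symBoundary O = 0 :=
    fun i _ => symBoundary_fission_add i
  refine ⟨graphBoundary_cls, fun i _ => polygonOp_cls i, fun i _ => attachOp_cls i,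
    isComponentMap_componentMap O, ⟨isGradedDerivation_symBoundary O,
      fun x => ⟨graphBoundary_mem_primitive x, symBoundary_ι x⟩⟩, fun i _ => fission_spec i,
    fun i _ => fissionHomotopy_spec i, graphBoundary_graphBoundary, symBoundary_symBoundary,
    fission_one, fun i _ => ⟨fun x => ⟨?_, ?_⟩, ⟨h i, homologyMap_fission i (h i)⟩, fission_eq i⟩⟩
  · rw [(fission_spec i).2]
    exact Submodule.smul_mem _ _ (SymGraph.proj_mem_power i _)
  · rw [(fissionHomotopy_spec i).2]
    exact Submodule.smul_mem _ _ (SymGraph.proj_mem_power i _)
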